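/- Let $p,q\ge1$ and let $(X_j)_{j\ge1}$, $X_j=(X_j^{(1)},\dots,X_j^{(p)})$, be a stationary $p$-dimensional Gaussian process with $EX_1^{(i)}=0$, $EX_1^{(i)}X_1^{(i')}=\delta_{ii'}$ and $$EX_1^{(i)}X_{k+1}^{(i')}=c_{ii'}L(k)k^{-D}\qquad(k\ge1,\ 1\le i,i'\le p),$$ where $0<D<1$, $L$ is slowly varying at infinity, and $c_{ii'}\in\mathbb R$ are constants with $c_{11}\neq0$. Let $G:\mathbb R^p\to\mathbb R^q$ be measurable, $Y_j=G(X_j)$, and $F(x)=P(Y_1\le x)$ (with $\le$ understood coordinatewise). Let $H_n(y)=(-1)^ne^{y^2/2}\frac{d^n}{dy^n}e^{-y^2/2}$, $H_{l_1,\dots,l_p}(s)=\prod_{i=1}^pH_{l_i}(s^{(i)})$ and $J_{l_1,\dots,l_p}(x)=E\big(1_{\{Y_1\le x\}}H_{l_1,\dots,l_p}(X_1)\big)$. Let $m$ be the Hermite rank of $(1_{\{G(\cdot)\le x\}}-F(x))_{x\in\mathbb R^q}$, that is, the smallest total degree $l_1+\dots+l_p$ for which $E\big((1_{\{Y_1\le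 x\}}-F(x))H_{l_1,\dots,l_p}(X_1)\big)\ne0$ for some $x\in\mathbb R^q$; assume that $m$ is finite and that $D<1/m$. Put $d_N^2=\operatorname{Var}\big(\sum_{j=1}^NH_m(X_j^{(1)})\big)$. Then there exist constants $C,\kappa>0$ such that for all $N\ge1$ and all $0<\varepsilon\le1$ $$P\Biggl(\max_{1\le n\le N}\ \sup_{x\in[-\infty,\infty]^q}d_N^{-1}\Biggl|\sum_{j=1}^n\Bigl(1_{\{Y_j\le x\}}-F(x)-\sum_{l_1+\dots+l_p=m}\frac{J_{l_1,\dots,l_p}(x)}{l_1!\cdots l_p!}H_{l_1,\dots,l_p}(X_j)\Bigr)\Biggr|>\varepsilon\Biggr)\le CN^{-\kappa}(1+\varepsilon^{-3}).$$ -/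

import Mathlib

open MeasureTheory ProbabilityTheory Filter Topology

/-- `L` is slowly varying at infinity (Karamata): measurable, positive near infinity, and
`L (a * t) / L t → 1` as `t → ∞` for every `a > 0`. -/
def SlowlyVarying (L : ℝ → ℝ) : Prop :=
  Measurable L ∧ (∀ᶠ t in atTop, 0 < L t) ∧
    ∀ a : ℝ, 0 < a → Tendsto (fun t => L (a * t) / L t) atTop (𝓝 1)

/-- A sequence of random elements is (strictly) stationary: every shift has the same law as
the sequence itself. -/
def StationarySeq {Ω E : Type*} [MeasurableSpace Ω] [MeasurableSpace E]
    (X : ℕ → Ω → E) (μ : Measure Ω) : Prop :=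
  ∀ k : ℕ, IdentDistrib (fun ω j => X (j + k) ω) (fun ω j => X j ω) μ μ

/-- The probabilists' Hermite polynomial
`H_n(y) = (-1)^n exp(y^2/2) (d/dy)^n exp(-y^2/2)` as a real function. -/
noncomputable def hermiteFn (n : ℕ) (y : ℝ) : ℝ :=
  Polynomial.aeval y (Polynomial.hermite n)

/-- The multivariate Hermite polynomial `H_{l_1,…,l_p}(s) = H_{l_1}(s_1) ⋯ H_{l_p}(s_p)`. -/
noncomputable def hermiteMv {p : ℕ} (l : Fin p → ℕ) (s : Fin p → ℝ) : ℝ :=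
  ∏ i, hermiteFn (l i) (s i)

/-- The orthant `{y ∈ ℝ^q : y ≤ x}` for `x ∈ [-∞,∞]^q`. -/
def lowerOrthant {q : ℕ} (x : Fin q → EReal) : Set (Fin q → ℝ) :=
  {y | ∀ i, (y i : EReal) ≤ x i}

/-- The indicator `1_{y ≤ x}`. -/
noncomputable def orthantInd {q : ℕ} (x : Fin q → EReal) (y : Fin q → ℝ) : ℝ :=
  (lowerOrthant x).indicator (fun _ => 1) y

section

variable {Ω : Type*} [MeasurableSpace Ω] {p q : ℕ}

/-- The distribution function `F(x) = P(Y ≤ x)`, `x ∈ [-∞,∞]^q`, of a random vector `Y`. -/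
noncomputable def distFn (μ : Measure Ω) (Y : Ω → Fin q → ℝ) (x : Fin q → EReal) : ℝ :=
  μ.real {ω | Y ω ∈ lowerOrthant x}

/-- The Hermite coefficient `E[f(ξ) H_l(ξ)]` of `f` (for a standard normal vector `ξ`). -/
noncomputable def hermiteCoeff (μ : Measure Ω) (ξ : Ω → Fin p → ℝ)
    (f : (Fin p → ℝ) → ℝ) (l : Fin p → ℕ) : ℝ :=
  ∫ ω, f (ξ ω) * hermiteMv l (ξ ω) ∂μ

/-- The Hermite rank of `f`: the largest `k` such that all coefficients of `f` of total degree
less than `k` vanish (`⊤` if all coefficients vanish). -/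
noncomputable def hermiteRank (μ : Measure Ω) (ξ : Ω → Fin p → ℝ)
    (f : (Fin p → ℝ) → ℝ) : ℕ∞ :=
  sSup {k : ℕ∞ | ∀ l : Fin p → ℕ, ((∑ i, l i : ℕ) : ℕ∞) < k → hermiteCoeff μ ξ f l = 0}

/-- The Hermite rank of the class `(1_{G(·) ≤ x} - F(x))`, `x ∈ ℝ^q`: the minimum of the
pointwise Hermite ranks, where `F` is the distribution function of `G(ξ)`. -/
noncomputable def classHermiteRank (μ : Measure Ω) (ξ : Ω → Fin p → ℝ)
    (G : (Fin p → ℝ) → (Fin q → ℝ)) : ℕ∞ :=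
  ⨅ x : Fin q → ℝ, hermiteRank μ ξ fun s =>
    orthantInd (fun i => (x i : EReal)) (G s)
      - distFn μ (fun ω => G (ξ ω)) (fun i => (x i : EReal))

/-- `J_l(x) = E[1_{G(ξ) ≤ x} H_l(ξ)]`, `x ∈ [-∞,∞]^q`. -/
noncomputable def Jcoeff (μ : Measure Ω) (ξ : Ω → Fin p → ℝ)
    (G : (Fin p → ℝ) → (Fin q → ℝ)) (l : Fin p → ℕ) (x : Fin q → EReal) : ℝ :=
  hermiteCoeff μ ξ (fun s => orthantInd x (G s)) l

/-- `1_{G(X_j) ≤ x} - F(x) - ∑_{l_1+…+l_p=m} J_l(x) / (l_1! ⋯ l_p!) H_l(X_j)` at `ω`. Indices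
start at `0`, so the marginal law is that of `X 0`. -/
noncomputable def reductionTerm (μ : Measure Ω) (X : ℕ → Ω → Fin p → ℝ)
    (G : (Fin p → ℝ) → (Fin q → ℝ)) (m j : ℕ) (x : Fin q → EReal) (ω : Ω) : ℝ :=
  orthantInd x (G (X j ω)) - distFn μ (fun ω' => G (X 0 ω')) x
    - ∑ l ∈ Finset.piAntidiag (Finset.univ : Finset (Fin p)) m,
        Jcoeff μ (X 0) G l x / (∏ i, ((l i).factorial : ℝ)) * hermiteMv l (X j ω)

/-- The normalization `d_N = (Var ∑_{j ≤ N} H_m(X_j^{(1)}))^{1/2}`. -/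
noncomputable def dNorm [NeZero p] (μ : Measure Ω) (X : ℕ → Ω → Fin p → ℝ) (m N : ℕ) : ℝ :=
  Real.sqrt (variance (fun ω => ∑ j ∈ Finset.range N, hermiteFn m (X j ω 0)) μ)

end

/-! Let ν be the law of G(ξ), ξ standard normal in ℝ^p. Every summand is R_A(X_j) with A = {y ≤ x},
where R_A is the indicator of {G ∈ A} minus its mean and its Hermite component of degree m
(`setRemainder`, `reductionTerm_eq`). The coefficients of degrees 1, …, m - 1 vanish for orthants,
hence for all Borel sets A by a π-λ argument. So R_A has no component of degree at most m, and
‖R_A‖² ≤ ν(A).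

Covariances (`abs_integral_mul_le_of_gaussian_pair`). If all cross-covariances of two standard
normal vectors are at most θ/p, the pair has the law of √θ Z + √(1-θ) V, where Z is a correlated
pair and V an independent pair with independent halves. Integrating out V replaces f by its image
under an Ornstein-Uhlenbeck operator. If f has no component of degree below M, the squared norm of
this image is O(θ^M ‖f‖²); the proof truncates the Mehler kernel and uses Bessel's identity, so
completeness of the Hermite system is not needed. With M = m + 1 and bounds of power type for L, the
covariance of R_A at lag k is O(ν(A) k^{-s}) for every s < D(m+1). Hence, if also s < 1, E(∑_{j∈I}
R_A(X_j))² ≤ B ν(A) |I| N^{1-s} for I ⊆ [0, N), with B independent of A. On the other hand d_N² ≥ b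
N^{2-t} for large N whenever Dm < t < 1. Because D < 1/m, one can take Dm < t < s < min(1, D(m+1)).

Chaining (`sq_sum_le_dyadic`, `exists_sq_sum_reductionTerm_le`). Each coordinate of ℝ^q is
discretized by quantiles into O(N²) levels. An initial segment of times times a discrete orthant is
a disjoint union of dyadic boxes, at most one for each of the (K+1)^{q+1} scales, K of order log N.
By Cauchy-Schwarz the squared sum is at most (K+1)^{q+1} times the sum of squares over all boxes, a
bound free of n and x. The second-moment estimate is additive over the boxes of one scale, since ∑
ν(cell) ≤ 1 and ∑ |block| = N, so the expectation is N^{2-s} up to logarithms. A general orthant is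
sandwiched between discrete ones; the correction is controlled by an envelope times √(q/N²), which
costs O(1) in mean square.

Markov's inequality then gives ε^{-2} N^{-(s-t)} up to logarithms, and half of the exponent s - t
absorbs these. -/

/-! ### One-dimensional Hermite polynomials and the Mehler kernel -/

/-- The Hermite polynomial as a real polynomial. -/
noncomputable def hermiteReal (n : ℕ) : Polynomial ℝ :=
  (Polynomial.hermite n).map (Int.castRingHom ℝ)

lemma hermiteFn_eq_eval (n : ℕ) (y : ℝ) : hermiteFn n y = (hermiteReal n).eval y := by
  simp [hermiteFn, hermiteReal, Polynomial.aeval_def, Polynomial.eval_map]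

lemma hermiteReal_zero : hermiteReal 0 = 1 := by
  simp [hermiteReal]

lemma hermiteReal_succ (n : ℕ) : hermiteReal (n + 1) =
    Polynomial.X * hermiteReal n - Polynomial.derivative (hermiteReal n) := by
  simp [hermiteReal, Polynomial.hermite_succ, Polynomial.derivative_map]

lemma derivative_hermiteReal_succ (n : ℕ) :
    Polynomial.derivative (hermiteReal (n + 1)) = (n + 1 : ℝ) • hermiteReal n := by
  induction n with
  | zero => simp [hermiteReal_succ, hermiteReal_zero]
  | succ n ih =>
    rw [hermiteReal_succ (n + 1), ih, Polynomial.derivative_sub, Polynomial.derivative_mul, ih,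
      Polynomial.derivative_smul, Polynomial.derivative_X, hermiteReal_succ n]
    simp only [Polynomial.smul_eq_C_mul]
    push_cast
    simp only [Polynomial.C_add, Polynomial.C_1]
    ring

lemma hermiteFn_zero (y : ℝ) : hermiteFn 0 y = 1 := by
  simp [hermiteFn_eq_eval, hermiteReal_zero]

lemma continuous_hermiteFn (n : ℕ) : Continuous (hermiteFn n) := by
  simp_rw [funext (hermiteFn_eq_eval n)]
  exact (hermiteReal n).continuous

/-- The exponent r is quantified inside the induction because Hölder's inequality, applied to y ·
y^n, doubles it at every step. -/
lemma memLp_pow_gaussianReal (n : ℕ) :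
    ∀ r : ENNReal, r ≠ ⊤ → MemLp (fun y : ℝ => y ^ n) r (gaussianReal 0 1) := by
  induction n with
  | zero => intro r hr; simpa using memLp_const (1 : ℝ)
  | succ n ih =>
    intro r hr
    have h2 : 2 * r ≠ ⊤ := ENNReal.mul_ne_top (by simp) hr
    have hh : ENNReal.HolderTriple (2 * r) (2 * r) r := by
      constructor
      rw [ENNReal.mul_inv (by simp) (by simp), ← two_mul, ← mul_assoc,
        ENNReal.mul_inv_cancel (by simp) (by simp), one_mul]
    have := MemLp.mul (hpqr := hh) (memLp_id_gaussianReal' (μ := 0) (v := 1) _ h2) (ih _ h2)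
    exact this.ae_eq (Eventually.of_forall fun y => (pow_succ y n).symm)

lemma memLp_polynomial_gaussianReal (q : Polynomial ℝ) (r : ENNReal) (hr : r ≠ ⊤) :
    MemLp (fun y : ℝ => q.eval y) r (gaussianReal 0 1) := by
  induction q using Polynomial.induction_on' with
  | add q₁ q₂ h₁ h₂ => exact (h₁.add h₂).ae_eq (Eventually.of_forall fun y => by simp)
  | monomial n c => simpa using (memLp_pow_gaussianReal n r hr).const_mul c

lemma integrable_polynomial_gaussianReal (q : Polynomial ℝ) :
    Integrable (fun y : ℝ => q.eval y) (gaussianReal 0 1) :=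
  memLp_one_iff_integrable.1 (memLp_polynomial_gaussianReal q 1 (by simp))

lemma hasDerivAt_gaussianPDFReal (y : ℝ) :
    HasDerivAt (gaussianPDFReal 0 1) (-y * gaussianPDFReal 0 1 y) y := by
  have h : HasDerivAt (fun x : ℝ => -(x - 0) ^ 2 / (2 * ((1 : NNReal) : ℝ))) (-y) y := by
    have := (((hasDerivAt_id y).sub_const 0).pow 2).neg.div_const (2 * ((1 : NNReal) : ℝ))
    refine this.congr_deriv ?_
    simp
    ring
  have := (h.exp).const_mul (√(2 * Real.pi * ((1 : NNReal) : ℝ)))⁻¹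
  rw [gaussianPDFReal_def]
  refine this.congr_deriv ?_
  simp only []
  ring

/-- Gaussian integration by parts for polynomials. -/
lemma integral_mul_eval_gaussianReal (q : Polynomial ℝ) :
    ∫ y, y * q.eval y ∂(gaussianReal 0 1) = ∫ y, q.derivative.eval y ∂(gaussianReal 0 1) := by
  have hi : ∀ r : Polynomial ℝ, Integrable (fun y => gaussianPDFReal 0 1 y * r.eval y) := by
    intro r
    have := integrable_polynomial_gaussianReal r
    rw [gaussianReal_of_var_ne_zero _ one_ne_zero,
      integrable_withDensity_iff_integrable_smul' (by fun_prop)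
        (Eventually.of_forall fun _ => gaussianPDF_lt_top)] at this
    simpa using this
  have h0 := integral_eq_zero_of_hasDerivAt_of_integrable
    (f := fun y => gaussianPDFReal 0 1 y * q.eval y)
    (f' := fun y => gaussianPDFReal 0 1 y * (q.derivative - Polynomial.X * q).eval y)
    (fun y => by
      refine ((hasDerivAt_gaussianPDFReal y).mul (q.hasDerivAt y)).congr_deriv ?_
      simp only [Polynomial.eval_sub, Polynomial.eval_mul, Polynomial.eval_X]
      ring) (hi _) (hi _)
  have h1 : ∫ y, (q.derivative - Polynomial.X * q).eval y ∂(gaussianReal 0 1) = 0 := by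
    rw [integral_gaussianReal_eq_integral_smul one_ne_zero]
    simpa using h0
  have h2 := integrable_polynomial_gaussianReal q.derivative
  have h3 := integrable_polynomial_gaussianReal (Polynomial.X * q)
  simp only [Polynomial.eval_sub] at h1
  rw [integral_sub h2 h3] at h1
  simp only [Polynomial.eval_mul, Polynomial.eval_X] at h1
  linarith

lemma integrable_eval_mul_eval_gaussianReal (q r : Polynomial ℝ) :
    Integrable (fun y : ℝ => q.eval y * r.eval y) (gaussianReal 0 1) := by
  simpa using integrable_polynomial_gaussianReal (q * r)

lemma integrable_hermiteFn_mul (n k : ℕ) :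
    Integrable (fun y => hermiteFn n y * hermiteFn k y) (gaussianReal 0 1) := by
  simpa [hermiteFn_eq_eval] using
    integrable_eval_mul_eval_gaussianReal (hermiteReal n) (hermiteReal k)

/-- Adjointness of creation and annihilation. -/
lemma integral_hermiteReal_succ_mul (n : ℕ) (q : Polynomial ℝ) :
    ∫ y, (hermiteReal (n + 1)).eval y * q.eval y ∂(gaussianReal 0 1) =
      ∫ y, (hermiteReal n).eval y * q.derivative.eval y ∂(gaussianReal 0 1) := by
  have h := integral_mul_eval_gaussianReal (hermiteReal n * q)
  simp only [Polynomial.derivative_mul, Polynomial.eval_add, Polynomial.eval_mul] at h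
  rw [integral_add (integrable_eval_mul_eval_gaussianReal _ _)
    (integrable_eval_mul_eval_gaussianReal _ _)] at h
  rw [hermiteReal_succ]
  simp only [Polynomial.eval_sub, Polynomial.eval_mul, Polynomial.eval_X, sub_mul]
  have h1 := integrable_eval_mul_eval_gaussianReal (Polynomial.X * hermiteReal n) q
  simp only [Polynomial.eval_mul, Polynomial.eval_X] at h1
  rw [integral_sub h1 (integrable_eval_mul_eval_gaussianReal _ _)]
  simp only [mul_assoc] at h ⊢
  linarith

/-- Adjointness turns one creation step on the left into a derivative on the right, which lowers
both indices by one and produces the factor k + 1; a constant on either side ends the descent. -/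
lemma integral_hermiteReal_mul (n : ℕ) : ∀ k,
    ∫ y, (hermiteReal n).eval y * (hermiteReal k).eval y ∂(gaussianReal 0 1) =
      if n = k then (n.factorial : ℝ) else 0 := by
  induction n with
  | zero =>
    intro k
    cases k with
    | zero => simp [hermiteReal_zero]
    | succ k =>
      have : ∀ y, (hermiteReal 0).eval y * (hermiteReal (k + 1)).eval y =
          (hermiteReal (k + 1)).eval y * (hermiteReal 0).eval y := fun y => mul_comm _ _
      simp_rw [this]
      rw [integral_hermiteReal_succ_mul]
      simp [hermiteReal_zero]
  | succ n ih =>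
    intro k
    rw [integral_hermiteReal_succ_mul]
    cases k with
    | zero => simp [hermiteReal_zero]
    | succ k =>
      rw [derivative_hermiteReal_succ]
      simp only [Polynomial.eval_smul, smul_eq_mul]
      simp_rw [mul_left_comm _ ((k : ℝ) + 1)]
      rw [integral_const_mul, ih]
      by_cases h : n = k
      · subst h; simp [Nat.factorial_succ]
      · simp [h]

lemma integral_hermiteFn_mul (n k : ℕ) :
    ∫ y, hermiteFn n y * hermiteFn k y ∂(gaussianReal 0 1) =
      if n = k then (n.factorial : ℝ) else 0 := by
  simp_rw [hermiteFn_eq_eval]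
  exact integral_hermiteReal_mul n k

/-- Hermite polynomials are eigenfunctions of the Ornstein-Uhlenbeck semigroup. -/
lemma integral_hermiteFn_comp (a b : ℝ) (hab : a ^ 2 + b ^ 2 = 1) (n : ℕ) (x : ℝ) :
    ∫ v, hermiteFn n (a * x + b * v) ∂(gaussianReal 0 1) = a ^ n * hermiteFn n x := by
  simp_rw [hermiteFn_eq_eval]
  induction n using Nat.strong_induction_on generalizing x with
  | _ n ih =>
    match n with
    | 0 => simp [hermiteReal_zero]
    | n + 1 =>
      -- Composition with this affine polynomial keeps all integrands polynomial in v, so Gaussian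
      -- integration by parts applies and each derivative brings out a factor b.
      let A : Polynomial ℝ := Polynomial.C (a * x) + Polynomial.C b * Polynomial.X
      have hA : ∀ (q : Polynomial ℝ) v, q.eval (a * x + b * v) = (q.comp A).eval v := by
        intro q v; simp [A, Polynomial.eval_comp]
      have hint : ∀ q : Polynomial ℝ,
          Integrable (fun v => q.eval (a * x + b * v)) (gaussianReal 0 1) := by
        intro q
        simp_rw [hA]
        exact integrable_polynomial_gaussianReal _
      have hst : ∀ q : Polynomial ℝ, ∫ v, v * q.eval (a * x + b * v) ∂(gaussianReal 0 1) =
          b * ∫ v, q.derivative.eval (a * x + b * v) ∂(gaussianReal 0 1) := by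
        intro q
        simp_rw [hA]
        rw [integral_mul_eval_gaussianReal, Polynomial.derivative_comp, ← integral_const_mul]
        simp [A]
      have hvint : ∀ q : Polynomial ℝ,
          Integrable (fun v => v * q.eval (a * x + b * v)) (gaussianReal 0 1) := by
        intro q
        simp_rw [hA]
        have := integrable_eval_mul_eval_gaussianReal Polynomial.X (q.comp A)
        simpa only [Polynomial.eval_X] using this
      -- Integrating b v by parts gives b² times the integral of the derivative; combined with the
      -- term -1 from the Hermite recursion this leaves b² - 1 = -a².
      have key : ∫ v, (hermiteReal (n + 1)).eval (a * x + b * v) ∂(gaussianReal 0 1) =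
          a * x * ∫ v, (hermiteReal n).eval (a * x + b * v) ∂(gaussianReal 0 1)
          - a ^ 2 *
            ∫ v, (hermiteReal n).derivative.eval (a * x + b * v) ∂(gaussianReal 0 1) := by
        have e : ∀ v, (hermiteReal (n + 1)).eval (a * x + b * v) =
            a * x * (hermiteReal n).eval (a * x + b * v)
            + b * (v * (hermiteReal n).eval (a * x + b * v))
            - (hermiteReal n).derivative.eval (a * x + b * v) := by
          intro v
          rw [hermiteReal_succ]
          simp only [Polynomial.eval_sub, Polynomial.eval_mul, Polynomial.eval_X]
          ring
        simp_rw [e]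
        have h1 := (hint (hermiteReal n)).const_mul (a * x)
        have h2 := (hvint (hermiteReal n)).const_mul b
        have h3 := integral_sub (h1.add h2) (hint (hermiteReal n).derivative)
        simp only [Pi.add_apply] at h3
        rw [h3, integral_add h1 h2, integral_const_mul, integral_const_mul, hst]
        have : b * b = 1 - a ^ 2 := by linarith [sq b]
        linear_combination (∫ v, (hermiteReal n).derivative.eval (a * x + b * v)
          ∂(gaussianReal 0 1)) * this
      rw [key, ih n (by omega)]
      match n with
      | 0 => simp [hermiteReal_zero, hermiteReal_succ]
      | n + 1 =>
        rw [derivative_hermiteReal_succ]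
        simp only [Polynomial.eval_smul, smul_eq_mul]
        rw [integral_const_mul, ih n (by omega), hermiteReal_succ (n + 1),
          derivative_hermiteReal_succ]
        simp only [Polynomial.eval_sub, Polynomial.eval_mul, Polynomial.eval_X,
          Polynomial.eval_smul, smul_eq_mul]
        ring

/-- The density of `N(a x, v)` with respect to `N(0, 1)`. -/
noncomputable def mehlerKernel (a : ℝ) (v : NNReal) (x y : ℝ) : ℝ :=
  gaussianPDFReal (a * x) v y / gaussianPDFReal 0 1 y

lemma mehlerKernel_nonneg (a : ℝ) (v : NNReal) (x y : ℝ) : 0 ≤ mehlerKernel a v x y :=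
  div_nonneg (gaussianPDFReal_nonneg _ _ _) (gaussianPDFReal_nonneg _ _ _)

lemma measurable_mehlerKernel (a : ℝ) (v : NNReal) (x : ℝ) : Measurable (mehlerKernel a v x) := by
  unfold mehlerKernel
  fun_prop

lemma withDensity_mehlerKernel (a : ℝ) {v : NNReal} (hv : v ≠ 0) (x : ℝ) :
    (gaussianReal 0 1).withDensity (fun y => ENNReal.ofReal (mehlerKernel a v x y)) =
      gaussianReal (a * x) v := by
  have hm := measurable_mehlerKernel a v x
  rw [gaussianReal_of_var_ne_zero _ one_ne_zero, gaussianReal_of_var_ne_zero _ hv,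
    ← withDensity_mul _ (by fun_prop) (by fun_prop)]
  congr 1
  ext y
  have hp := gaussianPDFReal_pos 0 1 y one_ne_zero
  simp only [Pi.mul_apply, gaussianPDF]
  rw [← ENNReal.ofReal_mul hp.le, mehlerKernel, mul_div_cancel₀ _ hp.ne']

lemma gaussianReal_map_affine (a b x : ℝ) {v : NNReal} (hb : (v : ℝ) = b ^ 2) :
    (gaussianReal 0 1).map (fun z => a * x + b * z) = gaussianReal (a * x) v := by
  have : (fun z : ℝ => a * x + b * z) = (fun z => a * x + z) ∘ fun z => b * z := rfl
  rw [this, ← Measure.map_map (by fun_prop) (by fun_prop), gaussianReal_map_const_mul,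
    gaussianReal_map_const_add]
  congr 1
  · ring
  · ext; simp [hb]

/-- The squared `L²`-norm of `mehlerKernel a v x`. -/
noncomputable def mehlerNormSq (a : ℝ) (v : NNReal) (x : ℝ) : ℝ :=
  (√(v : ℝ) * √(1 + a ^ 2))⁻¹ * Real.exp (a ^ 2 * x ^ 2 / (1 + a ^ 2))

/-- Completing the square in y: the exponent of φ K² is again quadratic, with centre 2ax/(1+a²) and
variance v/(1+a²). The L²-norm of the kernel is then read off from the total mass one of a Gaussian
density. -/
lemma gaussianPDFReal_mul_mehlerKernel_sq {a : ℝ} {v w : NNReal} (hv : v ≠ 0)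
    (hva : (v : ℝ) = 1 - a ^ 2) (hw : (w : ℝ) = v / (1 + a ^ 2)) (x y : ℝ) :
    gaussianPDFReal 0 1 y * mehlerKernel a v x y ^ 2 =
      mehlerNormSq a v x * gaussianPDFReal (2 * a * x / (1 + a ^ 2)) w y := by
  have hv' : (0 : ℝ) < v := by exact_mod_cast pos_iff_ne_zero.2 hv
  have h1 : (0 : ℝ) < 1 + a ^ 2 := by positivity
  have hpi : 0 < 2 * Real.pi := by positivity
  rw [mehlerKernel, div_pow, sq (gaussianPDFReal 0 1 y), ← mul_div_assoc,
    mul_div_mul_left _ _ (gaussianPDFReal_pos 0 1 y one_ne_zero).ne', mehlerNormSq]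
  simp only [gaussianPDFReal, hw]
  have hs1 : √(2 * Real.pi * (v : ℝ)) = √(2 * Real.pi) * √(v : ℝ) := Real.sqrt_mul hpi.le _
  have hs2 : √(2 * Real.pi * ((v : ℝ) / (1 + a ^ 2))) =
      √(2 * Real.pi) * (√(v : ℝ) / √(1 + a ^ 2)) := by
    rw [Real.sqrt_mul hpi.le, Real.sqrt_div hv'.le]
  have p1 := Real.sqrt_pos.2 hpi
  have p2 := Real.sqrt_pos.2 hv'
  have p3 := Real.sqrt_pos.2 h1
  have hexp : Real.exp (-(y - a * x) ^ 2 / (2 * (v : ℝ))) ^ 2 =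
      Real.exp (-(y - 0) ^ 2 / (2 * ((1 : NNReal) : ℝ))) *
      (Real.exp (a ^ 2 * x ^ 2 / (1 + a ^ 2)) *
      Real.exp (-(y - 2 * a * x / (1 + a ^ 2)) ^ 2 / (2 * ((v : ℝ) / (1 + a ^ 2))))) := by
    rw [sq, ← Real.exp_add, ← Real.exp_add, ← Real.exp_add]
    congr 1
    rw [hva] at hv' ⊢
    have := hv'.ne'
    have := h1.ne'
    simp only [NNReal.coe_one]
    field_simp
    ring
  rw [mul_pow, hexp, hs1, hs2, NNReal.coe_one, mul_one]
  have pe := Real.exp_pos (-(y - 0) ^ 2 / (2 * ((1 : NNReal) : ℝ)))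
  rw [NNReal.coe_one] at pe
  have := pe.ne'
  field_simp

lemma exists_pos_coe_div {v : NNReal} (hv : v ≠ 0) {c : ℝ} (hc : 0 < c) :
    ∃ w : NNReal, w ≠ 0 ∧ (w : ℝ) = v / c := by
  have hv' : (0 : ℝ) < v := by exact_mod_cast pos_iff_ne_zero.2 hv
  refine ⟨⟨v / c, by positivity⟩, ?_, rfl⟩
  intro h
  have : (v : ℝ) / c = 0 := congrArg NNReal.toReal h
  have := div_pos hv' hc
  linarith

lemma integrable_mehlerKernel_sq {a : ℝ} {v : NNReal} (hv : v ≠ 0)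
    (hva : (v : ℝ) = 1 - a ^ 2) (x : ℝ) :
    Integrable (fun y => mehlerKernel a v x y ^ 2) (gaussianReal 0 1) := by
  obtain ⟨w, hw0, hw⟩ := exists_pos_coe_div hv (c := 1 + a ^ 2) (by positivity)
  rw [gaussianReal_of_var_ne_zero _ one_ne_zero,
      integrable_withDensity_iff_integrable_smul' (by fun_prop)
        (Eventually.of_forall fun _ => gaussianPDF_lt_top)]
  simp only [toReal_gaussianPDF, smul_eq_mul]
  simp_rw [gaussianPDFReal_mul_mehlerKernel_sq hv hva hw]
  exact (integrable_gaussianPDFReal _ _).const_mul _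

lemma integral_mehlerKernel_sq {a : ℝ} {v : NNReal} (hv : v ≠ 0)
    (hva : (v : ℝ) = 1 - a ^ 2) (x : ℝ) :
    ∫ y, mehlerKernel a v x y ^ 2 ∂(gaussianReal 0 1) = mehlerNormSq a v x := by
  obtain ⟨w, hw0, hw⟩ := exists_pos_coe_div hv (c := 1 + a ^ 2) (by positivity)
  rw [integral_gaussianReal_eq_integral_smul one_ne_zero]
  simp only [smul_eq_mul]
  simp_rw [gaussianPDFReal_mul_mehlerKernel_sq hv hva hw]
  rw [integral_const_mul, integral_gaussianPDFReal_eq_one _ hw0, mul_one]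

/-- The same device in the variable x: the Gaussian weight beats the growth exp(a²x²/(1+a²)), and
the product is a multiple of the centred density of variance (1+a²)/v. This makes the Mehler kernel
Hilbert-Schmidt with squared norm 1/(1-a²). -/
lemma gaussianPDFReal_mul_mehlerNormSq {a : ℝ} {v w : NNReal} (hv : v ≠ 0)
    (hva : (v : ℝ) = 1 - a ^ 2) (hw : (w : ℝ) = (1 + a ^ 2) / v) (x : ℝ) :
    gaussianPDFReal 0 1 x * mehlerNormSq a v x = (v : ℝ)⁻¹ * gaussianPDFReal 0 w x := by
  have hv' : (0 : ℝ) < v := by exact_mod_cast pos_iff_ne_zero.2 hv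
  have h1 : (0 : ℝ) < 1 + a ^ 2 := by positivity
  have hpi : 0 < 2 * Real.pi := by positivity
  simp only [gaussianPDFReal, mehlerNormSq, hw]
  have hs2 : √(2 * Real.pi * ((1 + a ^ 2) / (v : ℝ))) =
      √(2 * Real.pi) * (√(1 + a ^ 2) / √(v : ℝ)) := by
    rw [Real.sqrt_mul hpi.le, Real.sqrt_div h1.le]
  have p1 := Real.sqrt_pos.2 hpi
  have p2 := Real.sqrt_pos.2 hv'
  have p3 := Real.sqrt_pos.2 h1
  have hexp : Real.exp (-(x - 0) ^ 2 / (2 * ((1 : NNReal) : ℝ))) *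
      Real.exp (a ^ 2 * x ^ 2 / (1 + a ^ 2)) =
      Real.exp (-(x - 0) ^ 2 / (2 * ((1 + a ^ 2) / (v : ℝ)))) := by
    rw [← Real.exp_add]
    congr 1
    rw [hva] at hv' ⊢
    have := hv'.ne'
    have := h1.ne'
    simp only [NNReal.coe_one]
    field_simp
    ring
  rw [← hexp, hs2, NNReal.coe_one, mul_one]
  have hsq : √(v : ℝ) * √(v : ℝ) = v := Real.mul_self_sqrt hv'.le
  field_simp
  rw [sq, hsq]

lemma integrable_mehlerNormSq {a : ℝ} {v : NNReal} (hv : v ≠ 0) (hva : (v : ℝ) = 1 - a ^ 2) :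
    Integrable (mehlerNormSq a v) (gaussianReal 0 1) := by
  have hv' : (0 : ℝ) < v := by exact_mod_cast pos_iff_ne_zero.2 hv
  have hw : (((⟨(1 + a ^ 2) / v, by positivity⟩ : NNReal)) : ℝ) = (1 + a ^ 2) / v := rfl
  rw [gaussianReal_of_var_ne_zero _ one_ne_zero,
      integrable_withDensity_iff_integrable_smul' (by fun_prop)
        (Eventually.of_forall fun _ => gaussianPDF_lt_top)]
  simp only [toReal_gaussianPDF, smul_eq_mul]
  simp_rw [gaussianPDFReal_mul_mehlerNormSq hv hva hw]
  exact (integrable_gaussianPDFReal _ _).const_mul _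

lemma integral_mehlerNormSq {a : ℝ} {v : NNReal} (hv : v ≠ 0) (hva : (v : ℝ) = 1 - a ^ 2) :
    ∫ x, mehlerNormSq a v x ∂(gaussianReal 0 1) = (1 - a ^ 2)⁻¹ := by
  have hv' : (0 : ℝ) < v := by exact_mod_cast pos_iff_ne_zero.2 hv
  have hw : (((⟨(1 + a ^ 2) / v, by positivity⟩ : NNReal)) : ℝ) = (1 + a ^ 2) / v := rfl
  have hw0 : (⟨(1 + a ^ 2) / v, by positivity⟩ : NNReal) ≠ 0 := by
    intro h
    have h2 : (1 + a ^ 2) / (v : ℝ) = 0 := congrArg NNReal.toReal h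
    have : 0 < (1 + a ^ 2) / (v : ℝ) := by positivity
    linarith
  rw [integral_gaussianReal_eq_integral_smul one_ne_zero]
  simp only [smul_eq_mul]
  simp_rw [gaussianPDFReal_mul_mehlerNormSq hv hva hw]
  rw [integral_const_mul, integral_gaussianPDFReal_eq_one _ hw0, mul_one, hva]

/-! ### Square-integrable functions -/

section L2

variable {α : Type*} [MeasurableSpace α] {ν : Measure α}

lemma integrable_mul_of_memLp_two {f g : α → ℝ} (hf : MemLp f 2 ν) (hg : MemLp g 2 ν) :
    Integrable (fun x => f x * g x) ν :=
  hf.integrable_mul hg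

/-- The quadratic polynomial t ↦ ∫ (t f + g)² is nonnegative, so its discriminant is not positive.
-/
lemma sq_integral_mul_le {f g : α → ℝ} (hf : MemLp f 2 ν) (hg : MemLp g 2 ν) :
    (∫ x, f x * g x ∂ν) ^ 2 ≤ (∫ x, f x ^ 2 ∂ν) * ∫ x, g x ^ 2 ∂ν := by
  have h : ∀ t : ℝ, 0 ≤ (∫ x, f x ^ 2 ∂ν) * (t * t) + (2 * ∫ x, f x * g x ∂ν) * t
      + ∫ x, g x ^ 2 ∂ν := by
    intro t
    have h0 : 0 ≤ ∫ x, (t * f x + g x) ^ 2 ∂ν := integral_nonneg fun x => sq_nonneg _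
    have e : ∀ x, (t * f x + g x) ^ 2 = t * t * f x ^ 2 + 2 * t * (f x * g x) + g x ^ 2 := by
      intro x; ring
    simp_rw [e] at h0
    have h1 := hf.integrable_sq.const_mul (t * t)
    have h2 := (integrable_mul_of_memLp_two hf hg).const_mul (2 * t)
    have h3 := integral_add (h1.add h2) hg.integrable_sq
    simp only [Pi.add_apply] at h3
    rw [h3, integral_add h1 h2, integral_const_mul, integral_const_mul] at h0
    linarith
  have := discrim_le_zero h
  simp only [discrim] at this
  nlinarith

/-- Bessel's identity for a finite orthogonal family. -/
lemma integral_sub_proj_sq {ι : Type*} [DecidableEq ι] (S : Finset ι) (e : ι → α → ℝ) (c : ι → ℝ)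
    (hc : ∀ l ∈ S, c l ≠ 0) (he : ∀ l ∈ S, MemLp (e l) 2 ν)
    (horth : ∀ l ∈ S, ∀ k ∈ S, ∫ x, e l x * e k x ∂ν = if l = k then c l else 0)
    {Q : α → ℝ} (hQ : MemLp Q 2 ν) {w : ι → ℝ} (hw : ∀ l ∈ S, ∫ x, Q x * e l x ∂ν = w l) :
    ∫ x, (Q x - ∑ l ∈ S, w l / c l * e l x) ^ 2 ∂ν = ∫ x, Q x ^ 2 ∂ν - ∑ l ∈ S, w l ^ 2 / c l := by
  set R : α → ℝ := fun x => ∑ l ∈ S, w l / c l * e l x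
  have hR : MemLp R 2 ν := memLp_finsetSum S fun l hl => (he l hl).const_mul _
  have hmulR : ∀ {g : α → ℝ}, MemLp g 2 ν →
      ∫ x, g x * R x ∂ν = ∑ l ∈ S, w l / c l * ∫ x, g x * e l x ∂ν := by
    intro g hg
    simp only [R, Finset.mul_sum]
    rw [integral_finsetSum S fun l hl => integrable_mul_of_memLp_two hg ((he l hl).const_mul _)]
    refine Finset.sum_congr rfl fun l _ => ?_
    rw [← integral_const_mul]
    congr 1; ext x; ring
  have hQR : ∫ x, Q x * R x ∂ν = ∑ l ∈ S, w l ^ 2 / c l := by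
    rw [hmulR hQ]
    refine Finset.sum_congr rfl fun l hl => ?_
    rw [hw l hl]; ring
  have hRR : ∫ x, R x * R x ∂ν = ∑ l ∈ S, w l ^ 2 / c l := by
    rw [hmulR hR]
    refine Finset.sum_congr rfl fun l hl => ?_
    have : ∫ x, R x * e l x ∂ν = w l := by
      rw [show ∫ x, R x * e l x ∂ν = ∫ x, e l x * R x ∂ν by congr 1; ext x; exact mul_comm _ _,
        hmulR (he l hl), Finset.sum_eq_single_of_mem l hl, horth l hl l hl, if_pos rfl,
        div_mul_cancel₀ _ (hc l hl)]
      intro k hk hkl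
      rw [horth l hl k hk, if_neg hkl.symm, mul_zero]
    rw [this]; ring
  have e : ∀ x, (Q x - R x) ^ 2 = Q x ^ 2 - 2 * (Q x * R x) + R x * R x := by intro x; ring
  change ∫ x, (Q x - R x) ^ 2 ∂ν = _
  simp_rw [e]
  have h2 := (integrable_mul_of_memLp_two hQ hR).const_mul 2
  have h3 := integral_add (hQ.integrable_sq.sub h2) (integrable_mul_of_memLp_two hR hR)
  simp only [Pi.sub_apply] at h3
  rw [h3, integral_sub hQ.integrable_sq h2, integral_const_mul, hQR, hRR]
  ring

end L2

/-! ### Multivariate Hermite polynomials and the Ornstein-Uhlenbeck semigroup -/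

/-- The standard Gaussian measure on `ℝ^p`. -/
noncomputable abbrev stdNormalPi (p : ℕ) : Measure (Fin p → ℝ) :=
  Measure.pi fun _ => gaussianReal 0 1

section Hermite

variable {p : ℕ}

lemma continuous_hermiteMv (l : Fin p → ℕ) : Continuous (hermiteMv l) :=
  continuous_finsetProd _ fun i _ => (continuous_hermiteFn (l i)).comp (continuous_apply i)

lemma hermiteMv_zero (s : Fin p → ℝ) : hermiteMv (fun _ => 0) s = 1 := by
  simp [hermiteMv, hermiteFn_zero]

lemma integrable_hermiteMv_mul (l k : Fin p → ℕ) :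
    Integrable (fun s => hermiteMv l s * hermiteMv k s) (stdNormalPi p) := by
  simp only [hermiteMv, ← Finset.prod_mul_distrib]
  exact Integrable.fintype_prod (f := fun i y => hermiteFn (l i) y * hermiteFn (k i) y)
    fun i => integrable_hermiteFn_mul _ _

lemma integral_hermiteMv_mul (l k : Fin p → ℕ) :
    ∫ s, hermiteMv l s * hermiteMv k s ∂(stdNormalPi p) =
      if l = k then ∏ i, ((l i).factorial : ℝ) else 0 := by
  simp only [hermiteMv, ← Finset.prod_mul_distrib]
  rw [integral_fintype_prod_eq_prod (fun i y => hermiteFn (l i) y * hermiteFn (k i) y)]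
  simp_rw [integral_hermiteFn_mul]
  rw [Finset.prod_ite_zero]
  simp [funext_iff]

lemma memLp_hermiteMv (l : Fin p → ℕ) : MemLp (hermiteMv l) 2 (stdNormalPi p) := by
  rw [memLp_two_iff_integrable_sq (continuous_hermiteMv l).aestronglyMeasurable]
  simpa [sq] using integrable_hermiteMv_mul l l

/-- The Mehler kernel on `ℝ^p`. -/
noncomputable def mehlerKernelPi (a : ℝ) (v : NNReal) (x y : Fin p → ℝ) : ℝ :=
  ∏ i, mehlerKernel a v (x i) (y i)

lemma mehlerKernelPi_nonneg (a : ℝ) (v : NNReal) (x y : Fin p → ℝ) : 0 ≤ mehlerKernelPi a v x y :=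
  Finset.prod_nonneg fun _ _ => mehlerKernel_nonneg _ _ _ _

lemma measurable_mehlerKernelPi (a : ℝ) (v : NNReal) (x : Fin p → ℝ) :
    Measurable (mehlerKernelPi a v x) :=
  Finset.measurable_prod _ fun i _ =>
    (measurable_mehlerKernel a v (x i)).comp (measurable_pi_apply i)

lemma memLp_mehlerKernelPi {a : ℝ} {v : NNReal} (hv : v ≠ 0) (hva : (v : ℝ) = 1 - a ^ 2)
    (x : Fin p → ℝ) : MemLp (mehlerKernelPi a v x) 2 (stdNormalPi p) := by
  rw [memLp_two_iff_integrable_sq (measurable_mehlerKernelPi a v x).aestronglyMeasurable]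
  simp only [mehlerKernelPi, ← Finset.prod_pow]
  exact Integrable.fintype_prod (f := fun i y => mehlerKernel a v (x i) y ^ 2)
    fun i => integrable_mehlerKernel_sq hv hva _

lemma integral_mehlerKernelPi_sq {a : ℝ} {v : NNReal} (hv : v ≠ 0) (hva : (v : ℝ) = 1 - a ^ 2)
    (x : Fin p → ℝ) :
    ∫ y, mehlerKernelPi a v x y ^ 2 ∂(stdNormalPi p) = ∏ i, mehlerNormSq a v (x i) := by
  simp only [mehlerKernelPi, ← Finset.prod_pow]
  rw [integral_fintype_prod_eq_prod (fun i y => mehlerKernel a v (x i) y ^ 2)]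
  simp_rw [integral_mehlerKernel_sq hv hva]

lemma integrable_mehlerKernel {a : ℝ} {v : NNReal} (hv : v ≠ 0) (hva : (v : ℝ) = 1 - a ^ 2)
    (x : ℝ) : Integrable (mehlerKernel a v x) (gaussianReal 0 1) :=
  ((memLp_two_iff_integrable_sq (measurable_mehlerKernel a v x).aestronglyMeasurable).2
    (integrable_mehlerKernel_sq hv hva x)).integrable one_le_two

lemma withDensity_mehlerKernelPi {a : ℝ} {v : NNReal} (hv : v ≠ 0) (hva : (v : ℝ) = 1 - a ^ 2)
    (x : Fin p → ℝ) :
    (stdNormalPi p).withDensity (fun y => ENNReal.ofReal (mehlerKernelPi a v x y)) =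
      Measure.pi fun i => gaussianReal (a * x i) v := by
  symm
  refine Measure.pi_eq fun s hs => ?_
  have hint : ∀ i, Integrable (mehlerKernel a v (x i)) ((gaussianReal 0 1).restrict (s i)) :=
    fun i => (integrable_mehlerKernel hv hva (x i)).restrict
  have h1 : Integrable (mehlerKernelPi a v x)
      (Measure.pi fun i => (gaussianReal 0 1).restrict (s i)) :=
    Integrable.fintype_prod (f := fun i => mehlerKernel a v (x i)) hint
  rw [withDensity_apply _ (MeasurableSet.univ_pi hs), Measure.restrict_pi_pi,
    ← ofReal_integral_eq_lintegral_ofReal h1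
      (Eventually.of_forall fun y => mehlerKernelPi_nonneg _ _ _ _)]
  simp only [mehlerKernelPi]
  rw [integral_fintype_prod_eq_prod (fun i => mehlerKernel a v (x i)), ENNReal.ofReal_prod_of_nonneg
    fun i _ => integral_nonneg fun y => mehlerKernel_nonneg _ _ _ _]
  refine Finset.prod_congr rfl fun i _ => ?_
  rw [ofReal_integral_eq_lintegral_ofReal (hint i)
    (Eventually.of_forall fun y => mehlerKernel_nonneg _ _ _ _), ← withDensity_apply _ (hs i),
    withDensity_mehlerKernel a hv]

lemma stdNormalPi_map_affine {a b : ℝ} {v : NNReal} (hb : (v : ℝ) = b ^ 2) (x : Fin p → ℝ) :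
    (stdNormalPi p).map (fun z i => a * x i + b * z i) =
      Measure.pi fun i => gaussianReal (a * x i) v := by
  have (i : Fin p) : IsProbabilityMeasure
      ((gaussianReal 0 1).map (fun z => a * x i + b * z)) := by
    rw [gaussianReal_map_affine a b _ hb]; infer_instance
  rw [stdNormalPi, Measure.pi_map_pi (f := fun i z => a * x i + b * z)
    (fun i => Measurable.aemeasurable (by fun_prop))]
  simp_rw [gaussianReal_map_affine a b _ hb]

/-- The Ornstein-Uhlenbeck operator `(P f)(x) = E f(a x + b Z)`. -/
noncomputable def ouOp (a b : ℝ) (f : (Fin p → ℝ) → ℝ) (x : Fin p → ℝ) : ℝ :=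
  ∫ z, f (fun i => a * x i + b * z i) ∂(stdNormalPi p)

/-- The vector a x + b Z has independent N(a x_i, b²) coordinates, and the Mehler kernel is the
density of this law with respect to the standard one. -/
lemma ouOp_eq_integral_mehlerKernelPi {a b : ℝ} {v : NNReal} (hv : v ≠ 0)
    (hva : (v : ℝ) = 1 - a ^ 2) (hb : (v : ℝ) = b ^ 2) {f : (Fin p → ℝ) → ℝ} (hf : Measurable f)
    (x : Fin p → ℝ) :
    ouOp a b f x = ∫ y, mehlerKernelPi a v x y * f y ∂(stdNormalPi p) := by
  have hm : Measurable fun (z : Fin p → ℝ) i => a * x i + b * z i := by fun_prop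
  have h := integral_map hm.aemeasurable (μ := stdNormalPi p) (f := f) hf.aestronglyMeasurable
  rw [ouOp, ← h, stdNormalPi_map_affine hb, ← withDensity_mehlerKernelPi hv hva,
    integral_withDensity_eq_integral_toReal_smul
      ((measurable_mehlerKernelPi a v x).ennreal_ofReal)
      (Eventually.of_forall fun _ => ENNReal.ofReal_lt_top)]
  refine integral_congr_ae (Eventually.of_forall fun y => ?_)
  simp [ENNReal.toReal_ofReal (mehlerKernelPi_nonneg a v x y)]

lemma ouOp_hermiteMv {a b : ℝ} (hab : a ^ 2 + b ^ 2 = 1) (l : Fin p → ℕ) (x : Fin p → ℝ) :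
    ouOp a b (hermiteMv l) x = a ^ (∑ i, l i) * hermiteMv l x := by
  simp only [ouOp, hermiteMv]
  rw [integral_fintype_prod_eq_prod (fun i y => hermiteFn (l i) (a * x i + b * y))]
  simp_rw [integral_hermiteFn_comp a b hab]
  rw [Finset.prod_mul_distrib, Finset.prod_pow_eq_pow_sum]

/-- Multi-indices of total degree less than `M`. -/
def multiIndexLT (p M : ℕ) : Finset (Fin p → ℕ) :=
  (Fintype.piFinset fun _ : Fin p => Finset.range M).filter fun l => ∑ i, l i < M

lemma mem_multiIndexLT {M : ℕ} {l : Fin p → ℕ} : l ∈ multiIndexLT p M ↔ ∑ i, l i < M := by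
  simp only [multiIndexLT, Finset.mem_filter, Fintype.mem_piFinset, Finset.mem_range,
    and_iff_right_iff_imp]
  intro h i
  exact (Finset.single_le_sum (fun _ _ => Nat.zero_le _) (Finset.mem_univ i)).trans_lt h

lemma prod_factorial_pos (l : Fin p → ℕ) : 0 < ∏ i, ((l i).factorial : ℝ) :=
  Finset.prod_pos fun _ _ => by positivity

/-- The squared norm of the part of the Mehler kernel of degree at least `M`. -/
noncomputable def mehlerTail (a : ℝ) (v : NNReal) (M : ℕ) (x : Fin p → ℝ) : ℝ :=
  ∏ i, mehlerNormSq a v (x i) -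
    ∑ l ∈ multiIndexLT p M, (a ^ (∑ i, l i) * hermiteMv l x) ^ 2 / ∏ i, ((l i).factorial : ℝ)

/-- Since f is orthogonal to all Hermite polynomials of degree below M, the kernel K(x, ·) may be
replaced by its distance vector from their span before applying Cauchy-Schwarz. The Hermite
coefficients of K(x, ·) are a^{|l|} H_l(x) by the eigenfunction property, so Bessel's identity
evaluates the squared distance as `mehlerTail`. -/
lemma ouOp_sq_le {a b : ℝ} {v : NNReal} (hv : v ≠ 0) (hva : (v : ℝ) = 1 - a ^ 2)
    (hb : (v : ℝ) = b ^ 2) {f : (Fin p → ℝ) → ℝ} (hf : Measurable f)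
    (hf2 : MemLp f 2 (stdNormalPi p)) {M : ℕ}
    (hfM : ∀ l ∈ multiIndexLT p M, ∫ s, f s * hermiteMv l s ∂(stdNormalPi p) = 0)
    (x : Fin p → ℝ) :
    ouOp a b f x ^ 2 ≤ (∫ s, f s ^ 2 ∂(stdNormalPi p)) * mehlerTail a v M x := by
  set w : (Fin p → ℕ) → ℝ := fun l => a ^ (∑ i, l i) * hermiteMv l x
  set c : (Fin p → ℕ) → ℝ := fun l => ∏ i, ((l i).factorial : ℝ)
  have hK := memLp_mehlerKernelPi hv hva x
  have hw : ∀ l ∈ multiIndexLT p M,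
      ∫ y, mehlerKernelPi a v x y * hermiteMv l y ∂(stdNormalPi p) = w l := by
    intro l _
    rw [← ouOp_eq_integral_mehlerKernelPi hv hva hb (continuous_hermiteMv l).measurable,
      ouOp_hermiteMv (by linarith)]
  have hB := integral_sub_proj_sq (multiIndexLT p M) hermiteMv c
    (fun l _ => (prod_factorial_pos l).ne') (fun l _ => memLp_hermiteMv l)
    (fun l _ k _ => integral_hermiteMv_mul l k) hK hw
  rw [integral_mehlerKernelPi_sq hv hva] at hB
  have hR : MemLp (fun y => ∑ l ∈ multiIndexLT p M, w l / c l * hermiteMv l y) 2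
      (stdNormalPi p) := memLp_finsetSum _ fun l _ => (memLp_hermiteMv l).const_mul _
  have hdiff : ouOp a b f x = ∫ y, f y * (mehlerKernelPi a v x y -
      ∑ l ∈ multiIndexLT p M, w l / c l * hermiteMv l y) ∂(stdNormalPi p) := by
    simp_rw [mul_sub]
    rw [integral_sub (integrable_mul_of_memLp_two hf2 hK) (integrable_mul_of_memLp_two hf2 hR),
      ouOp_eq_integral_mehlerKernelPi hv hva hb hf]
    have h0 :
        ∫ y, f y * ∑ l ∈ multiIndexLT p M, w l / c l * hermiteMv l y ∂(stdNormalPi p) = 0 := by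
      simp_rw [Finset.mul_sum]
      rw [integral_finsetSum _ fun l _ =>
        integrable_mul_of_memLp_two hf2 ((memLp_hermiteMv l).const_mul _)]
      refine Finset.sum_eq_zero fun l hl => ?_
      simp_rw [mul_left_comm (f _)]
      rw [integral_const_mul, hfM l hl, mul_zero]
    rw [h0, sub_zero]
    simp_rw [mul_comm (f _)]
  rw [hdiff, mehlerTail, ← hB]
  exact sq_integral_mul_le hf2 (hK.sub hR)

lemma integrable_mehlerTail {a : ℝ} {v : NNReal} (hv : v ≠ 0) (hva : (v : ℝ) = 1 - a ^ 2)
    (M : ℕ) : Integrable (mehlerTail a v M : (Fin p → ℝ) → ℝ) (stdNormalPi p) := by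
  refine (Integrable.fintype_prod (f := fun _ : Fin p => mehlerNormSq a v)
    fun i => integrable_mehlerNormSq hv hva).sub (integrable_finsetSum _ fun l _ => ?_)
  exact ((memLp_hermiteMv l).const_mul _).integrable_sq.div_const _

/-- Each subtracted term integrates to a^{2|l|} because H_l² has mean ∏ l_i!. What remains is the
Hilbert-Schmidt norm of the operator restricted to degrees at least M. -/
lemma integral_mehlerTail {a : ℝ} {v : NNReal} (hv : v ≠ 0) (hva : (v : ℝ) = 1 - a ^ 2)
    (M : ℕ) : ∫ x, mehlerTail a v M x ∂(stdNormalPi p) =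
      (1 - a ^ 2)⁻¹ ^ p - ∑ l ∈ multiIndexLT p M, (a ^ 2) ^ (∑ i, l i) := by
  have hi : ∀ l : Fin p → ℕ, Integrable (fun x => (a ^ (∑ i, l i) * hermiteMv l x) ^ 2 /
      ∏ i, ((l i).factorial : ℝ)) (stdNormalPi p) :=
    fun l => ((memLp_hermiteMv l).const_mul _).integrable_sq.div_const _
  simp only [mehlerTail]
  rw [integral_sub (Integrable.fintype_prod (f := fun _ : Fin p => mehlerNormSq a v)
    fun i => integrable_mehlerNormSq hv hva) (integrable_finsetSum _ fun l _ => hi l),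
    integral_fintype_prod_eq_prod (fun _ : Fin p => mehlerNormSq a v),
    integral_finsetSum _ fun l _ => hi l]
  congr 1
  · simp [integral_mehlerNormSq hv hva]
  · refine Finset.sum_congr rfl fun l _ => ?_
    simp_rw [mul_pow]
    rw [integral_div, integral_const_mul]
    have h := integral_hermiteMv_mul l l
    rw [if_pos rfl] at h
    simp_rw [← sq] at h
    rw [h, mul_div_assoc, div_self (prod_factorial_pos l).ne', mul_one]
    ring

/-- The multiplicative constant in the tail bound for the Mehler kernel. -/
def mehlerConst (p M : ℕ) : ℝ := 2 ^ p * p + (M : ℝ) ^ p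

lemma mehlerConst_nonneg (p M : ℕ) : 0 ≤ mehlerConst p M := by
  unfold mehlerConst; positivity

/-- The power (1-u)^{-p} is the sum of u^{|l|} over all multi-indices. The indices outside the box
[0, M)^p contribute at most 2^p p u^M, by Bernoulli's inequality for (1-u^M)^p; inside the box at
most M^p indices have degree at least M, each contributing at most u^M. -/
lemma inv_pow_sub_sum_multiIndexLT_le {u : ℝ} (hu0 : 0 ≤ u) (hu : u ≤ 1 / 2) (M : ℕ) :
    (1 - u)⁻¹ ^ p - ∑ l ∈ multiIndexLT p M, u ^ (∑ i, l i) ≤ mehlerConst p M * u ^ M := by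
  have hbox : ∑ l ∈ Fintype.piFinset (fun _ : Fin p => Finset.range M), u ^ (∑ i, l i) =
      ((1 - u)⁻¹ * (1 - u ^ M)) ^ p := by
    have := Finset.prod_univ_sum (fun _ : Fin p => Finset.range M) (fun _ j => u ^ j)
    simp_rw [← Finset.prod_pow_eq_pow_sum]
    rw [← this, geom_sum_eq (by linarith)]
    simp only [Finset.prod_const, Finset.card_univ, Fintype.card_fin]
    congr 1
    rw [← neg_sub 1 (u ^ M), ← neg_sub 1 u, neg_div_neg_eq, div_eq_inv_mul]
  have hsplit := Finset.sum_filter_add_sum_filter_not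
    (Fintype.piFinset fun _ : Fin p => Finset.range M) (fun l => ∑ i, l i < M)
    (fun l => u ^ (∑ i, l i))
  rw [hbox] at hsplit
  have hrest : ∑ l ∈ (Fintype.piFinset fun _ : Fin p => Finset.range M).filter
      (fun l => ¬ ∑ i, l i < M), u ^ (∑ i, l i) ≤ (M : ℝ) ^ p * u ^ M := by
    calc _ ≤ ∑ l ∈ (Fintype.piFinset fun _ : Fin p => Finset.range M).filter
          (fun l => ¬ ∑ i, l i < M), u ^ M := by
          refine Finset.sum_le_sum fun l hl => ?_
          exact pow_le_pow_of_le_one hu0 (by linarith) (not_lt.1 (Finset.mem_filter.1 hl).2)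
      _ ≤ ∑ l ∈ Fintype.piFinset fun _ : Fin p => Finset.range M, u ^ M :=
          Finset.sum_le_sum_of_subset_of_nonneg (Finset.filter_subset _ _)
            fun _ _ _ => by positivity
      _ = (M : ℝ) ^ p * u ^ M := by simp
  have hb : 1 - (p : ℝ) * u ^ M ≤ (1 - u ^ M) ^ p := by
    have hle : u ^ M ≤ 1 := pow_le_one₀ hu0 (by linarith)
    have := one_add_mul_le_pow (a := -u ^ M) (by linarith) p
    rw [← sub_eq_add_neg] at this
    linarith
  have hinv : (1 - u)⁻¹ ≤ 2 := by
    rw [inv_le_comm₀ (by linarith) (by norm_num)]; linarith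
  have hinv0 : 0 ≤ (1 - u)⁻¹ := inv_nonneg.2 (by linarith)
  have hpow : (1 - u)⁻¹ ^ p ≤ 2 ^ p := pow_le_pow_left₀ hinv0 hinv p
  have hpow0 : 0 ≤ (1 - u)⁻¹ ^ p := by positivity
  have h1 : (1 - u)⁻¹ ^ p - ((1 - u)⁻¹ * (1 - u ^ M)) ^ p ≤ 2 ^ p * (p * u ^ M) := by
    rw [mul_pow]
    have huM : 0 ≤ (p : ℝ) * u ^ M := by positivity
    calc _ = (1 - u)⁻¹ ^ p * (1 - (1 - u ^ M) ^ p) := by ring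
      _ ≤ (1 - u)⁻¹ ^ p * (p * u ^ M) := by gcongr; linarith
      _ ≤ _ := by gcongr
  have : (1 - u)⁻¹ ^ p - ∑ l ∈ multiIndexLT p M, u ^ (∑ i, l i) ≤
      2 ^ p * (p * u ^ M) + (M : ℝ) ^ p * u ^ M := by
    simp only [multiIndexLT]
    linarith
  refine this.trans (le_of_eq ?_)
  simp only [mehlerConst]; ring

lemma measurable_ouOp (a b : ℝ) {f : (Fin p → ℝ) → ℝ} (hf : Measurable f) :
    StronglyMeasurable (ouOp a b f) := by
  refine StronglyMeasurable.integral_prod_right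
    (f := fun (x z : Fin p → ℝ) => f fun i => a * x i + b * z i) ?_
  refine (hf.comp ?_).stronglyMeasurable
  fun_prop

/-- Contraction of the Ornstein-Uhlenbeck operator on functions of Hermite rank at least `M`. -/
lemma integrable_ouOp_sq_and_integral_le {a b : ℝ} (hab : a ^ 2 + b ^ 2 = 1) (ha : a ^ 2 ≤ 1 / 2)
    {f : (Fin p → ℝ) → ℝ} (hf : Measurable f) (hf2 : MemLp f 2 (stdNormalPi p)) {M : ℕ}
    (hfM : ∀ l ∈ multiIndexLT p M, ∫ s, f s * hermiteMv l s ∂(stdNormalPi p) = 0) :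
    Integrable (fun x => ouOp a b f x ^ 2) (stdNormalPi p) ∧
      ∫ x, ouOp a b f x ^ 2 ∂(stdNormalPi p) ≤
        mehlerConst p M * (a ^ 2) ^ M * ∫ s, f s ^ 2 ∂(stdNormalPi p) := by
  obtain ⟨v, hv⟩ : ∃ v : NNReal, (v : ℝ) = b ^ 2 := ⟨⟨b ^ 2, sq_nonneg b⟩, rfl⟩
  have hva : (v : ℝ) = 1 - a ^ 2 := by linarith
  have hv0 : v ≠ 0 := by
    rintro rfl
    simp only [NNReal.coe_zero] at hva
    linarith
  have hle := ouOp_sq_le hv0 hva hv hf hf2 hfM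
  have hN := (integrable_mehlerTail (p := p) hv0 hva M).const_mul (∫ s, f s ^ 2 ∂(stdNormalPi p))
  have hi : Integrable (fun x => ouOp a b f x ^ 2) (stdNormalPi p) := by
    refine hN.mono' ((measurable_ouOp a b hf).aestronglyMeasurable.pow 2)
      (Eventually.of_forall fun x => ?_)
    rw [Real.norm_eq_abs, abs_of_nonneg (sq_nonneg _)]
    exact hle x
  refine ⟨hi, (integral_mono hi hN hle).trans ?_⟩
  rw [integral_const_mul, integral_mehlerTail hv0 hva, mul_comm]
  exact mul_le_mul_of_nonneg_right (inv_pow_sub_sum_multiIndexLT_le (sq_nonneg a) ha M)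
    (integral_nonneg fun _ => sq_nonneg _)

end Hermite

/-! ### Gaussian vectors -/

/-- The characteristic function of a centred Gaussian in direction L depends only on the variance of
L(W), which expands as a quadratic form in the second moments of the functionals `Z k` spanning L.
-/
lemma charFunDual_map_of_hasGaussianLaw {Ω E κ : Type*} [MeasurableSpace Ω]
    [NormedAddCommGroup E] [NormedSpace ℝ E] [MeasurableSpace E] [BorelSpace E]
    [SecondCountableTopology E] [CompleteSpace E] [Fintype κ]
    {P₁ : Measure Ω} {W₁ : Ω → E} (hW₁ : HasGaussianLaw W₁ P₁) {Z : κ → StrongDual ℝ E}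
    (h₁ : ∀ k, ∫ ω, Z k (W₁ ω) ∂P₁ = 0) (L : StrongDual ℝ E)
    (c : κ → ℝ) (hc : ∀ x, L x = ∑ k, c k * Z k x) :
    charFunDual (P₁.map W₁) L = Complex.exp (-((∑ k, ∑ l, c k * c l *
      ∫ ω, Z k (W₁ ω) * Z l (W₁ ω) ∂P₁ : ℝ) : ℂ) / 2) := by
  have := hW₁.isProbabilityMeasure
  have hm : ∀ k, MemLp (fun ω => Z k (W₁ ω)) 2 P₁ := fun k => (hW₁.map_fun (Z k)).memLp_two
  have hmean : ∫ ω, L (W₁ ω) ∂P₁ = 0 := by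
    simp_rw [hc]
    rw [integral_finsetSum _ fun k _ => ((hm k).integrable one_le_two).const_mul _]
    simp_rw [integral_const_mul, h₁, mul_zero, Finset.sum_const_zero]
  rw [hW₁.charFunDual_map_eq_fun, variance_eq_sub (hW₁.map_fun L).memLp_two, hmean]
  have hsq : ∫ ω, ((fun ω => L (W₁ ω)) ^ 2) ω ∂P₁ = ∑ k, ∑ l, c k * c l *
      ∫ ω, Z k (W₁ ω) * Z l (W₁ ω) ∂P₁ := by
    have e : ∀ ω, ((fun ω => L (W₁ ω)) ^ 2) ω =
        ∑ k, ∑ l, c k * c l * (Z k (W₁ ω) * Z l (W₁ ω)) := by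
      intro ω
      simp only [Pi.pow_apply]
      rw [hc, sq, Finset.sum_mul_sum]
      refine Finset.sum_congr rfl fun k _ => Finset.sum_congr rfl fun l _ => by ring
    simp_rw [e]
    have hi : ∀ k l, Integrable (fun ω => c k * c l * (Z k (W₁ ω) * Z l (W₁ ω))) P₁ :=
      fun k l => (integrable_mul_of_memLp_two (hm k) (hm l)).const_mul _
    rw [integral_finsetSum _ fun k _ => integrable_finsetSum _ fun l _ => hi k l]
    refine Finset.sum_congr rfl fun k _ => ?_
    rw [integral_finsetSum _ fun l _ => hi k l]
    simp_rw [integral_const_mul]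
  rw [hsq]
  congr 1
  push_cast
  ring

/-- A centred Gaussian law is determined by the second moments of its coordinates. -/
lemma map_eq_of_hasGaussianLaw {Ω Ω' E κ : Type*} [MeasurableSpace Ω] [MeasurableSpace Ω']
    [NormedAddCommGroup E] [NormedSpace ℝ E] [MeasurableSpace E] [BorelSpace E]
    [SecondCountableTopology E] [CompleteSpace E] [Fintype κ]
    {P : Measure Ω} {P' : Measure Ω'} {W : Ω → E} {W' : Ω' → E} (hW : HasGaussianLaw W P)
    (hW' : HasGaussianLaw W' P') (Z : κ → StrongDual ℝ E)
    (hspan : ∀ L : StrongDual ℝ E, ∃ c : κ → ℝ, ∀ x, L x = ∑ k, c k * Z k x)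
    (h0 : ∀ k, ∫ ω, Z k (W ω) ∂P = 0) (h0' : ∀ k, ∫ ω, Z k (W' ω) ∂P' = 0)
    (h2 : ∀ k l, ∫ ω, Z k (W ω) * Z l (W ω) ∂P = ∫ ω, Z k (W' ω) * Z l (W' ω) ∂P') :
    P.map W = P'.map W' := by
  have i1 := hW.isGaussian_map
  have i2 := hW'.isGaussian_map
  refine Measure.ext_of_charFunDual ?_
  ext L
  obtain ⟨c, hc⟩ := hspan L
  rw [charFunDual_map_of_hasGaussianLaw hW h0 L c hc,
    charFunDual_map_of_hasGaussianLaw hW' h0' L c hc]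
  simp_rw [h2]

section Pi

variable {ι : Type*} [Fintype ι] [DecidableEq ι]

lemma strongDual_pi_eq_sum (L : StrongDual ℝ (ι → ℝ)) :
    ∃ c : ι → ℝ, ∀ x, L x = ∑ k, c k * ContinuousLinearMap.proj (R := ℝ) (φ := fun _ => ℝ) k x := by
  refine ⟨fun k => L (Pi.single k 1), fun x => ?_⟩
  conv_lhs => rw [← Finset.univ_sum_single x]
  rw [map_sum]
  refine Finset.sum_congr rfl fun k _ => ?_
  have : Pi.single k (x k) = x k • (Pi.single k (1 : ℝ) : ι → ℝ) := by
    rw [← Pi.single_smul, smul_eq_mul, mul_one]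
  rw [this, map_smul, smul_eq_mul, mul_comm]
  rfl

omit [DecidableEq ι] in
lemma hasGaussianLaw_id_pi :
    HasGaussianLaw (id : (ι → ℝ) → ι → ℝ) (Measure.pi fun _ : ι => gaussianReal 0 1) := by
  have h := iIndepFun_pi (μ := fun _ : ι => gaussianReal 0 1) (X := fun _ => (id : ℝ → ℝ))
    fun _ => aemeasurable_id
  refine h.hasGaussianLaw fun i => ?_
  have : (Measure.pi fun _ : ι => gaussianReal 0 1).map (fun ω => id (ω i)) = gaussianReal 0 1 :=
    (measurePreserving_eval _ i).map_eq
  refine ⟨?_⟩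
  change IsGaussian ((Measure.pi fun _ : ι => gaussianReal 0 1).map (fun ω => id (ω i)))
  rw [this]
  infer_instance

omit [DecidableEq ι] in
lemma integral_eval_pi_gaussian (i : ι) :
    ∫ v, v i ∂(Measure.pi fun _ : ι => gaussianReal 0 1) = 0 := by
  have := integral_comp_eval (μ := fun _ : ι => gaussianReal 0 1) (i := i) (f := fun y : ℝ => y)
    (by fun_prop)
  rw [this, integral_id_gaussianReal]

lemma integral_eval_mul_eval_pi_gaussian (i j : ι) :
    ∫ v, v i * v j ∂(Measure.pi fun _ : ι => gaussianReal 0 1) = if i = j then 1 else 0 := by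
  split_ifs with h
  · subst h
    have := integral_comp_eval (μ := fun _ : ι => gaussianReal 0 1) (i := i)
      (f := fun y : ℝ => y * y) (by fun_prop)
    rw [this]
    have h1 := integral_hermiteFn_mul 1 1
    simpa [hermiteFn_eq_eval, hermiteReal_succ, hermiteReal_zero] using h1
  · have hI := iIndepFun_pi (μ := fun _ : ι => gaussianReal 0 1) (X := fun _ => (id : ℝ → ℝ))
      fun _ => aemeasurable_id
    have := (hI.indepFun h).integral_fun_mul_eq_mul_integral
      (measurable_pi_apply i).aestronglyMeasurable (measurable_pi_apply j).aestronglyMeasurable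
    simp only [id] at this
    rw [this, integral_eval_pi_gaussian, zero_mul]

lemma map_eq_pi_gaussian {Ω : Type*} [MeasurableSpace Ω] {P : Measure Ω} {X : Ω → ι → ℝ}
    (hX : HasGaussianLaw X P) (h0 : ∀ i, ∫ ω, X ω i ∂P = 0)
    (h2 : ∀ i j, ∫ ω, X ω i * X ω j ∂P = if i = j then 1 else 0) :
    P.map X = Measure.pi fun _ : ι => gaussianReal 0 1 := by
  have := map_eq_of_hasGaussianLaw hX (hasGaussianLaw_id_pi (ι := ι))
    (fun k => ContinuousLinearMap.proj (R := ℝ) (φ := fun _ => ℝ) k) strongDual_pi_eq_sum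
    h0 (fun k => integral_eval_pi_gaussian k)
    (fun k l => (h2 k l).trans (integral_eval_mul_eval_pi_gaussian k l).symm)
  rwa [Measure.map_id] at this

/-- A pair of centred Gaussian vectors is determined in law by its second moments. -/
lemma map_pair_eq_of_hasGaussianLaw {Ω Ω' : Type*} [MeasurableSpace Ω] [MeasurableSpace Ω']
    {P : Measure Ω} {P' : Measure Ω'} {X Y : Ω → ι → ℝ} {X' Y' : Ω' → ι → ℝ}
    (hW : HasGaussianLaw (fun ω => (X ω, Y ω)) P) (hW' : HasGaussianLaw (fun ω => (X' ω, Y' ω)) P')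
    (hX : ∀ i, ∫ ω, X ω i ∂P = 0) (hY : ∀ i, ∫ ω, Y ω i ∂P = 0)
    (hX' : ∀ i, ∫ ω, X' ω i ∂P' = 0) (hY' : ∀ i, ∫ ω, Y' ω i ∂P' = 0)
    (hXX : ∀ i j, ∫ ω, X ω i * X ω j ∂P = ∫ ω, X' ω i * X' ω j ∂P')
    (hYY : ∀ i j, ∫ ω, Y ω i * Y ω j ∂P = ∫ ω, Y' ω i * Y' ω j ∂P')
    (hXY : ∀ i j, ∫ ω, X ω i * Y ω j ∂P = ∫ ω, X' ω i * Y' ω j ∂P') :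
    P.map (fun ω => (X ω, Y ω)) = P'.map (fun ω => (X' ω, Y' ω)) := by
  refine map_eq_of_hasGaussianLaw hW hW' (κ := ι ⊕ ι)
    (Sum.elim (fun k => (ContinuousLinearMap.proj (R := ℝ) (φ := fun _ => ℝ) k).comp
        (ContinuousLinearMap.fst ℝ (ι → ℝ) (ι → ℝ)))
      (fun k => (ContinuousLinearMap.proj (R := ℝ) (φ := fun _ => ℝ) k).comp
        (ContinuousLinearMap.snd ℝ (ι → ℝ) (ι → ℝ)))) (fun L => ?_) ?_ ?_ ?_
  · obtain ⟨c, hc⟩ := strongDual_pi_eq_sum (L.comp (ContinuousLinearMap.inl ℝ (ι → ℝ) (ι → ℝ)))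
    obtain ⟨d, hd⟩ := strongDual_pi_eq_sum (L.comp (ContinuousLinearMap.inr ℝ (ι → ℝ) (ι → ℝ)))
    refine ⟨Sum.elim c d, fun x => ?_⟩
    have h1 := hc x.1
    have h2 := hd x.2
    simp only [ContinuousLinearMap.comp_apply, ContinuousLinearMap.inl_apply,
      ContinuousLinearMap.inr_apply] at h1 h2
    have : x = (x.1, 0) + (0, x.2) := by simp
    conv_lhs => rw [this]
    rw [map_add, h1, h2, Fintype.sum_sum_type]
    rfl
  · rintro (k | k)
    · exact hX k
    · exact hY k
  · rintro (k | k)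
    · exact hX' k
    · exact hY' k
  · rintro (k | k) (l | l)
    · exact hXX k l
    · exact hXY k l
    · have := hXY l k
      simp_rw [mul_comm (X _ _), mul_comm (X' _ _)] at this
      exact this
    · exact hYY k l

end Pi

/-- The covariance of Hermite polynomials of a standard Gaussian pair. -/
lemma integral_hermiteFn_mul_of_gaussian_pair {Ω : Type*} [MeasurableSpace Ω] {P : Measure Ω}
    {X Y : Ω → ℝ} (hXY : HasGaussianLaw (fun ω => (X ω, Y ω)) P)
    (hX : ∫ ω, X ω ∂P = 0) (hY : ∫ ω, Y ω ∂P = 0) (hXX : ∫ ω, X ω * X ω ∂P = 1)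
    (hYY : ∫ ω, Y ω * Y ω ∂P = 1) (n : ℕ) :
    ∫ ω, hermiteFn n (X ω) * hermiteFn n (Y ω) ∂P =
      n.factorial * (∫ ω, X ω * Y ω ∂P) ^ n := by
  set ρ := ∫ ω, X ω * Y ω ∂P
  have hρ : ρ ^ 2 ≤ 1 := by
    have := sq_integral_mul_le hXY.fst.memLp_two hXY.snd.memLp_two
    simp_rw [sq (X _), sq (Y _)] at this
    rwa [hXX, hYY, mul_one] at this
  set b := √(1 - ρ ^ 2)
  have hb : ρ ^ 2 + b ^ 2 = 1 := by
    rw [Real.sq_sqrt (by linarith)]; ring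
  have hX2 : Integrable (fun x : ℝ => x * x) (gaussianReal 0 1) :=
    integrable_mul_of_memLp_two (IsGaussian.memLp_two_id (μ := gaussianReal 0 1))
      (IsGaussian.memLp_two_id (μ := gaussianReal 0 1))
  have hm1 : ∫ x : ℝ, x ∂(gaussianReal 0 1) = 0 := integral_id_gaussianReal
  have hm2 : ∫ x : ℝ, x * x ∂(gaussianReal 0 1) = 1 := by
    have h1 := integral_hermiteFn_mul 1 1
    simpa [hermiteFn_eq_eval, hermiteReal_succ, hermiteReal_zero] using h1
  set Q := (gaussianReal 0 1).prod (gaussianReal 0 1)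
  have i1 : Integrable (fun z : ℝ × ℝ => z.1 * z.1) Q := hX2.comp_fst _
  have i2 : Integrable (fun z : ℝ × ℝ => z.2 * z.2) Q := hX2.comp_snd _
  have hI1 : Integrable (fun x : ℝ => x) (gaussianReal 0 1) := IsGaussian.integrable_id
  have i3 : Integrable (fun z : ℝ × ℝ => z.1 * z.2) Q := hI1.mul_prod hI1
  have m1 : ∫ z : ℝ × ℝ, z.1 * z.1 ∂Q = 1 := by
    rw [integral_fun_fst (fun x : ℝ => x * x)]; simp [hm2]
  have m2 : ∫ z : ℝ × ℝ, z.2 * z.2 ∂Q = 1 := by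
    rw [integral_fun_snd (fun x : ℝ => x * x)]; simp [hm2]
  have m3 : ∫ z : ℝ × ℝ, z.1 * z.2 ∂Q = 0 := by
    rw [integral_prod_mul (fun x : ℝ => x) (fun x : ℝ => x), hm1, zero_mul]
  have n1 : ∫ z : ℝ × ℝ, z.1 ∂Q = 0 := by
    rw [integral_fun_fst (fun x : ℝ => x)]; simp [hm1]
  have n2 : ∫ z : ℝ × ℝ, z.2 ∂Q = 0 := by
    rw [integral_fun_snd (fun x : ℝ => x)]; simp [hm1]
  have c2 : ∫ z : ℝ × ℝ, (ρ * z.1 + b * z.2) * (ρ * z.1 + b * z.2) ∂Q = 1 := by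
    have e : ∀ z : ℝ × ℝ, (ρ * z.1 + b * z.2) * (ρ * z.1 + b * z.2) =
        ρ ^ 2 * (z.1 * z.1) + (b ^ 2 * (z.2 * z.2) + 2 * ρ * b * (z.1 * z.2)) := by
      intro z; ring
    have j := integral_add (i1.const_mul (ρ ^ 2))
      ((i2.const_mul (b ^ 2)).add (i3.const_mul (2 * ρ * b)))
    simp only [Pi.add_apply] at j
    simp_rw [e]
    rw [j, integral_add (i2.const_mul _) (i3.const_mul _), integral_const_mul,
      integral_const_mul, integral_const_mul, m1, m2, m3]
    linarith
  let T : ℝ × ℝ →L[ℝ] ℝ × ℝ := (ContinuousLinearMap.fst ℝ ℝ ℝ).prod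
    (ρ • ContinuousLinearMap.fst ℝ ℝ ℝ + b • ContinuousLinearMap.snd ℝ ℝ ℝ)
  have hT : HasGaussianLaw (fun z : ℝ × ℝ => (z.1, ρ * z.1 + b * z.2)) Q :=
    (IsGaussian.hasGaussianLaw_id (μ := Q)).map T
  have hlaw : P.map (fun ω => (X ω, Y ω)) = Q.map fun z : ℝ × ℝ => (z.1, ρ * z.1 + b * z.2) := by
    refine map_eq_of_hasGaussianLaw hXY hT (κ := Bool)
      (fun k => bif k then ContinuousLinearMap.fst ℝ ℝ ℝ else ContinuousLinearMap.snd ℝ ℝ ℝ)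
      (fun L => ⟨fun k => bif k then L (1, 0) else L (0, 1), fun x => ?_⟩) ?_ ?_ ?_
    · have : x = x.1 • ((1, 0) : ℝ × ℝ) + x.2 • ((0, 1) : ℝ × ℝ) := by ext <;> simp
      conv_lhs => rw [this]
      rw [map_add, map_smul, map_smul]
      simp [mul_comm]
    · rintro (_ | _)
      · simpa using hY
      · simpa using hX
    · rintro (_ | _)
      · simp only [cond_false, ContinuousLinearMap.coe_snd']
        rw [integral_add ((hI1.comp_fst _).const_mul _) ((hI1.comp_snd _).const_mul _),
          integral_const_mul, integral_const_mul, n1, n2]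
        simp
      · simpa using n1
    · have c1 : ∫ z : ℝ × ℝ, z.1 * (ρ * z.1 + b * z.2) ∂Q = ρ := by
        have e : ∀ z : ℝ × ℝ, z.1 * (ρ * z.1 + b * z.2) = ρ * (z.1 * z.1) + b * (z.1 * z.2) := by
          intro z; ring
        simp_rw [e]
        rw [integral_add (i1.const_mul _) (i3.const_mul _), integral_const_mul,
          integral_const_mul, m1, m3]
        simp
      rintro (_ | _) (_ | _)
      · simpa using hYY.trans c2.symm
      · simp only [cond_false, ContinuousLinearMap.coe_snd', cond_true,
          ContinuousLinearMap.coe_fst']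
        simp_rw [mul_comm (Y _), mul_comm _ (Prod.fst _ : ℝ)]
        have := c1.symm
        simp_rw [mul_comm _ (Prod.fst _ : ℝ)] at this
        exact this
      · simpa using c1.symm
      · simpa using hXX.trans m1.symm
  have hc : Continuous fun w : ℝ × ℝ => hermiteFn n w.1 * hermiteFn n w.2 :=
    ((continuous_hermiteFn n).comp continuous_fst).mul
      ((continuous_hermiteFn n).comp continuous_snd)
  have s1 := integral_map hXY.aemeasurable (f := fun w : ℝ × ℝ => hermiteFn n w.1 * hermiteFn n w.2)
    hc.aestronglyMeasurable
  have s2 := integral_map hT.aemeasurable (f := fun w : ℝ × ℝ => hermiteFn n w.1 * hermiteFn n w.2)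
    hc.aestronglyMeasurable
  rw [hlaw] at s1
  rw [← s1, s2, integral_prod]
  · simp only
    simp_rw [integral_const_mul, integral_hermiteFn_comp ρ b hb, mul_left_comm (hermiteFn n _)]
    rw [integral_const_mul, integral_hermiteFn_mul, if_pos rfl, mul_comm]
  · have hl : MemLp (hermiteFn n) 2 (gaussianReal 0 1) := by
      simp_rw [funext (hermiteFn_eq_eval n)]
      exact memLp_polynomial_gaussianReal _ 2 (by simp)
    have hfst : MeasurePreserving (fun z : ℝ × ℝ => z.1) Q (gaussianReal 0 1) :=
      measurePreserving_fst
    have hsnd : MeasurePreserving (fun z : ℝ × ℝ => ρ * z.1 + b * z.2) Q (gaussianReal 0 1) := by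
      refine ⟨by fun_prop, ?_⟩
      rw [hT.snd.map_eq_gaussianReal]
      have hmean : ∫ z : ℝ × ℝ, (ρ * z.1 + b * z.2) ∂Q = 0 := by
        rw [integral_add ((hI1.comp_fst _).const_mul _) ((hI1.comp_snd _).const_mul _),
          integral_const_mul, integral_const_mul, n1, n2]
        simp
      rw [variance_eq_sub hT.snd.memLp_two, hmean]
      simp only [Pi.pow_apply, sq, c2]
      simp
    exact integrable_mul_of_memLp_two (hl.comp_measurePreserving hfst)
      (hl.comp_measurePreserving hsnd)

/-! ### Correlated pairs of standard normal vectors -/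

section CorrelatedPair

variable {p : ℕ}

/-- By 2|x_i y_j| ≤ x_i² + y_j², a matrix with entries at most 1/p distributes to each square p
times the weight 1/p. This is what makes `pairCorrMatrix` positive semidefinite. -/
lemma sum_sum_abs_mul_le (R : Fin p → Fin p → ℝ) (hR : ∀ i j, p * |R i j| ≤ 1)
    (x y : Fin p → ℝ) :
    -(∑ i, x i ^ 2 + ∑ j, y j ^ 2) ≤ 2 * ∑ i, ∑ j, R i j * (x i * y j) := by
  rcases Nat.eq_zero_or_pos p with rfl | hp
  · simp
  have hp' : (0 : ℝ) < p := by exact_mod_cast hp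
  have h1 : ∀ i j, -((x i ^ 2 + y j ^ 2) / p) ≤ 2 * (R i j * (x i * y j)) := by
    intro i j
    have h := hR i j
    have h2 : |R i j| ≤ 1 / p := by rw [le_div_iff₀ hp']; linarith
    have h3 : |2 * (R i j * (x i * y j))| ≤ (x i ^ 2 + y j ^ 2) / p := by
      have h4 : 2 * |x i * y j| ≤ x i ^ 2 + y j ^ 2 := by
        rw [abs_mul, ← sq_abs (x i), ← sq_abs (y j)]
        nlinarith [sq_nonneg (|x i| - |y j|)]
      rw [abs_mul, abs_mul, abs_two]
      calc 2 * (|R i j| * |x i * y j|) = |R i j| * (2 * |x i * y j|) := by ring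
        _ ≤ 1 / p * (x i ^ 2 + y j ^ 2) := by gcongr
        _ = _ := by ring
    linarith [neg_abs_le (2 * (R i j * (x i * y j)))]
  calc -(∑ i, x i ^ 2 + ∑ j, y j ^ 2) = ∑ i, ∑ j, -((x i ^ 2 + y j ^ 2) / p) := by
        simp only [Finset.sum_neg_distrib, ← Finset.sum_div, Finset.sum_add_distrib,
          Finset.sum_const, Finset.card_univ, Fintype.card_fin, nsmul_eq_mul, ← Finset.mul_sum]
        field_simp
    _ ≤ ∑ i, ∑ j, 2 * (R i j * (x i * y j)) :=
        Finset.sum_le_sum fun i _ => Finset.sum_le_sum fun j _ => h1 i j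
    _ = _ := by simp_rw [Finset.mul_sum]

/-- The correlation matrix of a pair of standard vectors with cross-correlation `R`. -/
def pairCorrMatrix (R : Fin p → Fin p → ℝ) : Matrix (Fin p ⊕ Fin p) (Fin p ⊕ Fin p) ℝ :=
  Matrix.fromBlocks 1 (Matrix.of R) (Matrix.of R).transpose 1

lemma posSemidef_pairCorrMatrix {R : Fin p → Fin p → ℝ} (hR : ∀ i j, p * |R i j| ≤ 1) :
    (pairCorrMatrix R).PosSemidef := by
  refine Matrix.PosSemidef.of_dotProduct_mulVec_nonneg ?_ fun x => ?_
  · refine Matrix.IsHermitian.fromBlocks Matrix.isHermitian_one ?_ Matrix.isHermitian_one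
    ext i j; simp
  · have h := sum_sum_abs_mul_le R hR (fun i => x (Sum.inl i)) (fun i => x (Sum.inr i))
    have e : star x ⬝ᵥ (pairCorrMatrix R).mulVec x =
        (∑ i, x (Sum.inl i) ^ 2 + ∑ j, x (Sum.inr j) ^ 2) +
          2 * ∑ i, ∑ j, R i j * (x (Sum.inl i) * x (Sum.inr j)) := by
      simp only [dotProduct, Matrix.mulVec, Fintype.sum_sum_type, pairCorrMatrix,
        Matrix.fromBlocks_apply₁₁, Matrix.fromBlocks_apply₁₂, Matrix.fromBlocks_apply₂₁,
        Matrix.fromBlocks_apply₂₂, Matrix.of_apply, Matrix.transpose_apply, Matrix.one_apply,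
        ite_mul, mul_ite, mul_zero, one_mul, zero_mul, Finset.sum_ite_eq, Finset.mem_univ,
        if_true, Pi.star_apply,
        star_trivial, mul_add, Finset.sum_add_distrib, Finset.mul_sum, two_mul]
      have c : ∑ j, ∑ i, x (Sum.inr j) * (R i j * x (Sum.inl i)) =
          ∑ i, ∑ j, R i j * (x (Sum.inl i) * x (Sum.inr j)) := by
        rw [Finset.sum_comm]
        exact Finset.sum_congr rfl fun i _ => Finset.sum_congr rfl fun j _ => by ring
      have c' : ∑ i, ∑ j, x (Sum.inl i) * (R i j * x (Sum.inr j)) =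
          ∑ i, ∑ j, R i j * (x (Sum.inl i) * x (Sum.inr j)) :=
        Finset.sum_congr rfl fun i _ => Finset.sum_congr rfl fun j _ => by ring
      rw [c, c']
      simp_rw [← sq]
      ring
    rw [e]
    linarith

/-- The law of a pair of independent pairs: a correlated pair and an independent pair. -/
noncomputable def corrPairMeasure (R : Fin p → Fin p → ℝ) :
    Measure (EuclideanSpace ℝ (Fin p ⊕ Fin p) × ((Fin p → ℝ) × (Fin p → ℝ))) :=
  (multivariateGaussian 0 (pairCorrMatrix R)).prod ((stdNormalPi p).prod (stdNormalPi p))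

instance isGaussian_stdNormalPi : IsGaussian (stdNormalPi p) := by
  have := (hasGaussianLaw_id_pi (ι := Fin p)).isGaussian_map
  rwa [Measure.map_id] at this

instance isGaussian_corrPairMeasure (R : Fin p → Fin p → ℝ) : IsGaussian (corrPairMeasure R) := by
  unfold corrPairMeasure; infer_instance

/-- The coordinates of the independent pair. -/
def pairCoord (v : (Fin p → ℝ) × (Fin p → ℝ)) : Fin p ⊕ Fin p → ℝ := Sum.elim v.1 v.2

lemma measurable_pairCoord (k : Fin p ⊕ Fin p) :
    Measurable fun v : (Fin p → ℝ) × (Fin p → ℝ) => pairCoord v k := by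
  rcases k with k | k
  · exact (measurable_pi_apply k).comp measurable_fst
  · exact (measurable_pi_apply k).comp measurable_snd

lemma memLp_eval_stdNormalPi (i : Fin p) : MemLp (fun v => v i) 2 (stdNormalPi p) :=
  IsGaussian.memLp_dual (stdNormalPi p)
    (ContinuousLinearMap.proj (R := ℝ) (φ := fun _ : Fin p => ℝ) i) 2 (by simp)

lemma memLp_pairCoord (k : Fin p ⊕ Fin p) :
    MemLp (fun v => pairCoord v k) 2 ((stdNormalPi p).prod (stdNormalPi p)) := by
  rcases k with k | k
  · exact (memLp_eval_stdNormalPi k).comp_fst _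
  · exact (memLp_eval_stdNormalPi k).comp_snd _

lemma integral_pairCoord (k : Fin p ⊕ Fin p) :
    ∫ v, pairCoord v k ∂((stdNormalPi p).prod (stdNormalPi p)) = 0 := by
  rcases k with k | k
  · simp only [pairCoord, Sum.elim_inl]
    rw [integral_fun_fst (fun v : Fin p → ℝ => v k), integral_eval_pi_gaussian, smul_zero]
  · simp only [pairCoord, Sum.elim_inr]
    rw [integral_fun_snd (fun v : Fin p → ℝ => v k), integral_eval_pi_gaussian, smul_zero]

lemma integral_pairCoord_mul (k l : Fin p ⊕ Fin p) :
    ∫ v, pairCoord v k * pairCoord v l ∂((stdNormalPi p).prod (stdNormalPi p)) =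
      if k = l then 1 else 0 := by
  rcases k with k | k <;> rcases l with l | l <;>
    simp only [pairCoord, Sum.elim_inl, Sum.elim_inr, Sum.inl.injEq, Sum.inr.injEq, reduceCtorEq,
      if_false]
  · rw [integral_fun_fst (fun v : Fin p → ℝ => v k * v l), integral_eval_mul_eval_pi_gaussian]
    simp
  · rw [integral_prod_mul (fun v : Fin p → ℝ => v k) (fun v : Fin p → ℝ => v l),
      integral_eval_pi_gaussian, zero_mul]
  · rw [show ∫ v : (Fin p → ℝ) × (Fin p → ℝ), v.2 k * v.1 l ∂((stdNormalPi p).prod (stdNormalPi p))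
      = ∫ v : (Fin p → ℝ) × (Fin p → ℝ), v.1 l * v.2 k ∂((stdNormalPi p).prod (stdNormalPi p)) by
        congr 1; ext v; exact mul_comm _ _,
        integral_prod_mul (fun v : Fin p → ℝ => v l) (fun v : Fin p → ℝ => v k),
      integral_eval_pi_gaussian, zero_mul]
  · rw [integral_fun_snd (fun v : Fin p → ℝ => v k * v l), integral_eval_mul_eval_pi_gaussian]
    simp

lemma memLp_eval_multivariateGaussian {ι : Type*} [Fintype ι] [DecidableEq ι]
    (S : Matrix ι ι ℝ) (k : ι) :
    MemLp (fun z : EuclideanSpace ℝ ι => z k) 2 (multivariateGaussian 0 S) :=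
  IsGaussian.memLp_dual (multivariateGaussian 0 S) (EuclideanSpace.proj k) 2 (by simp)

lemma integral_eval_multivariateGaussian {ι : Type*} [Fintype ι] [DecidableEq ι]
    (S : Matrix ι ι ℝ) (k : ι) :
    ∫ z, z k ∂(multivariateGaussian 0 S) = 0 := by
  have := IsGaussian.integral_dual (μ := multivariateGaussian 0 S)
    (EuclideanSpace.proj (𝕜 := ℝ) k)
  simpa using this

lemma integral_eval_mul_eval_multivariateGaussian {ι : Type*} [Fintype ι] [DecidableEq ι]
    {S : Matrix ι ι ℝ} (hS : S.PosSemidef) (k l : ι) :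
    ∫ z, z k * z l ∂(multivariateGaussian 0 S) = S k l := by
  have h := covariance_eval_multivariateGaussian (μ := 0) hS k l
  rw [covariance_eq_sub (memLp_eval_multivariateGaussian S k)
    (memLp_eval_multivariateGaussian S l), integral_eval_multivariateGaussian] at h
  simpa using h

section Mixture

variable {R : Fin p → Fin p → ℝ} {a b : ℝ}

/-- The coordinates of the mixture `a Z + b V`. -/
noncomputable def mixCoord (a b : ℝ)
    (w : EuclideanSpace ℝ (Fin p ⊕ Fin p) × ((Fin p → ℝ) × (Fin p → ℝ))) (k : Fin p ⊕ Fin p) : ℝ :=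
  a * w.1 k + b * pairCoord w.2 k

lemma integral_mixCoord (k : Fin p ⊕ Fin p) :
    ∫ w, mixCoord a b w k ∂(corrPairMeasure R) = 0 := by
  have h1 := (memLp_eval_multivariateGaussian (pairCorrMatrix R) k).integrable one_le_two
  have h2 := (memLp_pairCoord k).integrable one_le_two
  simp only [mixCoord, corrPairMeasure]
  rw [integral_add ((h1.comp_fst _).const_mul _) ((h2.comp_snd _).const_mul _),
    integral_const_mul, integral_const_mul, integral_fun_fst (fun z : EuclideanSpace ℝ _ => z k),
    integral_fun_snd (fun v => pairCoord v k), integral_pairCoord,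
    integral_eval_multivariateGaussian]
  simp

/-- The independent part V contributes only to the diagonal. So mixing with a² + b² = 1 keeps the
diagonal blocks equal to the identity and multiplies the cross-correlation R by a². -/
lemma integral_mixCoord_mul (hR : ∀ i j, p * |R i j| ≤ 1) (k l : Fin p ⊕ Fin p) :
    ∫ w, mixCoord a b w k * mixCoord a b w l ∂(corrPairMeasure R) =
      a ^ 2 * pairCorrMatrix R k l + b ^ 2 * if k = l then 1 else 0 := by
  have h1 := fun k => memLp_eval_multivariateGaussian (pairCorrMatrix R) k
  have h2 := fun k => memLp_pairCoord (p := p) k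
  have h1' := fun k => (h1 k).integrable one_le_two
  have h2' := fun k => (h2 k).integrable one_le_two
  have e : ∀ w : EuclideanSpace ℝ (Fin p ⊕ Fin p) × ((Fin p → ℝ) × (Fin p → ℝ)),
      mixCoord a b w k * mixCoord a b w l =
      (a ^ 2 * (w.1 k * w.1 l) + b ^ 2 * (pairCoord w.2 k * pairCoord w.2 l)) +
      (a * b * (w.1 k * pairCoord w.2 l) + a * b * (w.1 l * pairCoord w.2 k)) := by
    intro w; simp only [mixCoord]; ring
  have i1 : Integrable (fun w : EuclideanSpace ℝ (Fin p ⊕ Fin p) × ((Fin p → ℝ) × (Fin p → ℝ)) =>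
      a ^ 2 * (w.1 k * w.1 l)) (corrPairMeasure R) :=
    ((integrable_mul_of_memLp_two (h1 k) (h1 l)).comp_fst _).const_mul _
  have i2 : Integrable (fun w : EuclideanSpace ℝ (Fin p ⊕ Fin p) × ((Fin p → ℝ) × (Fin p → ℝ)) =>
      b ^ 2 * (pairCoord w.2 k * pairCoord w.2 l)) (corrPairMeasure R) :=
    ((integrable_mul_of_memLp_two (h2 k) (h2 l)).comp_snd _).const_mul _
  have i3 : ∀ k l, Integrable
      (fun w : EuclideanSpace ℝ (Fin p ⊕ Fin p) × ((Fin p → ℝ) × (Fin p → ℝ)) =>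
      a * b * (w.1 k * pairCoord w.2 l)) (corrPairMeasure R) :=
    fun k l => ((h1' k).mul_prod (h2' l)).const_mul _
  have j1 : ∫ w, w.1 k * w.1 l ∂(corrPairMeasure R) = pairCorrMatrix R k l := by
    rw [corrPairMeasure, integral_fun_fst (fun z : EuclideanSpace ℝ (Fin p ⊕ Fin p) => z k * z l),
      integral_eval_mul_eval_multivariateGaussian (posSemidef_pairCorrMatrix hR)]
    simp
  have j2 : ∫ w, pairCoord w.2 k * pairCoord w.2 l ∂(corrPairMeasure R) =
      if k = l then 1 else 0 := by
    rw [corrPairMeasure, integral_fun_snd (fun v => pairCoord v k * pairCoord v l),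
      integral_pairCoord_mul]
    simp
  have j3 : ∀ k l, ∫ w, w.1 k * pairCoord w.2 l ∂(corrPairMeasure R) = 0 := by
    intro k l
    rw [corrPairMeasure, integral_prod_mul (fun z : EuclideanSpace ℝ (Fin p ⊕ Fin p) => z k)
      (fun v => pairCoord v l), integral_pairCoord, mul_zero]
  have s := integral_add (i1.add i2) ((i3 k l).add (i3 l k))
  simp only [Pi.add_apply] at s
  simp_rw [e]
  rw [s, integral_add i1 i2, integral_add (i3 k l) (i3 l k)]
  simp only [integral_const_mul, j1, j2, j3]
  ring

lemma hasGaussianLaw_mixCoord :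
    HasGaussianLaw (fun w => ((fun i => mixCoord a b w (Sum.inl i)),
      fun i => mixCoord a b w (Sum.inr i))) (corrPairMeasure R) := by
  let T : (EuclideanSpace ℝ (Fin p ⊕ Fin p) × ((Fin p → ℝ) × (Fin p → ℝ))) →ₗ[ℝ]
      (Fin p → ℝ) × (Fin p → ℝ) :=
    { toFun := fun w => ((fun i => mixCoord a b w (Sum.inl i)),
        fun i => mixCoord a b w (Sum.inr i))
      map_add' := fun w w' => by
        ext i <;> simp [mixCoord, pairCoord] <;> ring
      map_smul' := fun c w => by
        ext i <;> simp [mixCoord, pairCoord] <;> ring }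
  exact (IsGaussian.hasGaussianLaw_id (μ := corrPairMeasure R)).map
    (LinearMap.toContinuousLinearMap T)

end Mixture

/-- Decay of the covariance of a function of Hermite rank at least `M` along a weakly correlated
standard Gaussian pair. -/
theorem abs_integral_mul_le_of_gaussian_pair {Ω : Type*} [MeasurableSpace Ω] {P : Measure Ω}
    {X Y : Ω → Fin p → ℝ} (hXY : HasGaussianLaw (fun ω => (X ω, Y ω)) P)
    (hX : ∀ i, ∫ ω, X ω i ∂P = 0) (hY : ∀ i, ∫ ω, Y ω i ∂P = 0)
    (hXX : ∀ i j, ∫ ω, X ω i * X ω j ∂P = if i = j then 1 else 0)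
    (hYY : ∀ i j, ∫ ω, Y ω i * Y ω j ∂P = if i = j then 1 else 0)
    {θ : ℝ} (hθ0 : 0 < θ) (hθ : θ ≤ 1 / 2) (hcross : ∀ i j, p * |∫ ω, X ω i * Y ω j ∂P| ≤ θ)
    {f : (Fin p → ℝ) → ℝ} (hf : Measurable f) (hf2 : MemLp f 2 (stdNormalPi p)) {M : ℕ}
    (hfM : ∀ l ∈ multiIndexLT p M, ∫ s, f s * hermiteMv l s ∂(stdNormalPi p) = 0) :
    |∫ ω, f (X ω) * f (Y ω) ∂P| ≤
      mehlerConst p M * θ ^ M * ∫ s, f s ^ 2 ∂(stdNormalPi p) := by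
  -- The cross-covariance is enlarged by 1/θ, the most that the hypothesis allows while the pair
  -- with cross-correlation R still exists; the mixture with a² = θ scales it back.
  set R : Fin p → Fin p → ℝ := fun i j => (∫ ω, X ω i * Y ω j ∂P) / θ
  have hR : ∀ i j, p * |R i j| ≤ 1 := by
    intro i j
    simp only [R, abs_div, abs_of_pos hθ0]
    rw [← mul_div_assoc, div_le_one hθ0]
    exact hcross i j
  set a := √θ
  set b := √(1 - θ)
  have ha : a ^ 2 = θ := Real.sq_sqrt hθ0.le
  have hb : b ^ 2 = 1 - θ := Real.sq_sqrt (by linarith)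
  have hab : a ^ 2 + b ^ 2 = 1 := by rw [ha, hb]; ring
  set Q := corrPairMeasure R
  set W₁ : EuclideanSpace ℝ (Fin p ⊕ Fin p) × ((Fin p → ℝ) × (Fin p → ℝ)) → Fin p → ℝ :=
    fun w i => mixCoord a b w (Sum.inl i)
  set W₂ : EuclideanSpace ℝ (Fin p ⊕ Fin p) × ((Fin p → ℝ) × (Fin p → ℝ)) → Fin p → ℝ :=
    fun w i => mixCoord a b w (Sum.inr i)
  have hW : HasGaussianLaw (fun w => (W₁ w, W₂ w)) Q := hasGaussianLaw_mixCoord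
  have mW₁ : ∀ i, ∫ w, W₁ w i ∂Q = 0 := fun i => integral_mixCoord _
  have mW₂ : ∀ i, ∫ w, W₂ w i ∂Q = 0 := fun i => integral_mixCoord _
  have c₁ : ∀ i j, ∫ w, W₁ w i * W₁ w j ∂Q = if i = j then 1 else 0 := by
    intro i j
    simp only [W₁, Q]
    rw [integral_mixCoord_mul hR]
    simp only [pairCorrMatrix, Matrix.fromBlocks_apply₁₁, Matrix.one_apply, Sum.inl.injEq]
    split_ifs <;> linarith
  have c₂ : ∀ i j, ∫ w, W₂ w i * W₂ w j ∂Q = if i = j then 1 else 0 := by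
    intro i j
    simp only [W₂, Q]
    rw [integral_mixCoord_mul hR]
    simp only [pairCorrMatrix, Matrix.fromBlocks_apply₂₂, Matrix.one_apply, Sum.inr.injEq]
    split_ifs <;> linarith
  have c₃ : ∀ i j, ∫ w, W₁ w i * W₂ w j ∂Q = ∫ ω, X ω i * Y ω j ∂P := by
    intro i j
    simp only [W₁, W₂, Q]
    rw [integral_mixCoord_mul hR]
    simp only [pairCorrMatrix, Matrix.fromBlocks_apply₁₂, Matrix.of_apply, reduceCtorEq, if_false,
      R, ha]
    field_simp
    ring
  have hlaw : P.map (fun ω => (X ω, Y ω)) = Q.map (fun w => (W₁ w, W₂ w)) :=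
    map_pair_eq_of_hasGaussianLaw hXY hW hX hY mW₁ mW₂
      (fun i j => (hXX i j).trans (c₁ i j).symm) (fun i j => (hYY i j).trans (c₂ i j).symm)
      (fun i j => (c₃ i j).symm)
  have hmeas : Measurable fun z : (Fin p → ℝ) × (Fin p → ℝ) => f z.1 * f z.2 :=
    (hf.comp measurable_fst).mul (hf.comp measurable_snd)
  have s1 := integral_map hXY.aemeasurable (f := fun z : (Fin p → ℝ) × (Fin p → ℝ) =>
    f z.1 * f z.2) hmeas.aestronglyMeasurable
  have s2 := integral_map hW.aemeasurable (f := fun z : (Fin p → ℝ) × (Fin p → ℝ) =>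
    f z.1 * f z.2) hmeas.aestronglyMeasurable
  rw [hlaw, s2] at s1
  have measW₁ : Measurable W₁ := measurable_pi_lambda _ fun i => by
    refine Measurable.add (Measurable.const_mul ?_ _)
      (((measurable_pairCoord (Sum.inl i)).comp measurable_snd).const_mul _)
    fun_prop
  have measW₂ : Measurable W₂ := measurable_pi_lambda _ fun i => by
    refine Measurable.add (Measurable.const_mul ?_ _)
      (((measurable_pairCoord (Sum.inr i)).comp measurable_snd).const_mul _)
    fun_prop
  have mp₁ : MeasurePreserving W₁ Q (stdNormalPi p) := ⟨measW₁, map_eq_pi_gaussian hW.fst mW₁ c₁⟩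
  have mp₂ : MeasurePreserving W₂ Q (stdNormalPi p) := ⟨measW₂, map_eq_pi_gaussian hW.snd mW₂ c₂⟩
  have hint : Integrable (fun w => f (W₁ w) * f (W₂ w)) Q :=
    integrable_mul_of_memLp_two (hf2.comp_measurePreserving mp₁) (hf2.comp_measurePreserving mp₂)
  -- the marginals of the correlated pair
  set G := multivariateGaussian 0 (pairCorrMatrix R)
  have projLaw : ∀ (s : Fin p → Fin p ⊕ Fin p) (hs : Function.Injective s)
      (hsR : ∀ i j, pairCorrMatrix R (s i) (s j) = if i = j then 1 else 0),
      MeasurePreserving (fun (z : EuclideanSpace ℝ (Fin p ⊕ Fin p)) i => z (s i)) G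
        (stdNormalPi p) := by
    intro s hs hsR
    refine ⟨by fun_prop, map_eq_pi_gaussian ?_ (fun i => integral_eval_multivariateGaussian _ _)
      fun i j => ?_⟩
    · let T : EuclideanSpace ℝ (Fin p ⊕ Fin p) →L[ℝ] (Fin p → ℝ) :=
        ContinuousLinearMap.pi fun i => EuclideanSpace.proj (s i)
      exact (IsGaussian.hasGaussianLaw_id (μ := G)).map T
    · rw [integral_eval_mul_eval_multivariateGaussian (posSemidef_pairCorrMatrix hR), hsR]
  have mq₁ := projLaw Sum.inl Sum.inl_injective fun i j => by
    simp [pairCorrMatrix, Matrix.one_apply]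
  have mq₂ := projLaw Sum.inr Sum.inr_injective fun i j => by
    simp [pairCorrMatrix, Matrix.one_apply]
  -- Given Z, the two halves are independent because those of V are, so the conditional expectation
  -- factors into two values of the Ornstein-Uhlenbeck image of f.
  have hfac : ∫ w, f (W₁ w) * f (W₂ w) ∂Q =
      ∫ z, ouOp a b f (fun i => z (Sum.inl i)) * ouOp a b f (fun i => z (Sum.inr i)) ∂G := by
    simp only [Q, corrPairMeasure] at hint ⊢
    rw [integral_prod _ hint]
    refine integral_congr_ae (Eventually.of_forall fun z => ?_)
    exact integral_prod_mul (μ := stdNormalPi p) (ν := stdNormalPi p)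
      (fun v => f fun i => a * z (Sum.inl i) + b * v i)
      (fun v => f fun i => a * z (Sum.inr i) + b * v i)
  obtain ⟨hP1, hP2⟩ := integrable_ouOp_sq_and_integral_le hab (ha.trans_le hθ) hf hf2 hfM
  rw [ha] at hP2
  have k₁ : Integrable (fun z : EuclideanSpace ℝ (Fin p ⊕ Fin p) =>
      ouOp a b f (fun i => z (Sum.inl i)) ^ 2) G := mq₁.integrable_comp_of_integrable hP1
  have k₂ : Integrable (fun z : EuclideanSpace ℝ (Fin p ⊕ Fin p) =>
      ouOp a b f (fun i => z (Sum.inr i)) ^ 2) G := mq₂.integrable_comp_of_integrable hP1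
  have e₁ : ∫ z : EuclideanSpace ℝ (Fin p ⊕ Fin p), ouOp a b f (fun i => z (Sum.inl i)) ^ 2 ∂G =
      ∫ x, ouOp a b f x ^ 2 ∂(stdNormalPi p) := by
    rw [← integral_map mq₁.aemeasurable (f := fun x => ouOp a b f x ^ 2)
      (by rw [mq₁.map_eq]; exact hP1.aestronglyMeasurable), mq₁.map_eq]
  have e₂ : ∫ z : EuclideanSpace ℝ (Fin p ⊕ Fin p), ouOp a b f (fun i => z (Sum.inr i)) ^ 2 ∂G =
      ∫ x, ouOp a b f x ^ 2 ∂(stdNormalPi p) := by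
    rw [← integral_map mq₂.aemeasurable (f := fun x => ouOp a b f x ^ 2)
      (by rw [mq₂.map_eq]; exact hP1.aestronglyMeasurable), mq₂.map_eq]
  rw [← s1, hfac]
  -- The correlation of Z plays no further role: both halves have the standard normal law, so 2|xy|
  -- ≤ x² + y² bounds the integral by the squared norm of the image of f.
  calc |∫ z, ouOp a b f (fun i => z (Sum.inl i)) * ouOp a b f (fun i => z (Sum.inr i)) ∂G|
      ≤ ∫ z, |ouOp a b f (fun i => z (Sum.inl i)) * ouOp a b f (fun i => z (Sum.inr i))| ∂G :=
        abs_integral_le_integral_abs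
    _ ≤ ∫ z : EuclideanSpace ℝ (Fin p ⊕ Fin p), (ouOp a b f (fun i => z (Sum.inl i)) ^ 2
          + ouOp a b f (fun i => z (Sum.inr i)) ^ 2) / 2 ∂G := by
        refine integral_mono_of_nonneg (Eventually.of_forall fun z => abs_nonneg _)
          ((k₁.add k₂).div_const 2) (Eventually.of_forall fun z => ?_)
        simp only [abs_mul]
        rw [← sq_abs (ouOp a b f fun i => z (Sum.inl i)),
          ← sq_abs (ouOp a b f fun i => z (Sum.inr i))]
        nlinarith [sq_nonneg (|ouOp a b f fun i => z (Sum.inl i)| -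
          |ouOp a b f fun i => z (Sum.inr i)|)]
    _ = ∫ x, ouOp a b f x ^ 2 ∂(stdNormalPi p) := by
        rw [integral_div, integral_add k₁ k₂, e₁, e₂]; ring
    _ ≤ _ := hP2

end CorrelatedPair

/-! ### Slowly varying functions -/

/-- The sets increase in n and exhaust the interval by pointwise convergence, so continuity from
below applies. This weak form of Egorov's theorem is all that uniform convergence requires. -/
lemma tendsto_volume_setOf_forall_ge {g : ℕ → ℝ → ℝ}
    (hlim : ∀ v, Tendsto (fun n => g n v) atTop (𝓝 0)) {η : ℝ} (hη : 0 < η) (a b : ℝ) :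
    Tendsto (fun n => volume (Set.Icc a b ∩ {v | ∀ k, n ≤ k → |g k v| ≤ η})) atTop
      (𝓝 (ENNReal.ofReal (b - a))) := by
  have hmono : Monotone fun n => Set.Icc a b ∩ {v | ∀ k, n ≤ k → |g k v| ≤ η} := by
    intro n n' hn v hv
    exact ⟨hv.1, fun k hk => hv.2 k (hn.trans hk)⟩
  have hU : ⋃ n, Set.Icc a b ∩ {v | ∀ k, n ≤ k → |g k v| ≤ η} = Set.Icc a b := by
    rw [← Set.inter_iUnion, Set.inter_eq_left]
    intro v _
    have := (hlim v).abs
    rw [abs_zero] at this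
    obtain ⟨n, hn⟩ := eventually_atTop.1 (this.eventually (ge_mem_nhds hη))
    exact Set.mem_iUnion.2 ⟨n, fun k hk => hn k hk⟩
  have := tendsto_measure_iUnion_atTop (μ := volume) hmono
  rwa [hU, Real.volume_Icc] at this

/-- The uniform convergence theorem for slowly varying functions, in additive form. -/
lemma exists_forall_abs_sub_le_of_tendsto {h : ℝ → ℝ} (hm : Measurable h)
    (hlim : ∀ u, Tendsto (fun x => h (x + u) - h x) atTop (𝓝 0)) {η : ℝ} (hη : 0 < η) :
    ∃ x₀, ∀ x, x₀ ≤ x → ∀ u ∈ Set.Icc (0 : ℝ) 1, |h (x + u) - h x| ≤ η := by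
  by_contra hcon
  push Not at hcon
  choose x hx u hu hxu using fun n : ℕ => hcon n
  have hxt : Tendsto x atTop atTop := tendsto_atTop_mono hx tendsto_natCast_atTop_atTop
  have hxt' : Tendsto (fun n => x n + u n) atTop atTop :=
    tendsto_atTop_mono (fun n => le_add_of_nonneg_right (hu n).1) hxt
  -- Good increments are collected from both base points x_n and x_n + u_n. The interval [0, 2] is
  -- used for the first so that it contains the translate by u_n ∈ [0, 1] of the good set in [0, 1]
  -- of the second.
  have hV := tendsto_volume_setOf_forall_ge (g := fun n v => h (x n + v) - h (x n))
    (fun v => (hlim v).comp hxt) (half_pos hη) 0 2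
  have hW := tendsto_volume_setOf_forall_ge (g := fun n v => h (x n + u n + v) - h (x n + u n))
    (fun v => (hlim v).comp hxt') (half_pos hη) 0 1
  have e1 : ENNReal.ofReal (3 / 2) < ENNReal.ofReal (2 - 0) := by
    rw [ENNReal.ofReal_lt_ofReal_iff] <;> norm_num
  have e2 : ENNReal.ofReal (1 / 2) < ENNReal.ofReal (1 - 0) := by
    rw [ENNReal.ofReal_lt_ofReal_iff] <;> norm_num
  obtain ⟨n, hnV, hnW⟩ := ((hV.eventually (lt_mem_nhds e1)).and
    (hW.eventually (lt_mem_nhds e2))).exists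
  set V := Set.Icc (0 : ℝ) 2 ∩ {v | ∀ k, n ≤ k → |h (x k + v) - h (x k)| ≤ η / 2}
  set W := Set.Icc (0 : ℝ) 1 ∩ {v | ∀ k, n ≤ k → |h (x k + u k + v) - h (x k + u k)| ≤ η / 2}
  have hVm : MeasurableSet V := by
    refine measurableSet_Icc.inter ?_
    have : {v | ∀ k, n ≤ k → |h (x k + v) - h (x k)| ≤ η / 2} =
        ⋂ k, ⋂ _ : n ≤ k, {v | |h (x k + v) - h (x k)| ≤ η / 2} := by ext; simp
    rw [this]
    exact MeasurableSet.iInter fun k => MeasurableSet.iInter fun _ =>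
      measurableSet_le (by fun_prop) (by fun_prop)
  have hW' : volume ((fun w => u n + w) '' W) = volume W := by
    rw [Set.image_add_left, measure_preimage_add]
  have hsub : V ∪ (fun w => u n + w) '' W ⊆ Set.Icc 0 2 := by
    rintro v (hv | ⟨w, hw, rfl⟩)
    · exact hv.1
    · have h1 := hu n
      have h2 := hw.1
      simp only [Set.mem_Icc] at *
      constructor <;> linarith
  -- The two sets have measures greater than 1/2 and 3/2 and lie in an interval of length 2, so they
  -- meet. At a common point both increments are at most η/2, which contradicts the choice of u_n.
  have hdis : ¬ Disjoint ((fun w => u n + w) '' W) V := by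
    intro hd
    have h1 := measure_union hd hVm (μ := volume)
    have h2 := measure_mono hsub (μ := volume)
    rw [Set.union_comm, h1, hW', Real.volume_Icc] at h2
    have h3 : ENNReal.ofReal (1 / 2) + ENNReal.ofReal (3 / 2) < volume W + volume V :=
      ENNReal.add_lt_add hnW hnV
    rw [← ENNReal.ofReal_add (by norm_num) (by norm_num)] at h3
    norm_num at h2 h3
    exact absurd h2 (not_le.2 h3)
  obtain ⟨v, ⟨w, hw, rfl⟩, hv⟩ := Set.not_disjoint_iff.1 hdis
  have h1 := hv.2 n le_rfl
  have h2 := hw.2 n le_rfl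
  rw [← add_assoc] at h1
  have h3 := hxu n
  have h4 : |h (x n + u n) - h (x n)| ≤ η := by
    have : h (x n + u n) - h (x n) =
      (h (x n + u n + w) - h (x n)) - (h (x n + u n + w) - h (x n + u n)) := by ring
    rw [this]
    exact (abs_sub _ _).trans (by linarith)
  linarith

/-- Slowly varying functions grow and decay more slowly than any power. -/
lemma SlowlyVarying.eventually_rpow_bounds {L : ℝ → ℝ} (hL : SlowlyVarying L) {η : ℝ}
    (hη : 0 < η) : ∀ᶠ t in atTop, t ^ (-η) ≤ L t ∧ L t ≤ t ^ η := by
  obtain ⟨hm, hpos, hlim⟩ := hL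
  set h : ℝ → ℝ := fun x => Real.log (L (Real.exp x)) with hh
  have hhm : Measurable h := Real.measurable_log.comp (hm.comp Real.measurable_exp)
  have hpos' : ∀ᶠ x in atTop, 0 < L (Real.exp x) := Real.tendsto_exp_atTop.eventually hpos
  have hhlim : ∀ u, Tendsto (fun x => h (x + u) - h x) atTop (𝓝 0) := by
    intro u
    have h1 := (hlim (Real.exp u) (Real.exp_pos u)).comp Real.tendsto_exp_atTop
    have h2 := ((Real.continuousAt_log one_ne_zero).tendsto).comp h1
    rw [Real.log_one] at h2
    refine h2.congr' ?_
    have hsh : ∀ᶠ x in atTop, 0 < L (Real.exp (x + u)) :=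
      (tendsto_atTop_add_const_right _ u tendsto_id).eventually hpos'
    filter_upwards [hpos', hsh] with x hx hxu
    have hxu' : 0 < L (Real.exp u * Real.exp x) := by rwa [← Real.exp_add, add_comm]
    simp only [Function.comp_apply, hh]
    rw [Real.log_div hxu'.ne' hx.ne', Real.exp_add, mul_comm (Real.exp x)]
  obtain ⟨x₀, hx₀⟩ := exists_forall_abs_sub_le_of_tendsto hhm hhlim (half_pos hη)
  -- Adding up unit steps: log L(e^x) moves by at most η/2 per step, hence grows at most linearly
  -- with slope η/2.
  have hstep : ∀ n : ℕ, ∀ x, x₀ ≤ x → x ≤ x₀ + n → |h x - h x₀| ≤ η / 2 * n := by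
    intro n
    induction n with
    | zero =>
      intro x h1 h2
      have : x = x₀ := le_antisymm (by simpa using h2) h1
      simp [this]
    | succ n ih =>
      intro x h1 h2
      push_cast at h2 ⊢
      by_cases hx : x ≤ x₀ + 1
      · have := hx₀ x₀ le_rfl (x - x₀) ⟨by linarith, by linarith⟩
        rw [add_sub_cancel] at this
        nlinarith [Nat.cast_nonneg (α := ℝ) n]
      · have h3 := ih (x - 1) (by linarith) (by linarith)
        have h4 := hx₀ (x - 1) (by linarith) 1 ⟨by norm_num, le_rfl⟩
        rw [sub_add_cancel] at h4
        calc |h x - h x₀| ≤ |h x - h (x - 1)| + |h (x - 1) - h x₀| := abs_sub_le _ _ _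
          _ ≤ _ := by linarith
  -- The threshold is such that the constants |h(x₀)| and (η/2)(1 + |x₀|) are paid for by the spare
  -- half of the slope η.
  have hlog : ∀ᶠ t : ℝ in atTop, max x₀ (2 / η * (|h x₀| + η / 2 * (1 + |x₀|))) ≤ Real.log t :=
    Real.tendsto_log_atTop.eventually_ge_atTop _
  filter_upwards [hpos, hlog, eventually_gt_atTop 0] with t ht1 ht2 ht3
  set x := Real.log t with hx
  have hxt : Real.exp x = t := Real.exp_log ht3
  have h1 : x₀ ≤ x := (le_max_left _ _).trans ht2
  have h2 : |h x₀| + η / 2 * (1 + |x₀|) ≤ η / 2 * x := by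
    have h5 := mul_le_mul_of_nonneg_left ((le_max_right _ _).trans ht2) (half_pos hη).le
    have h6 : η / 2 * (2 / η * (|h x₀| + η / 2 * (1 + |x₀|))) = |h x₀| + η / 2 * (1 + |x₀|) := by
      field_simp
    linarith
  have h3 := hstep ⌈x - x₀⌉₊ x h1 (by linarith [Nat.le_ceil (x - x₀)])
  have h4 : (⌈x - x₀⌉₊ : ℝ) ≤ x - x₀ + 1 := (Nat.ceil_lt_add_one (by linarith)).le
  have h5 : |h x| ≤ η * x := by
    have h6 : |h x| ≤ |h x - h x₀| + |h x₀| := by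
      have := abs_add_le (h x - h x₀) (h x₀)
      rwa [sub_add_cancel] at this
    have h7 : η / 2 * (⌈x - x₀⌉₊ : ℝ) ≤ η / 2 * (x - x₀ + 1) :=
      mul_le_mul_of_nonneg_left h4 (half_pos hη).le
    have h8 : -x₀ ≤ |x₀| := neg_le_abs _
    nlinarith
  have hLt : L t = Real.exp (h x) := by simp only [hh, hxt]; rw [Real.exp_log ht1]
  rw [abs_le] at h5
  rw [hLt, Real.rpow_def_of_pos ht3, Real.rpow_def_of_pos ht3, Real.exp_le_exp, Real.exp_le_exp]
  constructor <;> nlinarith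

/-! ### Sums over the lags of a stationary sequence -/

/-- On each side of i the map j ↦ |i - j| is injective, so every lag occurs at most twice. -/
lemma sum_dist_le (g : ℕ → ℝ) (hg : ∀ d, 0 ≤ g d) {i N : ℕ} (hi : i < N) :
    ∑ j ∈ Finset.range N, g (Nat.dist i j) ≤ 2 * ∑ d ∈ Finset.range N, g d := by
  rw [← Finset.sum_filter_add_sum_filter_not (Finset.range N) (fun j => j ≤ i), two_mul]
  have key : ∀ A : Finset ℕ, A ⊆ Finset.range N → Set.InjOn (Nat.dist i) A →
      ∑ j ∈ A, g (Nat.dist i j) ≤ ∑ d ∈ Finset.range N, g d := by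
    intro A hA hinj
    rw [← Finset.sum_image (f := g) hinj]
    refine Finset.sum_le_sum_of_subset_of_nonneg ?_ fun d _ _ => hg d
    intro d hd
    obtain ⟨j, hj, rfl⟩ := Finset.mem_image.1 hd
    have := Finset.mem_range.1 (hA hj)
    rw [Finset.mem_range, Nat.dist]
    omega
  refine add_le_add (key _ (Finset.filter_subset _ _) ?_) (key _ (Finset.filter_subset _ _) ?_)
  · intro j hj k hk hjk
    simp only [Finset.coe_filter, Finset.mem_range, Set.mem_ofPred_eq, Nat.dist] at hj hk hjk
    omega
  · intro j hj k hk hjk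
    simp only [Finset.coe_filter, Finset.mem_range, Set.mem_ofPred_eq, Nat.dist] at hj hk hjk
    omega

/-- Bernoulli's inequality for the concave power 1 - s shows that (N+1)^{1-s} - N^{1-s} is at least
(1-s)(N+1)^{-s}; induction replaces the comparison with an integral. -/
lemma sum_range_rpow_neg_le {s : ℝ} (hs0 : 0 < s) (hs1 : s < 1) (N : ℕ) :
    ∑ d ∈ Finset.range N, ((d : ℝ) + 1) ^ (-s) ≤ (N : ℝ) ^ (1 - s) / (1 - s) := by
  have h1s : 0 < 1 - s := by linarith
  induction N with
  | zero => simp [Real.zero_rpow h1s.ne']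
  | succ N ih =>
    rw [Finset.sum_range_succ]
    have hN : (0 : ℝ) < (N : ℝ) + 1 := by positivity
    have hB := rpow_one_add_le_one_add_mul_self (s := -1 / ((N : ℝ) + 1)) (p := 1 - s)
      (by rw [le_div_iff₀ hN]; nlinarith [Nat.cast_nonneg (α := ℝ) N]) h1s.le (by linarith)
    have e1 : 1 + -1 / ((N : ℝ) + 1) = N / (N + 1) := by field_simp; ring
    rw [e1, Real.div_rpow (by positivity) hN.le,
      div_le_iff₀ (Real.rpow_pos_of_pos hN _)] at hB
    have e2 : ((N : ℝ) + 1) ^ (1 - s) = ((N : ℝ) + 1) * ((N : ℝ) + 1) ^ (-s) := by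
      rw [sub_eq_add_neg, Real.rpow_add hN, Real.rpow_one]
    have e3 : (1 + (1 - s) * (-1 / ((N : ℝ) + 1))) * ((N : ℝ) + 1) ^ (1 - s) =
        ((N : ℝ) + 1) ^ (1 - s) - (1 - s) * ((N : ℝ) + 1) ^ (-s) := by
      rw [e2]; field_simp; ring
    rw [e3] at hB
    rw [le_div_iff₀ h1s] at ih ⊢
    push_cast
    rw [add_mul]
    linarith

/-- Lower bound for the variance of the partial sums of a long-range dependent sequence. -/
lemma exists_rpow_le_sum_sum_dist {ρ : ℕ → ℝ} (hρ : ∀ k, |ρ k| ≤ 1) {c s : ℝ} (hc : 0 < c)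
    (hs0 : 0 < s) (hs1 : s < 1) {k₀ : ℕ} (hk : ∀ k, k₀ ≤ k → c * (k : ℝ) ^ (-s) ≤ ρ k) :
    ∃ N₀ : ℕ, ∀ N, N₀ ≤ N → c / 2 * (N : ℝ) ^ (2 - s) ≤
      ∑ i ∈ Finset.range N, ∑ j ∈ Finset.range N, ρ (Nat.dist i j) := by
  -- The extra one keeps lag 0, where the negative power is not decreasing, among the exceptional
  -- lags.
  set K := k₀ + 1
  have hlim : Tendsto (fun N : ℕ => (N : ℝ) ^ (1 - s)) atTop atTop :=
    (tendsto_rpow_atTop (by linarith)).comp tendsto_natCast_atTop_atTop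
  obtain ⟨N₀, hN₀⟩ := eventually_atTop.1
    (hlim.eventually_ge_atTop (2 / c * ((1 + c) * (2 * K))))
  refine ⟨N₀ + 1, fun N hN => ?_⟩
  have hN1 : (1 : ℝ) ≤ N := by exact_mod_cast (by omega : 1 ≤ N)
  have hNpos : (0 : ℝ) < N := by linarith
  -- Lags of at least K obey the power lower bound, weakened to its value at N. A smaller lag loses
  -- at most 1 + c since |ρ| ≤ 1, and each row has at most 2K of them, which is negligible against
  -- N^{1-s}.
  have hterm : ∀ i ∈ Finset.range N, ∀ j ∈ Finset.range N,
      c * (N : ℝ) ^ (-s) - (1 + c) * (if Nat.dist i j < K then 1 else 0) ≤ ρ (Nat.dist i j) := by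
    intro i hi j hj
    rw [Finset.mem_range] at hi hj
    have hNs : (N : ℝ) ^ (-s) ≤ 1 := Real.rpow_le_one_of_one_le_of_nonpos hN1 (by linarith)
    split_ifs with hd
    · have := (abs_le.1 (hρ (Nat.dist i j))).1
      nlinarith
    · have h1 := hk (Nat.dist i j) (by omega)
      have hdN : Nat.dist i j ≤ N := by unfold Nat.dist; omega
      have hd1 : (0 : ℝ) < (Nat.dist i j : ℝ) := by exact_mod_cast (by omega : 0 < Nat.dist i j)
      have h2 : (N : ℝ) ^ (-s) ≤ (Nat.dist i j : ℝ) ^ (-s) :=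
        Real.rpow_le_rpow_of_nonpos hd1 (by exact_mod_cast hdN) (by linarith)
      have := mul_le_mul_of_nonneg_left h2 hc.le
      linarith
  have hcount : ∀ i ∈ Finset.range N,
      ∑ j ∈ Finset.range N, (if Nat.dist i j < K then (1 : ℝ) else 0) ≤ 2 * K := by
    intro i hi
    refine (sum_dist_le (fun d => if d < K then (1 : ℝ) else 0)
      (fun d => by positivity) (Finset.mem_range.1 hi)).trans ?_
    gcongr
    rw [Finset.sum_ite, Finset.sum_const_zero, add_zero, Finset.sum_const, nsmul_eq_mul, mul_one]
    have : ((Finset.range N).filter (· < K)).card ≤ (Finset.range K).card :=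
      Finset.card_le_card fun d hd => Finset.mem_range.2 (Finset.mem_filter.1 hd).2
    rw [Finset.card_range] at this
    exact_mod_cast this
  have hsum : ∑ i ∈ Finset.range N, (c * (N : ℝ) ^ (1 - s) - (1 + c) * (2 * K)) ≤
      ∑ i ∈ Finset.range N, ∑ j ∈ Finset.range N, ρ (Nat.dist i j) := by
    refine Finset.sum_le_sum fun i hi => ?_
    refine le_trans ?_ (Finset.sum_le_sum (hterm i hi))
    rw [Finset.sum_sub_distrib, Finset.sum_const, Finset.card_range, nsmul_eq_mul,
      ← Finset.mul_sum]
    have e : (N : ℝ) ^ (1 - s) = N * (N : ℝ) ^ (-s) := by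
      rw [sub_eq_add_neg, Real.rpow_add hNpos, Real.rpow_one]
    have := mul_le_mul_of_nonneg_left (hcount i hi) (by linarith : 0 ≤ 1 + c)
    rw [e]
    linarith
  refine le_trans ?_ hsum
  rw [Finset.sum_const, Finset.card_range, nsmul_eq_mul]
  have e : (N : ℝ) ^ (2 - s) = N * (N : ℝ) ^ (1 - s) := by
    rw [show (2 : ℝ) - s = 1 + (1 - s) by ring, Real.rpow_add hNpos, Real.rpow_one]
  rw [e]
  have h1 := hN₀ N (by omega)
  have h2 : (1 + c) * (2 * K) ≤ c / 2 * (N : ℝ) ^ (1 - s) := by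
    have := mul_le_mul_of_nonneg_left h1 (half_pos hc).le
    have e2 : c / 2 * (2 / c * ((1 + c) * (2 * K))) = (1 + c) * (2 * (K : ℝ)) := by field_simp
    linarith
  have := mul_le_mul_of_nonneg_left h2 hNpos.le
  linarith

/-! ### Stationary sequences of standard Gaussian vectors -/

/-- A stationary Gaussian sequence of standard normal vectors. -/
structure IsStdGaussianSeq {Ω : Type*} [MeasurableSpace Ω] {p : ℕ} (μ : Measure Ω)
    (X : ℕ → Ω → Fin p → ℝ) : Prop where
  meas : ∀ j, Measurable (X j)
  gauss : IsGaussianProcess X μ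
  stat : StationarySeq X μ
  mean : ∀ i, ∫ ω, X 0 ω i ∂μ = 0
  cov : ∀ i i', ∫ ω, X 0 ω i * X 0 ω i' ∂μ = if i = i' then 1 else 0

namespace IsStdGaussianSeq

variable {Ω : Type*} [MeasurableSpace Ω] {p : ℕ} {μ : Measure Ω} {X : ℕ → Ω → Fin p → ℝ}

lemma integral_shift (h : IsStdGaussianSeq μ X) {φ : (Fin p → ℝ) → (Fin p → ℝ) → ℝ}
    (hφ : Measurable (Function.uncurry φ)) (j k : ℕ) :
    ∫ ω, φ (X j ω) (X (j + k) ω) ∂μ = ∫ ω, φ (X 0 ω) (X k ω) ∂μ := by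
  have hu : Measurable fun s : ℕ → Fin p → ℝ => φ (s 0) (s k) :=
    hφ.comp (f := fun s : ℕ → Fin p → ℝ => (s 0, s k))
      ((measurable_pi_apply 0).prodMk (measurable_pi_apply k))
  have := ((h.stat j).comp hu).integral_eq
  simpa [Function.comp_def, add_comm] using this

lemma integral_dist (h : IsStdGaussianSeq μ X) {f : (Fin p → ℝ) → ℝ} (hf : Measurable f)
    (i j : ℕ) :
    ∫ ω, f (X i ω) * f (X j ω) ∂μ = ∫ ω, f (X 0 ω) * f (X (Nat.dist i j) ω) ∂μ := by
  have hm : Measurable (Function.uncurry fun x y => f x * f y) :=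
    (hf.comp measurable_fst).mul (hf.comp measurable_snd)
  rcases le_total i j with hij | hij
  · have := h.integral_shift hm i (j - i)
    rw [Nat.dist_eq_sub_of_le hij, ← this, Nat.add_sub_cancel' hij]
  · have := h.integral_shift hm j (i - j)
    rw [Nat.dist_comm, Nat.dist_eq_sub_of_le hij, ← this, Nat.add_sub_cancel' hij]
    simp_rw [mul_comm]

lemma integral_eval_eq (h : IsStdGaussianSeq μ X) {φ : (Fin p → ℝ) → ℝ}
    (hφ : Measurable φ) (j : ℕ) : ∫ ω, φ (X j ω) ∂μ = ∫ ω, φ (X 0 ω) ∂μ :=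
  h.integral_shift (φ := fun x _ => φ x) (hφ.comp measurable_fst) j 0

lemma mean_eval (h : IsStdGaussianSeq μ X) (j : ℕ) (i : Fin p) : ∫ ω, X j ω i ∂μ = 0 := by
  rw [h.integral_eval_eq (φ := fun x => x i) (measurable_pi_apply i), h.mean]

lemma cov_eval (h : IsStdGaussianSeq μ X) (j : ℕ) (i i' : Fin p) :
    ∫ ω, X j ω i * X j ω i' ∂μ = if i = i' then 1 else 0 := by
  rw [h.integral_eval_eq (φ := fun x => x i * x i')
    ((measurable_pi_apply i).mul (measurable_pi_apply i')), h.cov]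

lemma measurePreserving (h : IsStdGaussianSeq μ X) (j : ℕ) :
    MeasurePreserving (X j) μ (stdNormalPi p) :=
  ⟨h.meas j, map_eq_pi_gaussian (h.gauss.hasGaussianLaw_eval j) (h.mean_eval j) (h.cov_eval j)⟩

lemma integral_comp (h : IsStdGaussianSeq μ X) (j : ℕ) {f : (Fin p → ℝ) → ℝ}
    (hf : Measurable f) : ∫ ω, f (X j ω) ∂μ = ∫ s, f s ∂(stdNormalPi p) := by
  rw [← (h.measurePreserving j).map_eq, integral_map (h.meas j).aemeasurable
    hf.aestronglyMeasurable]

lemma memLp_comp (h : IsStdGaussianSeq μ X) (j : ℕ) {f : (Fin p → ℝ) → ℝ}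
    (hf : MemLp f 2 (stdNormalPi p)) : MemLp (fun ω => f (X j ω)) 2 μ :=
  hf.comp_measurePreserving (h.measurePreserving j)

/-- The covariance at lag `k` of the first coordinate with itself. -/
lemma integral_hermiteFn_mul_eval [NeZero p] (h : IsStdGaussianSeq μ X) (m i j : ℕ) :
    ∫ ω, hermiteFn m (X i ω 0) * hermiteFn m (X j ω 0) ∂μ =
      m.factorial * (∫ ω, X 0 ω 0 * X (Nat.dist i j) ω 0 ∂μ) ^ m := by
  rw [h.integral_dist (f := fun x => hermiteFn m (x 0))
    ((continuous_hermiteFn m).measurable.comp (measurable_pi_apply 0))]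
  have hpair : HasGaussianLaw (fun ω => (X 0 ω 0, X (Nat.dist i j) ω 0)) μ := by
    let T : (Fin p → ℝ) × (Fin p → ℝ) →L[ℝ] ℝ × ℝ :=
      (ContinuousLinearMap.proj 0).prodMap (ContinuousLinearMap.proj 0)
    exact (h.gauss.hasGaussianLaw_prodMk (s := 0) (t := Nat.dist i j)).map T
  refine integral_hermiteFn_mul_of_gaussian_pair hpair (h.mean_eval _ _) (h.mean_eval _ _) ?_ ?_ m
  · rw [h.cov_eval, if_pos rfl]
  · rw [h.cov_eval, if_pos rfl]

lemma abs_cov_le_one (h : IsStdGaussianSeq μ X) (i : Fin p) (k : ℕ) :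
    |∫ ω, X 0 ω i * X k ω i ∂μ| ≤ 1 := by
  have hm : ∀ j, MemLp (fun ω => X j ω i) 2 μ := fun j => h.memLp_comp j (memLp_eval_stdNormalPi i)
  have := sq_integral_mul_le (hm 0) (hm k)
  simp_rw [sq (X _ _ i)] at this
  rw [h.cov_eval, h.cov_eval, if_pos rfl, mul_one] at this
  exact (sq_le_one_iff_abs_le_one _).1 this

lemma integral_sum_sq (h : IsStdGaussianSeq μ X) (I : Finset ℕ) {f : (Fin p → ℝ) → ℝ}
    (hf2 : MemLp f 2 (stdNormalPi p)) :
    ∫ ω, (∑ j ∈ I, f (X j ω)) ^ 2 ∂μ = ∑ i ∈ I, ∑ j ∈ I, ∫ ω, f (X i ω) * f (X j ω) ∂μ := by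
  have hi : ∀ i j, Integrable (fun ω => f (X i ω) * f (X j ω)) μ := fun i j =>
    integrable_mul_of_memLp_two (h.memLp_comp i hf2) (h.memLp_comp j hf2)
  simp_rw [sq, Finset.sum_mul_sum]
  rw [integral_finsetSum _ fun i _ => integrable_finsetSum _ fun j _ => hi i j]
  exact Finset.sum_congr rfl fun i _ => integral_finsetSum _ fun j _ => hi i j

lemma variance_sum_hermiteFn [NeZero p] (h : IsStdGaussianSeq μ X) {m : ℕ} (hm : 1 ≤ m) (N : ℕ) :
    variance (fun ω => ∑ j ∈ Finset.range N, hermiteFn m (X j ω 0)) μ =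
      m.factorial * ∑ i ∈ Finset.range N, ∑ j ∈ Finset.range N,
        (∫ ω, X 0 ω 0 * X (Nat.dist i j) ω 0 ∂μ) ^ m := by
  have := h.gauss.isProbabilityMeasure
  have hH : MemLp (fun s : Fin p → ℝ => hermiteFn m (s 0)) 2 (stdNormalPi p) := by
    have h1 : MemLp (hermiteFn m) 2 (gaussianReal 0 1) := by
      simp_rw [funext (hermiteFn_eq_eval m)]
      exact memLp_polynomial_gaussianReal _ 2 (by simp)
    exact h1.comp_measurePreserving (measurePreserving_eval _ 0)
  have hHm : Measurable fun s : Fin p → ℝ => hermiteFn m (s 0) :=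
    (continuous_hermiteFn m).measurable.comp (measurable_pi_apply 0)
  have hmean : ∀ j, ∫ ω, hermiteFn m (X j ω 0) ∂μ = 0 := by
    intro j
    rw [h.integral_comp j hHm, integral_comp_eval (μ := fun _ : Fin p => gaussianReal 0 1)
      (continuous_hermiteFn m).aestronglyMeasurable]
    have := integral_hermiteFn_mul m 0
    simp_rw [hermiteFn_zero, mul_one] at this
    rw [this, if_neg (by omega)]
  have hL := fun j => h.memLp_comp j hH
  rw [variance_eq_sub (memLp_finsetSum _ fun j _ => hL j),
    integral_finsetSum _ fun j _ => (hL j).integrable one_le_two]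
  simp_rw [hmean]
  simp only [Pi.pow_apply, Finset.sum_const_zero]
  rw [h.integral_sum_sq _ hH]
  simp_rw [h.integral_hermiteFn_mul_eval, Finset.mul_sum]
  ring

/-- Second moment of a partial sum over any set of indices below `N`, given power decay of the
correlations. -/
lemma integral_sum_sq_le (h : IsStdGaussianSeq μ X) {f : (Fin p → ℝ) → ℝ} (hf : Measurable f)
    (hf2 : MemLp f 2 (stdNormalPi p)) {A s : ℝ} (hA : 0 ≤ A) (hs0 : 0 < s) (hs1 : s < 1)
    (hcorr : ∀ k : ℕ, |∫ ω, f (X 0 ω) * f (X k ω) ∂μ| ≤ A * ((k : ℝ) + 1) ^ (-s))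
    {N : ℕ} {I : Finset ℕ} (hI : I ⊆ Finset.range N) :
    ∫ ω, (∑ j ∈ I, f (X j ω)) ^ 2 ∂μ ≤ 2 * A / (1 - s) * (I.card * (N : ℝ) ^ (1 - s)) := by
  rw [h.integral_sum_sq I hf2]
  have h1 : ∀ i ∈ I, ∑ j ∈ I, ∫ ω, f (X i ω) * f (X j ω) ∂μ ≤
      2 * (A * ((N : ℝ) ^ (1 - s) / (1 - s))) := by
    intro i hi
    have hnn : ∀ d : ℕ, 0 ≤ A * ((d : ℝ) + 1) ^ (-s) := fun d => by positivity
    calc ∑ j ∈ I, ∫ ω, f (X i ω) * f (X j ω) ∂μ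
        ≤ ∑ j ∈ I, A * ((Nat.dist i j : ℝ) + 1) ^ (-s) := by
          refine Finset.sum_le_sum fun j _ => ?_
          rw [h.integral_dist hf]
          exact (le_abs_self _).trans (hcorr _)
      _ ≤ ∑ j ∈ Finset.range N, A * ((Nat.dist i j : ℝ) + 1) ^ (-s) :=
          Finset.sum_le_sum_of_subset_of_nonneg hI fun j _ _ => hnn _
      _ ≤ 2 * ∑ d ∈ Finset.range N, A * ((d : ℝ) + 1) ^ (-s) :=
          sum_dist_le (fun d => A * ((d : ℝ) + 1) ^ (-s)) hnn (Finset.mem_range.1 (hI hi))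
      _ ≤ _ := by
          rw [← Finset.mul_sum]
          gcongr
          exact sum_range_rpow_neg_le hs0 hs1 N
  refine (Finset.sum_le_sum h1).trans (le_of_eq ?_)
  rw [Finset.sum_const, nsmul_eq_mul]
  ring

/-- Under long-range dependence the correlations of a function of Hermite rank greater than `m`
decay like any power smaller than `D (m + 1)`. -/
lemma exists_abs_integral_mul_le (h : IsStdGaussianSeq μ X) {D : ℝ} {L : ℝ → ℝ}
    (hL : SlowlyVarying L) {c : Fin p → Fin p → ℝ}
    (hlrd : ∀ i i', ∀ k : ℕ, 1 ≤ k →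
      ∫ ω, X 0 ω i * X k ω i' ∂μ = c i i' * L (k : ℝ) * (k : ℝ) ^ (-D))
    {s : ℝ} (hs0 : 0 < s) (m : ℕ) (hs : s < D * (m + 1)) :
    ∃ B : ℝ, 0 ≤ B ∧ ∀ f : (Fin p → ℝ) → ℝ, Measurable f → MemLp f 2 (stdNormalPi p) →
      (∀ l ∈ multiIndexLT p (m + 1), ∫ x, f x * hermiteMv l x ∂(stdNormalPi p) = 0) →
      ∀ k : ℕ, |∫ ω, f (X 0 ω) * f (X k ω) ∂μ| ≤
        B * (∫ x, f x ^ 2 ∂(stdNormalPi p)) * ((k : ℝ) + 1) ^ (-s) := by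
  have hm1 : (0 : ℝ) < (m : ℝ) + 1 := by positivity
  -- The exponent for one correlation: its power m + 1 decays like k^{-s}, and the positive gap D -
  -- τ absorbs the slowly varying factor.
  set τ := s / (m + 1)
  have hτ : 0 < τ := by positivity
  have hτD : 0 < D - τ := by
    have : τ < D := by rw [div_lt_iff₀ hm1]; exact hs
    linarith
  set c' := ∑ i, ∑ i', |c i i'|
  have hc' : ∀ i i', |c i i'| ≤ c' := fun i i' =>
    (Finset.single_le_sum (f := fun i' => |c i i'|) (fun _ _ => abs_nonneg _)
      (Finset.mem_univ i')).trans
    (Finset.single_le_sum (f := fun i => ∑ i', |c i i'|)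
      (fun _ _ => Finset.sum_nonneg fun _ _ => abs_nonneg _) (Finset.mem_univ i))
  have hc0 : 0 ≤ c' := Finset.sum_nonneg fun _ _ => Finset.sum_nonneg fun _ _ => abs_nonneg _
  set b := p * c' + 1
  have hb : 0 < b := by positivity
  have hev := tendsto_natCast_atTop_atTop.eventually (hL.eventually_rpow_bounds hτD)
  have hsmall : Tendsto (fun k : ℕ => b * (k : ℝ) ^ (-τ)) atTop (𝓝 (b * 0)) :=
    ((tendsto_rpow_neg_atTop hτ).comp tendsto_natCast_atTop_atTop).const_mul b
  rw [mul_zero] at hsmall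
  obtain ⟨k₀, hk₀⟩ := eventually_atTop.1 ((hev.and
    (hsmall.eventually (ge_mem_nhds (by norm_num : (0 : ℝ) < 1 / 2)))).and (eventually_ge_atTop 1))
  set B₁ := mehlerConst p (m + 1) * b ^ (m + 1) * 2 ^ s
  have hB₁ : 0 ≤ B₁ := by have := mehlerConst_nonneg p (m + 1); positivity
  -- The first constant serves the lags from k₀ on, where θ = b k^{-τ} ≤ 1/2; the second serves the
  -- finitely many smaller lags, by Cauchy-Schwarz. Both are chosen before f, so the bound is
  -- uniform over f.
  refine ⟨B₁ + ((k₀ : ℝ) + 1) ^ s, by positivity, fun f hf hf2 hfM k => ?_⟩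
  set V := ∫ x, f x ^ 2 ∂(stdNormalPi p)
  have hV : 0 ≤ V := integral_nonneg fun _ => sq_nonneg _
  have hk1 : (0 : ℝ) < (k : ℝ) + 1 := by positivity
  by_cases hk : k₀ ≤ k
  · obtain ⟨⟨⟨hLlow, hLup⟩, hθ⟩, hk1'⟩ := hk₀ k hk
    have hkpos : (0 : ℝ) < k := by exact_mod_cast hk1'
    have hLpos : 0 ≤ L k := (Real.rpow_nonneg hkpos.le _).trans hLlow
    have hθ0 : 0 < b * (k : ℝ) ^ (-τ) := by positivity
    have hcross : ∀ i j, p * |∫ ω, X 0 ω i * X k ω j ∂μ| ≤ b * (k : ℝ) ^ (-τ) := by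
      intro i j
      have hLk : L k * (k : ℝ) ^ (-D) ≤ (k : ℝ) ^ (-τ) := by
        calc L k * (k : ℝ) ^ (-D) ≤ (k : ℝ) ^ (D - τ) * (k : ℝ) ^ (-D) := by gcongr
          _ = (k : ℝ) ^ (-τ) := by rw [← Real.rpow_add hkpos]; congr 1; ring
      have hLk0 : 0 ≤ L k * (k : ℝ) ^ (-D) := by positivity
      rw [hlrd i j k hk1', mul_assoc, abs_mul, abs_of_nonneg hLk0, ← mul_assoc]
      have h1 : p * |c i j| ≤ b := by
        have := mul_le_mul_of_nonneg_left (hc' i j) (Nat.cast_nonneg (α := ℝ) p)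
        simp only [b]; linarith
      exact mul_le_mul h1 hLk hLk0 hb.le
    have hmain := abs_integral_mul_le_of_gaussian_pair
      (h.gauss.hasGaussianLaw_prodMk (s := 0) (t := k)) (h.mean_eval 0) (h.mean_eval k)
      (h.cov_eval 0) (h.cov_eval k) hθ0 hθ hcross hf hf2 hfM
    refine hmain.trans ?_
    have e1 : (b * (k : ℝ) ^ (-τ)) ^ (m + 1) = b ^ (m + 1) * (k : ℝ) ^ (-s) := by
      rw [mul_pow, ← Real.rpow_natCast ((k : ℝ) ^ (-τ)), ← Real.rpow_mul hkpos.le]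
      congr 2
      push_cast
      simp only [τ]
      field_simp
    have e2 : (k : ℝ) ^ (-s) ≤ 2 ^ s * ((k : ℝ) + 1) ^ (-s) := by
      rw [Real.rpow_neg hkpos.le, Real.rpow_neg hk1.le, ← div_eq_mul_inv, inv_eq_one_div,
        div_le_div_iff₀ (by positivity) (by positivity), one_mul,
        ← Real.mul_rpow (by norm_num) hkpos.le]
      refine Real.rpow_le_rpow hk1.le ?_ hs0.le
      have : (1 : ℝ) ≤ k := by exact_mod_cast hk1'
      linarith
    rw [e1]
    have hmc := mehlerConst_nonneg p (m + 1)
    calc mehlerConst p (m + 1) * (b ^ (m + 1) * (k : ℝ) ^ (-s)) * V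
        ≤ mehlerConst p (m + 1) * (b ^ (m + 1) * (2 ^ s * ((k : ℝ) + 1) ^ (-s))) * V := by gcongr
      _ = B₁ * V * ((k : ℝ) + 1) ^ (-s) := by simp only [B₁]; ring
      _ ≤ _ := by
          gcongr
          have : 0 ≤ ((k₀ : ℝ) + 1) ^ s := by positivity
          linarith
  · have hcs := sq_integral_mul_le (h.memLp_comp 0 hf2) (h.memLp_comp k hf2)
    rw [h.integral_comp 0 (hf.pow_const 2), h.integral_comp k (hf.pow_const 2), ← sq] at hcs
    have h1 := abs_le_of_sq_le_sq hcs hV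
    have h2 : 1 ≤ ((k₀ : ℝ) + 1) ^ s * ((k : ℝ) + 1) ^ (-s) := by
      rw [Real.rpow_neg hk1.le, ← div_eq_mul_inv, one_le_div (by positivity)]
      refine Real.rpow_le_rpow hk1.le ?_ hs0.le
      have : (k : ℝ) ≤ k₀ := by exact_mod_cast (not_le.1 hk).le
      linarith
    calc |∫ ω, f (X 0 ω) * f (X k ω) ∂μ| ≤ V * 1 := by rw [mul_one]; exact h1
      _ ≤ V * (((k₀ : ℝ) + 1) ^ s * ((k : ℝ) + 1) ^ (-s)) := by gcongr
      _ = ((k₀ : ℝ) + 1) ^ s * V * ((k : ℝ) + 1) ^ (-s) := by ring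
      _ ≤ _ := by gcongr; linarith

/-- Lower bound for the normalizing variance under long-range dependence. -/
lemma exists_rpow_le_dNorm_sq [NeZero p] (h : IsStdGaussianSeq μ X) {D : ℝ} (hD : 0 < D)
    (hD1 : D < 1) {L : ℝ → ℝ} (hL : SlowlyVarying L) {c : ℝ} (hc : c ≠ 0)
    (hlrd : ∀ k : ℕ, 1 ≤ k → ∫ ω, X 0 ω 0 * X k ω 0 ∂μ = c * L (k : ℝ) * (k : ℝ) ^ (-D))
    {m : ℕ} (hm : 1 ≤ m) {s : ℝ} (hs : D * m < s) (hs1 : s < 1) :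
    ∃ b : ℝ, 0 < b ∧ ∃ N₀ : ℕ, ∀ N, N₀ ≤ N → b * (N : ℝ) ^ (2 - s) ≤ dNorm μ X m N ^ 2 := by
  set r : ℕ → ℝ := fun k => ∫ ω, X 0 ω 0 * X k ω 0 ∂μ
  have hr1 : ∀ k, |r k| ≤ 1 := fun k => h.abs_cov_le_one 0 k
  have hlow : ∀ τ, D < τ → ∃ k₀ : ℕ, ∀ k, k₀ ≤ k → (1 ≤ k ∧
      (k : ℝ) ^ (-τ) ≤ L k * (k : ℝ) ^ (-D)) := by
    intro τ hτ
    have hev := tendsto_natCast_atTop_atTop.eventually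
      (hL.eventually_rpow_bounds (sub_pos.2 hτ))
    obtain ⟨k₀, hk₀⟩ := eventually_atTop.1 (hev.and (eventually_ge_atTop 1))
    refine ⟨k₀, fun k hk => ⟨(hk₀ k hk).2, ?_⟩⟩
    have hkpos : (0 : ℝ) < k := by exact_mod_cast (hk₀ k hk).2
    calc (k : ℝ) ^ (-τ) = (k : ℝ) ^ (-(τ - D)) * (k : ℝ) ^ (-D) := by
          rw [← Real.rpow_add hkpos]; congr 1; ring
      _ ≤ _ := by gcongr; exact (hk₀ k hk).1.1
  -- A negative c would make the variance of ∑ X_j^{(1)} negative for large N, by the lower bound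
  -- applied to the negated correlations with an exponent between D and 1. Positivity is needed for
  -- c^m > 0 when m is odd.
  have hcpos : 0 < c := by
    by_contra hneg
    have hcneg : 0 < -c := by
      rcases lt_or_gt_of_ne hc with h1 | h1 <;> [linarith; exact absurd h1 hneg]
    obtain ⟨k₀, hk₀⟩ := hlow ((D + 1) / 2) (by linarith)
    obtain ⟨N₀, hN₀⟩ := exists_rpow_le_sum_sum_dist (ρ := fun k => -r k)
      (fun k => by rw [abs_neg]; exact hr1 k) hcneg (s := (D + 1) / 2) (by linarith)
      (by linarith) (k₀ := k₀) (fun k hk => by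
        obtain ⟨h1, h2⟩ := hk₀ k hk
        have h3 : r k = _ := hlrd k h1
        rw [h3]
        have := mul_le_mul_of_nonneg_left h2 hcneg.le
        linarith)
    have h1 := hN₀ (N₀ + 1) (by omega)
    have h2 : 0 < -c / 2 * ((N₀ + 1 : ℕ) : ℝ) ^ (2 - (D + 1) / 2) := by positivity
    have h3 := h.integral_sum_sq (Finset.range (N₀ + 1)) (memLp_eval_stdNormalPi (0 : Fin p))
    have h4 : 0 ≤ ∫ ω, (∑ j ∈ Finset.range (N₀ + 1), X j ω 0) ^ 2 ∂μ :=
      integral_nonneg fun _ => sq_nonneg _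
    rw [h3] at h4
    have h5 : ∀ i j, ∫ ω, X i ω 0 * X j ω 0 ∂μ = r (Nat.dist i j) := fun i j =>
      h.integral_dist (f := fun x => x 0) (measurable_pi_apply 0) i j
    simp_rw [h5] at h4
    simp only [Finset.sum_neg_distrib] at h1
    linarith
  have hm0 : (0 : ℝ) < m := by exact_mod_cast hm
  -- Now τ > D, so L(k) k^{-D} is eventually at least k^{-τ}, whose m-th power is k^{-s}.
  set τ := s / m
  have hτD : D < τ := by rw [lt_div_iff₀ hm0]; exact hs
  obtain ⟨k₀, hk₀⟩ := hlow τ hτD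
  have hs0 : 0 < s := lt_trans (by positivity) hs
  obtain ⟨N₀, hN₀⟩ := exists_rpow_le_sum_sum_dist (ρ := fun k => r k ^ m)
    (fun k => by rw [abs_pow]; exact pow_le_one₀ (abs_nonneg _) (hr1 k)) (c := c ^ m)
    (by positivity) hs0 hs1 (k₀ := k₀) (fun k hk => by
      obtain ⟨h1, h2⟩ := hk₀ k hk
      have hkpos : (0 : ℝ) < k := by exact_mod_cast h1
      have e : (k : ℝ) ^ (-s) = ((k : ℝ) ^ (-τ)) ^ m := by
        rw [← Real.rpow_natCast, ← Real.rpow_mul hkpos.le]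
        congr 1
        simp only [τ]
        field_simp
      have h3 : r k = _ := hlrd k h1
      rw [h3, e, ← mul_pow, mul_assoc]
      gcongr)
  refine ⟨m.factorial * (c ^ m / 2), by positivity, N₀, fun N hN => ?_⟩
  rw [dNorm, Real.sq_sqrt (variance_nonneg _ _), h.variance_sum_hermiteFn hm, mul_assoc]
  gcongr
  exact hN₀ N hN

end IsStdGaussianSeq

/-! ### Removing the lowest-order part of the Hermite expansion -/

section Reduction

variable {p : ℕ}

/-- `φ` minus its mean and its Hermite component of degree `m`. -/
noncomputable def hermiteRemainder (m : ℕ) (φ : (Fin p → ℝ) → ℝ) (s : Fin p → ℝ) : ℝ :=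
  φ s - ∫ x, φ x ∂(stdNormalPi p) - ∑ l ∈ Finset.piAntidiag (Finset.univ : Finset (Fin p)) m,
    (∫ x, φ x * hermiteMv l x ∂(stdNormalPi p)) / (∏ i, ((l i).factorial : ℝ)) * hermiteMv l s

variable {m : ℕ} {φ ψ : (Fin p → ℝ) → ℝ}

lemma measurable_hermiteRemainder (hφ : Measurable φ) : Measurable (hermiteRemainder m φ) := by
  unfold hermiteRemainder
  refine (hφ.sub_const _).sub (Finset.measurable_sum _ fun l _ => ?_)
  exact (continuous_hermiteMv l).measurable.const_mul _

lemma memLp_hermiteRemainder (hφ : MemLp φ 2 (stdNormalPi p)) :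
    MemLp (hermiteRemainder m φ) 2 (stdNormalPi p) :=
  (hφ.sub (memLp_const _)).sub (memLp_finsetSum _ fun l _ => (memLp_hermiteMv l).const_mul _)

lemma mem_piAntidiag_univ {l : Fin p → ℕ} :
    l ∈ Finset.piAntidiag (Finset.univ : Finset (Fin p)) m ↔ ∑ i, l i = m := by
  simp [Finset.mem_piAntidiag]

/-- The mean is the term of degree 0, and the degrees strictly between 0 and m contribute nothing.
So the remainder is φ minus its orthogonal projection onto all degrees at most m, and orthogonality
and Bessel's identity become available. -/
lemma hermiteRemainder_eq (hm : 1 ≤ m)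
    (hlow : ∀ l : Fin p → ℕ, 0 < ∑ i, l i → ∑ i, l i < m →
      ∫ x, φ x * hermiteMv l x ∂(stdNormalPi p) = 0) (s : Fin p → ℝ) :
    hermiteRemainder m φ s = φ s - ∑ l ∈ multiIndexLT p (m + 1),
      (∫ x, φ x * hermiteMv l x ∂(stdNormalPi p)) / (∏ i, ((l i).factorial : ℝ)) *
        hermiteMv l s := by
  have hnot : (fun _ => 0 : Fin p → ℕ) ∉ Finset.piAntidiag (Finset.univ : Finset (Fin p)) m := by
    rw [mem_piAntidiag_univ]; simp; omega
  have hsub : insert (fun _ => 0) (Finset.piAntidiag (Finset.univ : Finset (Fin p)) m) ⊆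
      multiIndexLT p (m + 1) := by
    intro l hl
    rw [mem_multiIndexLT]
    rcases Finset.mem_insert.1 hl with rfl | hl
    · simp
    · rw [mem_piAntidiag_univ.1 hl]; omega
  rw [← Finset.sum_subset hsub, Finset.sum_insert hnot, hermiteRemainder]
  · simp [hermiteMv_zero]
    ring
  · intro l hl hl'
    rw [mem_multiIndexLT] at hl
    rw [Finset.mem_insert, not_or, mem_piAntidiag_univ] at hl'
    have hpos : 0 < ∑ i, l i := by
      rw [Nat.pos_iff_ne_zero]
      intro h0
      apply hl'.1
      ext i
      simpa using Finset.sum_eq_zero_iff.1 h0 i (Finset.mem_univ i)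
    rw [hlow l hpos (by omega), zero_div, zero_mul]

lemma integral_hermiteRemainder_mul_eq_zero (hm : 1 ≤ m) (hφ : MemLp φ 2 (stdNormalPi p))
    (hlow : ∀ l : Fin p → ℕ, 0 < ∑ i, l i → ∑ i, l i < m →
      ∫ x, φ x * hermiteMv l x ∂(stdNormalPi p) = 0) {k : Fin p → ℕ}
    (hk : k ∈ multiIndexLT p (m + 1)) :
    ∫ s, hermiteRemainder m φ s * hermiteMv k s ∂(stdNormalPi p) = 0 := by
  simp_rw [hermiteRemainder_eq hm hlow, sub_mul, Finset.sum_mul, mul_assoc]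
  have hi : ∀ l : Fin p → ℕ, Integrable (fun s =>
      (∫ x, φ x * hermiteMv l x ∂(stdNormalPi p)) / (∏ i, ((l i).factorial : ℝ)) *
        (hermiteMv l s * hermiteMv k s)) (stdNormalPi p) :=
    fun l => (integrable_hermiteMv_mul l k).const_mul _
  rw [integral_sub (integrable_mul_of_memLp_two hφ (memLp_hermiteMv k))
    (integrable_finsetSum _ fun l _ => hi l), integral_finsetSum _ fun l _ => hi l,
    Finset.sum_eq_single_of_mem k hk]
  · rw [integral_const_mul, integral_hermiteMv_mul, if_pos rfl,
      div_mul_cancel₀ _ (prod_factorial_pos k).ne', sub_self]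
  · intro l _ hlk
    rw [integral_const_mul, integral_hermiteMv_mul, if_neg hlk, mul_zero]

lemma integral_hermiteRemainder_sq_le (hm : 1 ≤ m) (hφ : MemLp φ 2 (stdNormalPi p))
    (hlow : ∀ l : Fin p → ℕ, 0 < ∑ i, l i → ∑ i, l i < m →
      ∫ x, φ x * hermiteMv l x ∂(stdNormalPi p) = 0) :
    ∫ s, hermiteRemainder m φ s ^ 2 ∂(stdNormalPi p) ≤ ∫ s, φ s ^ 2 ∂(stdNormalPi p) := by
  simp_rw [hermiteRemainder_eq hm hlow]
  rw [integral_sub_proj_sq (multiIndexLT p (m + 1)) hermiteMv (fun l => ∏ i, ((l i).factorial : ℝ))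
    (fun l _ => (prod_factorial_pos l).ne') (fun l _ => memLp_hermiteMv l)
    (fun l _ k _ => integral_hermiteMv_mul l k) hφ (fun l _ => rfl), sub_le_self_iff]
  exact Finset.sum_nonneg fun l _ => div_nonneg (sq_nonneg _) (prod_factorial_pos l).le

lemma hermiteRemainder_sum {ι : Type*} (S : Finset ι) {f : ι → (Fin p → ℝ) → ℝ}
    (hf : ∀ k ∈ S, MemLp (f k) 2 (stdNormalPi p)) (s : Fin p → ℝ) :
    hermiteRemainder m (fun x => ∑ k ∈ S, f k x) s = ∑ k ∈ S, hermiteRemainder m (f k) s := by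
  simp only [hermiteRemainder, Finset.sum_sub_distrib, Finset.sum_mul]
  rw [integral_finsetSum S fun k hk => (hf k hk).integrable one_le_two, Finset.sum_comm (s := S)]
  congr 1
  refine Finset.sum_congr rfl fun l _ => ?_
  rw [integral_finsetSum S fun k hk => integrable_mul_of_memLp_two (hf k hk) (memLp_hermiteMv l),
    Finset.sum_div, Finset.sum_mul]

lemma hermiteRemainder_ite (P : Prop) [Decidable P] (s : Fin p → ℝ) :
    hermiteRemainder m (fun x => if P then φ x else 0) s =
      if P then hermiteRemainder m φ s else 0 := by
  split_ifs <;> simp [hermiteRemainder]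

/-- An envelope for the increments of the Hermite component of degree `m`. -/
noncomputable def hermiteEnvelope (p m : ℕ) (s : Fin p → ℝ) : ℝ :=
  1 + ∑ l ∈ Finset.piAntidiag (Finset.univ : Finset (Fin p)) m, |hermiteMv l s|

lemma hermiteEnvelope_nonneg (s : Fin p → ℝ) : 0 ≤ hermiteEnvelope p m s := by
  unfold hermiteEnvelope; positivity

lemma measurable_hermiteEnvelope : Measurable (hermiteEnvelope p m) := by
  unfold hermiteEnvelope
  refine Measurable.const_add (Finset.measurable_sum _ fun l _ => ?_) _
  exact (continuous_hermiteMv l).abs.measurable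

lemma memLp_hermiteEnvelope : MemLp (hermiteEnvelope p m) 2 (stdNormalPi p) := by
  have h1 : MemLp (fun s => ∑ l ∈ Finset.piAntidiag (Finset.univ : Finset (Fin p)) m,
      |hermiteMv l s|) 2 (stdNormalPi p) :=
    memLp_finsetSum _ fun l _ => (memLp_hermiteMv l).norm
  have h2 : MemLp (fun _ : Fin p → ℝ => (1 : ℝ)) 2 (stdNormalPi p) := memLp_const 1
  exact h2.add h1

/-- Taking remainders does not preserve order. What is lost is the increment of the mean and of the
degree-m coefficients, each bounded by Cauchy-Schwarz in terms of ‖ψ - φ‖ ≤ η. -/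
lemma hermiteRemainder_le_add (hφ : MemLp φ 2 (stdNormalPi p)) (hψ : MemLp ψ 2 (stdNormalPi p))
    (hle : ∀ s, φ s ≤ ψ s) {η : ℝ} (hη : 0 ≤ η)
    (hd : ∫ s, (ψ s - φ s) ^ 2 ∂(stdNormalPi p) ≤ η ^ 2) (s : Fin p → ℝ) :
    hermiteRemainder m φ s ≤ hermiteRemainder m ψ s + η * hermiteEnvelope p m s := by
  have hdiff : MemLp (fun s => ψ s - φ s) 2 (stdNormalPi p) := hψ.sub hφ
  have hcoef : ∀ l : Fin p → ℕ,
      |(∫ x, ψ x * hermiteMv l x ∂(stdNormalPi p)) - ∫ x, φ x * hermiteMv l x ∂(stdNormalPi p)|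
        ≤ η * ∏ i, ((l i).factorial : ℝ) := by
    intro l
    have hc := sq_integral_mul_le hdiff (memLp_hermiteMv l)
    have hn := integral_hermiteMv_mul l l
    rw [if_pos rfl] at hn
    simp_rw [← sq] at hn
    rw [hn] at hc
    simp_rw [sub_mul] at hc
    rw [integral_sub (integrable_mul_of_memLp_two hψ (memLp_hermiteMv l))
      (integrable_mul_of_memLp_two hφ (memLp_hermiteMv l))] at hc
    have h1 : 1 ≤ ∏ i, ((l i).factorial : ℝ) := by
      have : 1 ≤ ∏ i, (l i).factorial := Finset.prod_pos fun i _ => Nat.factorial_pos _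
      exact_mod_cast this
    -- Cauchy-Schwarz gives η √(∏ l_i!); the factorial product is at least 1, so the root is
    -- dropped, and the product later cancels the denominator of the Hermite term.
    refine abs_le_of_sq_le_sq (hc.trans ?_) (by positivity)
    rw [mul_pow]
    nlinarith [sq_nonneg η]
  have hmean : ∫ x, ψ x ∂(stdNormalPi p) - ∫ x, φ x ∂(stdNormalPi p) ≤ η := by
    have := hcoef (fun _ => 0)
    simp only [hermiteMv_zero, mul_one, Nat.factorial_zero, Nat.cast_one,
      Finset.prod_const_one] at this
    exact (le_abs_self _).trans this
  have hsum : (∑ l ∈ Finset.piAntidiag (Finset.univ : Finset (Fin p)) m,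
      (∫ x, ψ x * hermiteMv l x ∂(stdNormalPi p)) / (∏ i, ((l i).factorial : ℝ)) * hermiteMv l s) -
      (∑ l ∈ Finset.piAntidiag (Finset.univ : Finset (Fin p)) m,
      (∫ x, φ x * hermiteMv l x ∂(stdNormalPi p)) / (∏ i, ((l i).factorial : ℝ)) * hermiteMv l s)
      ≤ η * ∑ l ∈ Finset.piAntidiag (Finset.univ : Finset (Fin p)) m, |hermiteMv l s| := by
    rw [← Finset.sum_sub_distrib, Finset.mul_sum]
    refine Finset.sum_le_sum fun l _ => ?_
    rw [← sub_mul, ← sub_div]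
    refine (le_abs_self _).trans ?_
    rw [abs_mul, abs_div, abs_of_pos (prod_factorial_pos l)]
    gcongr
    rw [div_le_iff₀ (prod_factorial_pos l)]
    exact hcoef l
  simp only [hermiteRemainder, hermiteEnvelope, mul_add]
  have := hle s
  linarith

end Reduction

/-! ### Hermite coefficients of the indicators of measurable sets -/

section Rank

variable {p q : ℕ}

/-- If the Hermite coefficient vanishes for all orthants, it vanishes for all measurable sets. -/
lemma integral_indicator_mul_eq_zero {α : Type*} [MeasurableSpace α] {ν : Measure α}
    {G : α → Fin q → ℝ} (hG : Measurable G) {H : α → ℝ} (hH : Integrable H ν)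
    (h0 : ∫ s, H s ∂ν = 0)
    (horth : ∀ x : Fin q → ℝ, ∫ s, (Set.Iic x).indicator (fun _ => (1 : ℝ)) (G s) * H s ∂ν = 0)
    {A : Set (Fin q → ℝ)} (hA : MeasurableSet A) :
    ∫ s, A.indicator (fun _ => (1 : ℝ)) (G s) * H s ∂ν = 0 := by
  have hset : ∀ A : Set (Fin q → ℝ), MeasurableSet A →
      ∫ s, A.indicator (fun _ => (1 : ℝ)) (G s) * H s ∂ν = ∫ s in G ⁻¹' A, H s ∂ν := by
    intro A hA
    rw [← integral_indicator (hG hA)]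
    congr 1
    ext s
    by_cases h : G s ∈ A <;> simp [h]
  rw [hset A hA]
  have hgen : (MeasurableSpace.pi : MeasurableSpace (Fin q → ℝ)) = MeasurableSpace.generateFrom
      (Set.univ.pi '' Set.univ.pi fun _ : Fin q => Set.range Set.Iic) := by
    symm
    refine generateFrom_eq_pi (fun _ => ?_) fun _ => ?_
    · rw [← borel_eq_generateFrom_Iic]
      exact (BorelSpace.measurable_eq (α := ℝ)).symm
    · refine ⟨fun n => Set.Iic (n : ℝ), fun n => ⟨n, rfl⟩, ?_⟩
      ext x
      simpa using exists_nat_ge x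
  refine MeasurableSpace.induction_on_inter (C := fun A _ => ∫ s in G ⁻¹' A, H s ∂ν = 0) hgen
    (IsPiSystem.pi fun _ => isPiSystem_Iic) (by simp) ?_ ?_ ?_ A hA
  · rintro _ ⟨t, ht, rfl⟩
    choose x hx using fun i => ht i (Set.mem_univ i)
    have e : Set.univ.pi t = Set.Iic x := by
      ext y
      simp [Pi.le_def, ← hx]
    rw [e, ← hset _ measurableSet_Iic]
    exact horth x
  -- The vanishing total integral `h0` is what makes the class of good sets closed under
  -- complements.
  · intro t ht h
    have := integral_add_compl (hG ht) hH
    rw [Set.preimage_compl]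
    linarith
  · intro f hd hf h
    rw [Set.preimage_iUnion, integral_iUnion (fun i => hG (hf i))
      (fun i j hij => (hd hij).preimage G) hH.integrableOn]
    simp [h]

end Rank

/-! ### Dyadic decomposition -/

/-- Telescoping over the scales. Comparing r with a after division by 2^k and by 2^{k+1} gives
different answers only if the block of a is odd and r lies in its left sibling. At scale K + 1 the
quotient of a is 0 and nothing is left. -/
lemma ite_lt_eq_sum_dyadic {K a : ℕ} (ha : a < 2 ^ (K + 1)) (r : ℕ) :
    (if r < a then (1 : ℝ) else 0) = ∑ k ∈ Finset.range (K + 1),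
      if (a / 2 ^ k) % 2 = 1 ∧ r / 2 ^ k = a / 2 ^ k - 1 then 1 else 0 := by
  have hstep : ∀ k, (if (a / 2 ^ k) % 2 = 1 ∧ r / 2 ^ k = a / 2 ^ k - 1 then (1 : ℝ) else 0) =
      (if r / 2 ^ k < a / 2 ^ k then 1 else 0) -
        (if r / 2 ^ (k + 1) < a / 2 ^ (k + 1) then 1 else 0) := by
    intro k
    rw [pow_succ, ← Nat.div_div_eq_div_mul, ← Nat.div_div_eq_div_mul]
    generalize a / 2 ^ k = A
    generalize r / 2 ^ k = R
    split_ifs <;> first | omega | norm_num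
  simp_rw [hstep]
  rw [Finset.sum_range_sub', Nat.div_eq_of_lt ha]
  simp

section Chaining

variable {q : ℕ}

/-- Admissible vectors of dyadic levels. -/
def dyadicLevels (q K : ℕ) : Finset (Fin q → ℕ) :=
  Fintype.piFinset fun _ => Finset.range (K + 1)

lemma card_dyadicLevels (q K : ℕ) : (dyadicLevels q K).card = (K + 1) ^ q := by
  simp [dyadicLevels]

/-- The dyadic cell of level `κ` and position `c` with respect to the discretization `r`. -/
def dyadicCell (r : Fin q → ℝ → ℕ) (κ c : Fin q → ℕ) : Set (Fin q → ℝ) :=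
  {y | ∀ i, r i (y i) / 2 ^ κ i = c i}

/-- The lower set determined by `a` with respect to the discretization `r`. -/
def discreteOrthant (r : Fin q → ℝ → ℕ) (a : Fin q → ℕ) : Set (Fin q → ℝ) :=
  {y | ∀ i, r i (y i) < a i}

lemma measurableSet_dyadicCell {r : Fin q → ℝ → ℕ} (hr : ∀ i, Measurable (r i))
    (κ c : Fin q → ℕ) : MeasurableSet (dyadicCell r κ c) := by
  have : dyadicCell r κ c = ⋂ i, (fun y : Fin q → ℝ => r i (y i)) ⁻¹' {n | n / 2 ^ κ i = c i} := by
    ext; simp [dyadicCell]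
  rw [this]
  exact MeasurableSet.iInter fun i => ((hr i).comp (measurable_pi_apply i)) .of_discrete

lemma measurableSet_discreteOrthant {r : Fin q → ℝ → ℕ} (hr : ∀ i, Measurable (r i))
    (a : Fin q → ℕ) : MeasurableSet (discreteOrthant r a) := by
  have : discreteOrthant r a = ⋂ i, (fun y : Fin q → ℝ => r i (y i)) ⁻¹' {n | n < a i} := by
    ext; simp [discreteOrthant]
  rw [this]
  exact MeasurableSet.iInter fun i => ((hr i).comp (measurable_pi_apply i)) .of_discrete

/-- The indicator is a product of one-dimensional ones; expanding the product of their dyadic sums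
gives one cell for each vector of levels. -/
lemma indicator_discreteOrthant_eq_sum (r : Fin q → ℝ → ℕ) {K : ℕ} {a : Fin q → ℕ}
    (ha : ∀ i, a i < 2 ^ (K + 1)) (y : Fin q → ℝ) :
    (discreteOrthant r a).indicator (fun _ => (1 : ℝ)) y = ∑ κ ∈ dyadicLevels q K,
      if ∀ i, (a i / 2 ^ κ i) % 2 = 1 then
        (dyadicCell r κ fun i => a i / 2 ^ κ i - 1).indicator (fun _ => (1 : ℝ)) y else 0 := by
  have h1 : (discreteOrthant r a).indicator (fun _ => (1 : ℝ)) y =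
      ∏ i, if r i (y i) < a i then (1 : ℝ) else 0 := by
    rw [Finset.prod_ite_zero]
    simp [Set.indicator_apply, discreteOrthant]
  rw [h1]
  simp_rw [fun i => ite_lt_eq_sum_dyadic (ha i) (r i (y i))]
  rw [Finset.prod_univ_sum]
  refine Finset.sum_congr rfl fun κ _ => ?_
  rw [Finset.prod_ite_zero]
  simp only [Finset.mem_univ, true_imp_iff, Finset.prod_const_one, Set.indicator_apply,
    dyadicCell, forall_and, Set.mem_ofPred_eq, ite_and]

lemma sum_range_eq_sum_dyadic {K n N : ℕ} (hn : n ≤ N) (hnK : n < 2 ^ (K + 1)) (f : ℕ → ℝ) :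
    ∑ j ∈ Finset.range n, f j = ∑ k ∈ Finset.range (K + 1), if (n / 2 ^ k) % 2 = 1 then
      ∑ j ∈ (Finset.range N).filter (fun j => j / 2 ^ k = n / 2 ^ k - 1), f j else 0 := by
  have h1 : ∑ j ∈ Finset.range n, f j = ∑ j ∈ Finset.range N, (if j < n then 1 else 0) * f j := by
    simp_rw [ite_mul, one_mul, zero_mul]
    rw [← Finset.sum_filter]
    congr 1
    ext j
    simp only [Finset.mem_range, Finset.mem_filter]
    omega
  rw [h1]
  simp_rw [fun j => ite_lt_eq_sum_dyadic hnK j, Finset.sum_mul]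
  rw [Finset.sum_comm]
  refine Finset.sum_congr rfl fun k _ => ?_
  split_ifs with h
  · simp [h, Finset.sum_filter]
  · simp [h]

/-- The maximal inequality behind the chaining argument: partial sums over initial segments and
discretized orthants are controlled by the sum of squares over dyadic blocks and cells. -/
lemma sq_sum_le_dyadic {K n N A : ℕ} (hn : n ≤ N) (hnK : n < 2 ^ (K + 1)) {a : Fin q → ℕ}
    (ha : ∀ i, a i ≤ A) (g : (Fin q → ℕ) → (Fin q → ℕ) → ℕ → ℝ) :
    (∑ j ∈ Finset.range n, ∑ κ ∈ dyadicLevels q K, if ∀ i, (a i / 2 ^ κ i) % 2 = 1 then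
        g κ (fun i => a i / 2 ^ κ i - 1) j else 0) ^ 2 ≤
      ((K : ℝ) + 1) ^ (q + 1) * ∑ z ∈ Finset.range (K + 1) ×ˢ dyadicLevels q K,
        ∑ w ∈ Finset.range N ×ˢ Fintype.piFinset fun _ : Fin q => Finset.range A,
          (∑ j ∈ (Finset.range N).filter (fun j => j / 2 ^ z.1 = w.1), g z.2 w.2 j) ^ 2 := by
  set T : ℕ × (Fin q → ℕ) → ℕ × (Fin q → ℕ) → ℝ := fun z w =>
    ∑ j ∈ (Finset.range N).filter (fun j => j / 2 ^ z.1 = w.1), g z.2 w.2 j with hT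
  have hcoord : ∑ j ∈ Finset.range n, ∑ κ ∈ dyadicLevels q K,
      (if ∀ i, (a i / 2 ^ κ i) % 2 = 1 then g κ (fun i => a i / 2 ^ κ i - 1) j else 0) =
      ∑ z ∈ Finset.range (K + 1) ×ˢ dyadicLevels q K,
        if (n / 2 ^ z.1) % 2 = 1 ∧ ∀ i, (a i / 2 ^ z.2 i) % 2 = 1 then
          T z (n / 2 ^ z.1 - 1, fun i => a i / 2 ^ z.2 i - 1) else 0 := by
    rw [sum_range_eq_sum_dyadic hn hnK, Finset.sum_product]
    refine Finset.sum_congr rfl fun k _ => ?_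
    split_ifs with h
    · rw [Finset.sum_comm]
      refine Finset.sum_congr rfl fun κ _ => ?_
      split_ifs with h2 h3 h3
      · rfl
      · exact absurd ⟨h, h2⟩ h3
      · exact absurd h3.2 h2
      · simp
    · exact (Finset.sum_eq_zero fun κ _ => if_neg fun h2 => h h2.1).symm
  rw [hcoord]
  -- Cauchy-Schwarz over the scales. For each scale the square of the single box selected by (n, a)
  -- is then bounded by the sum over all boxes, which removes the dependence on n and a.
  refine sq_sum_le_card_mul_sum_sq.trans ?_
  have hcard : ((Finset.range (K + 1) ×ˢ dyadicLevels q K).card : ℝ) = ((K : ℝ) + 1) ^ (q + 1) := by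
    rw [Finset.card_product, card_dyadicLevels, Finset.card_range]
    push_cast
    ring
  rw [hcard]
  gcongr with z hz
  split_ifs with h
  · refine Finset.single_le_sum (f := fun w => T z w ^ 2) (fun w _ => sq_nonneg _)
      (a := (n / 2 ^ z.1 - 1, fun i => a i / 2 ^ z.2 i - 1)) ?_
    rw [Finset.mem_product, Finset.mem_range, Fintype.mem_piFinset]
    refine ⟨?_, fun i => Finset.mem_range.2 ?_⟩
    -- An odd quotient is at least 1, so subtracting 1 is not truncated and lands strictly below N.
    · have h1 := h.1
      have h2 : n / 2 ^ z.1 ≤ n := Nat.div_le_self _ _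
      show n / 2 ^ z.1 - 1 < N
      generalize n / 2 ^ z.1 = x at h1 h2 ⊢
      omega
    · have h1 := h.2 i
      have h2 : a i / 2 ^ z.2 i ≤ a i := Nat.div_le_self _ _
      have h3 := ha i
      show a i / 2 ^ z.2 i - 1 < A
      generalize a i / 2 ^ z.2 i = x at h1 h2 ⊢
      omega
  · rw [zero_pow two_ne_zero]
    exact Finset.sum_nonneg fun w _ => sq_nonneg _

end Chaining

/-! ### Discretization of the line -/

/-- A monotone discretization of the line whose non-degenerate cells have small mass. -/
lemma exists_discretization (ν : Measure ℝ) [IsProbabilityMeasure ν] (M : ℕ) (hM : 0 < M) :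
    ∃ r : ℝ → ℕ, Measurable r ∧ ∀ x : EReal, ∃ a b : ℕ, a ≤ 2 * M + 1 ∧ b ≤ 2 * M + 1 ∧
      {y | r y < a} ⊆ {y : ℝ | (y : EReal) ≤ x} ∧ {y : ℝ | (y : EReal) ≤ x} ⊆ {y | r y < b} ∧
      ν.real ({y | r y < b} \ {y | r y < a}) ≤ 1 / M := by
  have hM' : (0 : ℝ) < M := by exact_mod_cast hM
  set f : ℝ → ℕ := fun y => ⌊M * ν.real (Set.Iio y)⌋₊
  set g : ℝ → ℕ := fun y => ⌊M * ν.real (Set.Iic y)⌋₊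
  have hfmono : Monotone f := fun y z hyz =>
    Nat.floor_mono (mul_le_mul_of_nonneg_left (measureReal_mono (Set.Iio_subset_Iio hyz)) hM'.le)
  have hgmono : Monotone g := fun y z hyz =>
    Nat.floor_mono (mul_le_mul_of_nonneg_left (measureReal_mono (Set.Iic_subset_Iic.2 hyz)) hM'.le)
  have hfg : ∀ y, f y ≤ g y := fun y =>
    Nat.floor_mono (mul_le_mul_of_nonneg_left (measureReal_mono Set.Iio_subset_Iic_self) hM'.le)
  have hgf : ∀ {y z}, y < z → g y ≤ f z := fun {y z} hyz =>
    Nat.floor_mono (mul_le_mul_of_nonneg_left (measureReal_mono fun w hw =>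
      lt_of_le_of_lt hw hyz) hM'.le)
  have hgM : ∀ y, g y ≤ M := by
    intro y
    have h1 : (M : ℝ) * ν.real (Set.Iic y) ≤ M := by
      have : ν.real (Set.Iic y) ≤ 1 := measureReal_le_one
      nlinarith
    exact (Nat.floor_mono h1).trans (Nat.floor_natCast M).le
  -- Both quantile functions are needed: the open half-line misses an atom at y, the closed one
  -- contains it. An atom across which they differ receives a value of `r` of its own.
  set r : ℝ → ℕ := fun y => f y + g y
  have hrmono : Monotone r := fun y z hyz => Nat.add_le_add (hfmono hyz) (hgmono hyz)
  have hrm : Measurable r := hrmono.measurable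
  have hr2 : ∀ y, r y < 2 * M + 1 := fun y => by
    have := hfg y; have := hgM y; simp only [r]; omega
  refine ⟨r, hrm, fun x => ?_⟩
  induction x using EReal.rec with
  | bot => exact ⟨0, 0, by omega, by omega, by simp, by simp, by simp⟩
  | top => exact ⟨2 * M + 1, 2 * M + 1, le_rfl, le_rfl, by simp, by simp [hr2], by simp⟩
  | coe x =>
    simp only [EReal.coe_le_coe_iff]
    -- If the value at x is shared, x is bracketed by the strict and the weak sublevel set, and the
    -- level set has to be shown small. Otherwise the half-line up to x is itself a sublevel set and
    -- there is no error.
    by_cases hx : ∃ y, y ≠ x ∧ r y = r x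
    · obtain ⟨y₀, hy₀, hry₀⟩ := hx
      refine ⟨r x, r x + 1, (hr2 x).le, hr2 x, ?_, ?_, ?_⟩
      · intro y hy
        by_contra hxy
        exact absurd (hrmono (not_le.1 hxy).le) (not_le.2 hy)
      · intro y hy
        exact Nat.lt_succ_of_le (hrmono hy)
      · have hcell : {y | r y < r x + 1} \ {y | r y < r x} = r ⁻¹' {r x} := by
          ext y
          simp only [Set.mem_sdiff, Set.mem_ofPred_eq, Set.mem_preimage, Set.mem_singleton_iff]
          omega
        rw [hcell]
        -- For y < z one has f y ≤ g y ≤ f z ≤ g z, so equal sums force all four to coincide.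
        have hpair : ∀ {y z}, y < z → r y = r z → f y = g y ∧ g y = f z ∧ f z = g z := by
          intro y z hyz h
          have h1 := hfg y; have h2 := hgf hyz; have h3 := hfg z
          have h4 : f y + g y = f z + g z := h
          omega
        have hval : ∀ y, r y = r x → f y = f x ∧ g y = f x := by
          have hxx : f x = g x := by
            rcases lt_or_gt_of_ne hy₀ with h | h
            · exact (hpair h hry₀).2.2
            · exact (hpair h hry₀.symm).1
          intro y hy
          rcases lt_trichotomy y x with h | h | h
          · have := hpair h hy; omega
          · subst h; omega
          · have := hpair h hy.symm; omega
        by_contra hlt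
        rw [not_le] at hlt
        have hcm : MeasurableSet (r ⁻¹' {r x}) := hrm (measurableSet_singleton _)
        have hlt' : ENNReal.ofReal (1 / M) < ν (r ⁻¹' {r x}) := by
          rw [measureReal_def, ← ENNReal.ofReal_lt_iff_lt_toReal (by positivity)
            (measure_ne_top _ _)] at hlt
          exact hlt
        -- Inner regularity supplies a compact subset whose extreme points y and z lie in the level
        -- set itself. There f y = g z = f x, so M ν([y, z]) is at most 1, although the level set
        -- may have no end points.
        obtain ⟨C, hCs, hCc, hCν⟩ := hcm.exists_lt_isCompact hlt'
        have hCne : C.Nonempty := by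
          rw [Set.nonempty_iff_ne_empty]
          rintro rfl
          simp at hCν
        obtain ⟨y, hy⟩ := hCc.exists_isLeast hCne
        obtain ⟨z, hz⟩ := hCc.exists_isGreatest hCne
        have hyz : y ≤ z := hy.2 hz.1
        have hsub : C ⊆ Set.Icc y z := fun w hw => ⟨hy.2 hw, hz.2 hw⟩
        have hIcc : ν.real (Set.Icc y z) = ν.real (Set.Iic z) - ν.real (Set.Iio y) := by
          have : Set.Icc y z = Set.Iic z \ Set.Iio y := by
            ext w; simp
          have hsub' : Set.Iio y ⊆ Set.Iic z := fun w hw => (le_of_lt hw).trans hyz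
          rw [this, measureReal_sdiff hsub' measurableSet_Iio]
        have hfy := (hval y (hCs hy.1)).1
        have hgz := (hval z (hCs hz.1)).2
        have b1 : (f x : ℝ) ≤ M * ν.real (Set.Iio y) := by
          rw [← hfy]; exact Nat.floor_le (by positivity)
        have b2 : M * ν.real (Set.Iic z) < f x + 1 := by
          rw [← hgz]; exact Nat.lt_floor_add_one _
        have b3 : ν.real (Set.Icc y z) ≤ 1 / M := by
          rw [hIcc, le_div_iff₀ hM']
          nlinarith
        have b4 : ν C ≤ ENNReal.ofReal (1 / M) := by
          refine (measure_mono hsub).trans ?_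
          rw [← ENNReal.ofReal_toReal (measure_ne_top ν (Set.Icc y z))]
          exact ENNReal.ofReal_le_ofReal b3
        exact absurd hCν (not_lt.2 b4)
    · push Not at hx
      have heq : ∀ y, r y < r x + 1 ↔ y ≤ x := by
        intro y
        constructor
        · intro h
          by_contra hxy
          rw [not_le] at hxy
          exact hx y hxy.ne' (le_antisymm (by omega) (hrmono hxy.le))
        · intro h
          have := hrmono h
          omega
      refine ⟨r x + 1, r x + 1, hr2 x, hr2 x, fun y hy => (heq y).1 hy,
        fun y hy => (heq y).2 hy, ?_⟩
      simp

/-! ### Remainders of subordinated indicators -/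

section SetRemainder

variable {p q : ℕ}

/-- The Hermite remainder of the indicator of `G ⁻¹' A`. -/
noncomputable def setRemainder (m : ℕ) (G : (Fin p → ℝ) → Fin q → ℝ) (A : Set (Fin q → ℝ)) :
    (Fin p → ℝ) → ℝ :=
  hermiteRemainder m fun s => A.indicator (fun _ => (1 : ℝ)) (G s)

variable {m : ℕ} {G : (Fin p → ℝ) → Fin q → ℝ} {A B : Set (Fin q → ℝ)}

lemma measurable_indicator_comp (hG : Measurable G) (hA : MeasurableSet A) :
    Measurable fun s => A.indicator (fun _ => (1 : ℝ)) (G s) :=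
  (measurable_const.indicator hA).comp hG

lemma memLp_indicator_comp (hG : Measurable G) (hA : MeasurableSet A) :
    MemLp (fun s => A.indicator (fun _ => (1 : ℝ)) (G s)) 2 (stdNormalPi p) := by
  refine MemLp.of_bound (measurable_indicator_comp hG hA).aestronglyMeasurable 1
    (Eventually.of_forall fun s => ?_)
  by_cases h : G s ∈ A <;> simp [h]

lemma integral_indicator_comp (hG : Measurable G) (hA : MeasurableSet A) :
    ∫ s, A.indicator (fun _ => (1 : ℝ)) (G s) ∂(stdNormalPi p) =
      ((stdNormalPi p).map G).real A := by
  rw [← integral_map (f := fun y => A.indicator (fun _ => (1 : ℝ)) y) hG.aemeasurable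
    (measurable_const.indicator hA).aestronglyMeasurable]
  exact integral_indicator_one hA

lemma measurable_setRemainder (hG : Measurable G) (hA : MeasurableSet A) :
    Measurable (setRemainder m G A) :=
  measurable_hermiteRemainder (measurable_indicator_comp hG hA)

lemma memLp_setRemainder (hG : Measurable G) (hA : MeasurableSet A) :
    MemLp (setRemainder m G A) 2 (stdNormalPi p) :=
  memLp_hermiteRemainder (memLp_indicator_comp hG hA)

/-- An indicator equals its square, so Bessel's inequality yields the first power of the mass of A.
This linearity is what lets the bounds be summed over disjoint cells. -/
lemma integral_setRemainder_sq_le (hm : 1 ≤ m) (hG : Measurable G) (hA : MeasurableSet A)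
    (hlow : ∀ l : Fin p → ℕ, 0 < ∑ i, l i → ∑ i, l i < m →
      ∫ s, A.indicator (fun _ => (1 : ℝ)) (G s) * hermiteMv l s ∂(stdNormalPi p) = 0) :
    ∫ s, setRemainder m G A s ^ 2 ∂(stdNormalPi p) ≤ ((stdNormalPi p).map G).real A := by
  refine (integral_hermiteRemainder_sq_le hm (memLp_indicator_comp hG hA) hlow).trans_eq ?_
  rw [← integral_indicator_comp hG hA]
  congr 1
  ext s
  by_cases h : G s ∈ A <;> simp [h]

lemma setRemainder_le_add (hG : Measurable G) (hA : MeasurableSet A) (hB : MeasurableSet B)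
    (hAB : A ⊆ B) {η : ℝ} (hη : 0 ≤ η) (hd : ((stdNormalPi p).map G).real (B \ A) ≤ η ^ 2)
    (s : Fin p → ℝ) :
    setRemainder m G A s ≤ setRemainder m G B s + η * hermiteEnvelope p m s := by
  refine hermiteRemainder_le_add (memLp_indicator_comp hG hA) (memLp_indicator_comp hG hB)
    (fun s => Set.indicator_le_indicator_of_subset hAB (fun _ => zero_le_one) _) hη ?_ s
  refine le_trans (le_of_eq ?_) hd
  rw [← integral_indicator_comp hG (hB.diff hA)]
  congr 1
  ext s
  by_cases h1 : G s ∈ A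
  · simp [h1, hAB h1]
  · by_cases h2 : G s ∈ B <;> simp [h1, h2]

lemma setRemainder_discreteOrthant (hG : Measurable G) {r : Fin q → ℝ → ℕ}
    (hr : ∀ i, Measurable (r i)) {K : ℕ} {a : Fin q → ℕ} (ha : ∀ i, a i < 2 ^ (K + 1))
    (s : Fin p → ℝ) :
    setRemainder m G (discreteOrthant r a) s = ∑ κ ∈ dyadicLevels q K,
      if ∀ i, (a i / 2 ^ κ i) % 2 = 1 then
        setRemainder m G (dyadicCell r κ fun i => a i / 2 ^ κ i - 1) s else 0 := by
  unfold setRemainder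
  simp_rw [indicator_discreteOrthant_eq_sum r ha]
  rw [hermiteRemainder_sum]
  · exact Finset.sum_congr rfl fun κ _ => hermiteRemainder_ite _ _
  · intro κ _
    split_ifs
    · exact memLp_indicator_comp hG (measurableSet_dyadicCell hr _ _)
    · exact MemLp.zero'

lemma measurableSet_lowerOrthant (x : Fin q → EReal) : MeasurableSet (lowerOrthant x) := by
  have : lowerOrthant x = ⋂ i, {y : Fin q → ℝ | (y i : EReal) ≤ x i} := by
    ext; simp [lowerOrthant]
  rw [this]
  exact MeasurableSet.iInter fun i =>
    measurableSet_le (measurable_coe_real_ereal.comp (measurable_pi_apply i)) measurable_const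

lemma lowerOrthant_coe (x : Fin q → ℝ) : lowerOrthant (fun i => (x i : EReal)) = Set.Iic x := by
  ext y; simp [lowerOrthant, Pi.le_def]

lemma sum_measureReal_dyadicCell_le_one (ν : Measure (Fin q → ℝ)) [IsProbabilityMeasure ν]
    {r : Fin q → ℝ → ℕ} (hr : ∀ i, Measurable (r i)) (κ : Fin q → ℕ) (S : Finset (Fin q → ℕ)) :
    ∑ c ∈ S, ν.real (dyadicCell r κ c) ≤ 1 := by
  rw [← measureReal_biUnion_finset]
  · exact measureReal_le_one
  · intro c _ c' _ hcc
    refine Set.disjoint_left.2 fun y hy hy' => hcc (funext fun i => ?_)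
    rw [← hy i, ← hy' i]
  · exact fun c _ => measurableSet_dyadicCell hr κ c

/-- The sum of squares over dyadic blocks and cells. -/
noncomputable def dyadicSquareSum {Ω : Type*} (X : ℕ → Ω → Fin p → ℝ) (m : ℕ)
    (G : (Fin p → ℝ) → Fin q → ℝ) (r : Fin q → ℝ → ℕ) (K N A : ℕ) (ω : Ω) : ℝ :=
  ∑ z ∈ Finset.range (K + 1) ×ˢ dyadicLevels q K,
    ∑ w ∈ Finset.range N ×ˢ Fintype.piFinset fun _ : Fin q => Finset.range A,
      (∑ j ∈ (Finset.range N).filter (fun j => j / 2 ^ z.1 = w.1),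
        setRemainder m G (dyadicCell r z.2 w.2) (X j ω)) ^ 2

end SetRemainder

/-! ### Second moments of block sums of set remainders -/

namespace IsStdGaussianSeq

variable {Ω : Type*} [MeasurableSpace Ω] {p q : ℕ} {μ : Measure Ω} {X : ℕ → Ω → Fin p → ℝ}
  {m : ℕ} {G : (Fin p → ℝ) → Fin q → ℝ}

lemma distFn_eq (h : IsStdGaussianSeq μ X) (hG : Measurable G) (x : Fin q → EReal) :
    distFn μ (fun ω => G (X 0 ω)) x =
      ∫ s, (lowerOrthant x).indicator (fun _ => (1 : ℝ)) (G s) ∂(stdNormalPi p) := by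
  have hx := measurableSet_lowerOrthant x
  rw [integral_indicator_comp hG hx, distFn, measureReal_def, measureReal_def,
    Measure.map_apply hG hx, ← (h.measurePreserving 0).map_eq,
    Measure.map_apply (h.meas 0) (hG hx)]
  rfl

lemma reductionTerm_eq (h : IsStdGaussianSeq μ X) (hG : Measurable G) (j : ℕ)
    (x : Fin q → EReal) (ω : Ω) :
    reductionTerm μ X G m j x ω = setRemainder m G (lowerOrthant x) (X j ω) := by
  have hJ : ∀ l, Jcoeff μ (X 0) G l x =
      ∫ s, (lowerOrthant x).indicator (fun _ => (1 : ℝ)) (G s) * hermiteMv l s ∂(stdNormalPi p) :=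
    fun l => h.integral_comp 0 (f := fun s =>
      (lowerOrthant x).indicator (fun _ => (1 : ℝ)) (G s) * hermiteMv l s)
      ((measurable_indicator_comp hG (measurableSet_lowerOrthant x)).mul
        (continuous_hermiteMv l).measurable)
  simp only [reductionTerm, setRemainder, hermiteRemainder, h.distFn_eq hG, hJ]
  rfl

/-- The Hermite coefficients of positive degree below the rank of the class vanish for the
indicators of all measurable sets. -/
lemma integral_indicator_mul_hermiteMv_eq_zero (h : IsStdGaussianSeq μ X) (hG : Measurable G)
    (hm : classHermiteRank μ (X 0) G = (m : ℕ∞)) {l : Fin p → ℕ} (hl0 : 0 < ∑ i, l i)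
    (hlm : ∑ i, l i < m) {A : Set (Fin q → ℝ)} (hA : MeasurableSet A) :
    ∫ s, A.indicator (fun _ => (1 : ℝ)) (G s) * hermiteMv l s ∂(stdNormalPi p) = 0 := by
  have hH := memLp_hermiteMv l
  have hH0 : ∫ s, hermiteMv l s ∂(stdNormalPi p) = 0 := by
    have := integral_hermiteMv_mul l (fun _ => 0)
    rw [if_neg (by rintro rfl; simp at hl0)] at this
    simpa [hermiteMv_zero] using this
  refine integral_indicator_mul_eq_zero hG (hH.integrable one_le_two) hH0 (fun x => ?_) hA
  have hrank : (m : ℕ∞) ≤ hermiteRank μ (X 0) fun s =>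
      orthantInd (fun i => (x i : EReal)) (G s)
        - distFn μ (fun ω => G (X 0 ω)) (fun i => (x i : EReal)) := by
    rw [← hm]; exact iInf_le _ x
  have hlt : ((∑ i, l i : ℕ) : ℕ∞) < m := by exact_mod_cast hlm
  obtain ⟨k, hk, hlk⟩ := lt_sSup_iff.1 (hlt.trans_le hrank)
  have h0 := hk l hlk
  have hO := measurableSet_lowerOrthant (fun i => (x i : EReal))
  have hI := memLp_indicator_comp (p := p) hG hO
  rw [hermiteCoeff, h.integral_comp 0 (f := fun s => (orthantInd (fun i => (x i : EReal)) (G s)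
        - distFn μ (fun ω => G (X 0 ω)) (fun i => (x i : EReal))) * hermiteMv l s)
      (((measurable_indicator_comp hG hO).sub_const _).mul
        (continuous_hermiteMv l).measurable)] at h0
  simp_rw [sub_mul] at h0
  -- The constant F(x) does not affect the coefficient, because H_l has mean zero in positive
  -- degree.
  have e := integral_sub (integrable_mul_of_memLp_two hI hH)
    ((hH.integrable one_le_two).const_mul
      (distFn μ (fun ω => G (X 0 ω)) (fun i => (x i : EReal))))
  rw [integral_const_mul, hH0, mul_zero, sub_zero, lowerOrthant_coe] at e
  rw [← e, ← lowerOrthant_coe]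
  exact h0

/-- R_A has no Hermite component of degree at most m, so its correlations decay like k^{-s} with a
constant proportional to ν(A); B does not depend on A or on the index set. -/
lemma exists_integral_sum_setRemainder_sq_le (h : IsStdGaussianSeq μ X) {D : ℝ} {L : ℝ → ℝ}
    (hL : SlowlyVarying L) {c : Fin p → Fin p → ℝ}
    (hlrd : ∀ i i', ∀ k : ℕ, 1 ≤ k →
      ∫ ω, X 0 ω i * X k ω i' ∂μ = c i i' * L (k : ℝ) * (k : ℝ) ^ (-D))
    (hG : Measurable G) (hm1 : 1 ≤ m) (hm : classHermiteRank μ (X 0) G = (m : ℕ∞))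
    {s : ℝ} (hs0 : 0 < s) (hs1 : s < 1) (hs : s < D * (m + 1)) :
    ∃ B : ℝ, 0 ≤ B ∧ ∀ A : Set (Fin q → ℝ), MeasurableSet A → ∀ (N : ℕ) (I : Finset ℕ),
      I ⊆ Finset.range N → ∫ ω, (∑ j ∈ I, setRemainder m G A (X j ω)) ^ 2 ∂μ ≤
        B * (((stdNormalPi p).map G).real A * (I.card * (N : ℝ) ^ (1 - s))) := by
  obtain ⟨B, hB, hcorr⟩ := h.exists_abs_integral_mul_le hL hlrd hs0 m hs
  have h1s : 0 < 1 - s := by linarith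
  refine ⟨2 * B / (1 - s), by positivity, fun A hA N I hI => ?_⟩
  have hlow := fun l hl0 hlm =>
    h.integral_indicator_mul_hermiteMv_eq_zero hG hm (l := l) hl0 hlm hA
  have hsq := integral_setRemainder_sq_le hm1 hG hA hlow
  refine (h.integral_sum_sq_le (A := B * ((stdNormalPi p).map G).real A)
    (measurable_setRemainder hG hA) (memLp_setRemainder hG hA) (by positivity) hs0 hs1
    (fun k => (hcorr _ (measurable_setRemainder hG hA) (memLp_setRemainder hG hA)
      (fun l hl => integral_hermiteRemainder_mul_eq_zero hm1 (memLp_indicator_comp hG hA)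
        hlow hl) k).trans ?_) hI).trans_eq (by ring)
  gcongr

lemma integrable_sum_setRemainder_sq (h : IsStdGaussianSeq μ X) (hG : Measurable G)
    {A : Set (Fin q → ℝ)} (hA : MeasurableSet A) (I : Finset ℕ) :
    Integrable (fun ω => (∑ j ∈ I, setRemainder m G A (X j ω)) ^ 2) μ :=
  (memLp_finsetSum I fun j _ => h.memLp_comp j (memLp_setRemainder hG hA)).integrable_sq

lemma integrable_dyadicSquareSum (h : IsStdGaussianSeq μ X) (hG : Measurable G)
    {r : Fin q → ℝ → ℕ} (hr : ∀ i, Measurable (r i)) (K N A : ℕ) :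
    Integrable (dyadicSquareSum X m G r K N A) μ :=
  integrable_finsetSum _ fun _ _ => integrable_finsetSum _ fun _ _ =>
    h.integrable_sum_setRemainder_sq hG (measurableSet_dyadicCell hr _ _) _

/-- At a fixed scale the cells are disjoint, with masses summing to at most 1, and the block lengths
sum to N. Each of the (K+1)^{q+1} scales therefore contributes at most B N N^{1-s}, no matter how
many boxes it has. -/
lemma integral_dyadicSquareSum_le (h : IsStdGaussianSeq μ X) (hG : Measurable G)
    {r : Fin q → ℝ → ℕ} (hr : ∀ i, Measurable (r i)) {B s : ℝ} (hB : 0 ≤ B)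
    (hblock : ∀ A : Set (Fin q → ℝ), MeasurableSet A → ∀ (N : ℕ) (I : Finset ℕ),
      I ⊆ Finset.range N → ∫ ω, (∑ j ∈ I, setRemainder m G A (X j ω)) ^ 2 ∂μ ≤
        B * (((stdNormalPi p).map G).real A * (I.card * (N : ℝ) ^ (1 - s)))) (K N A : ℕ) :
    ∫ ω, dyadicSquareSum X m G r K N A ω ∂μ ≤
      ((K : ℝ) + 1) ^ (q + 1) * (B * (N * (N : ℝ) ^ (1 - s))) := by
  have hν : IsProbabilityMeasure ((stdNormalPi p).map G) :=
    Measure.isProbabilityMeasure_map hG.aemeasurable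
  have hint := fun (z : ℕ × (Fin q → ℕ)) (w : ℕ × (Fin q → ℕ)) =>
    h.integrable_sum_setRemainder_sq (m := m) hG (measurableSet_dyadicCell hr z.2 w.2)
      ((Finset.range N).filter fun j => j / 2 ^ z.1 = w.1)
  unfold dyadicSquareSum
  rw [integral_finsetSum _ fun z _ => integrable_finsetSum _ fun w _ => hint z w]
  have hcard : ((Finset.range (K + 1) ×ˢ dyadicLevels q K).card : ℝ) = ((K : ℝ) + 1) ^ (q + 1) := by
    rw [Finset.card_product, card_dyadicLevels, Finset.card_range]
    push_cast
    ring
  rw [← hcard, ← nsmul_eq_mul]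
  refine Finset.sum_le_card_nsmul _ _ _ fun z _ => ?_
  rw [integral_finsetSum _ fun w _ => hint z w]
  refine (Finset.sum_le_sum fun w _ => hblock _ (measurableSet_dyadicCell hr z.2 w.2) N _
    (Finset.filter_subset _ _)).trans ?_
  rw [← Finset.mul_sum]
  refine mul_le_mul_of_nonneg_left ?_ hB
  rw [Finset.sum_product]
  have hcells := sum_measureReal_dyadicCell_le_one ((stdNormalPi p).map G) hr z.2
    (Fintype.piFinset fun _ : Fin q => Finset.range A)
  have hblocks : ∑ x ∈ Finset.range N,
      (((Finset.range N).filter fun j => j / 2 ^ z.1 = x).card : ℝ) = N := by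
    rw [← Nat.cast_sum, ← Finset.card_eq_sum_card_fiberwise (f := fun j => j / 2 ^ z.1),
      Finset.card_range]
    intro j hj
    simp only [Finset.coe_range, Set.mem_Iio] at hj ⊢
    exact (Nat.div_le_self _ _).trans_lt hj
  simp_rw [← Finset.sum_mul]
  rw [← Finset.mul_sum, ← Finset.sum_mul, hblocks]
  exact mul_le_of_le_one_left (by positivity) hcells

lemma integral_sum_hermiteEnvelope_sq_le (h : IsStdGaussianSeq μ X) (m N : ℕ) :
    ∫ ω, (∑ j ∈ Finset.range N, hermiteEnvelope p m (X j ω)) ^ 2 ∂μ ≤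
      (N : ℝ) ^ 2 * ∫ s, hermiteEnvelope p m s ^ 2 ∂(stdNormalPi p) := by
  have hi : ∀ j, Integrable (fun ω => hermiteEnvelope p m (X j ω) ^ 2) μ := fun j =>
    (h.memLp_comp j memLp_hermiteEnvelope).integrable_sq
  have hsum : Integrable (fun ω => (∑ j ∈ Finset.range N, hermiteEnvelope p m (X j ω)) ^ 2) μ :=
    (memLp_finsetSum _ fun j _ => h.memLp_comp j memLp_hermiteEnvelope).integrable_sq
  calc _ ≤ ∫ ω, (N : ℝ) * ∑ j ∈ Finset.range N, hermiteEnvelope p m (X j ω) ^ 2 ∂μ := by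
        refine integral_mono hsum ((integrable_finsetSum _ fun j _ => hi j).const_mul _)
          fun ω => ?_
        have := sq_sum_le_card_mul_sum_sq (s := Finset.range N)
          (f := fun j => hermiteEnvelope p m (X j ω))
        rwa [Finset.card_range] at this
    _ = _ := by
        rw [integral_const_mul, integral_finsetSum _ fun j _ => hi j]
        simp_rw [fun j => h.integral_comp j (f := fun s => hermiteEnvelope p m s ^ 2)
          (measurable_hermiteEnvelope.pow_const 2)]
        rw [Finset.sum_const, Finset.card_range, nsmul_eq_mul]
        ring

end IsStdGaussianSeq

/-! ### The maximal inequality -/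

section Maximal

variable {p q : ℕ}

/-- A discretization of `ℝ^q` in which all orthants are sandwiched between discrete ones. -/
lemma exists_discretization_pi (ν : Measure (Fin q → ℝ)) [IsProbabilityMeasure ν] (M : ℕ)
    (hM : 0 < M) :
    ∃ r : Fin q → ℝ → ℕ, (∀ i, Measurable (r i)) ∧ ∀ x : Fin q → EReal, ∃ a b : Fin q → ℕ,
      (∀ i, a i ≤ 2 * M + 1) ∧ (∀ i, b i ≤ 2 * M + 1) ∧ discreteOrthant r a ⊆ lowerOrthant x ∧
      lowerOrthant x ⊆ discreteOrthant r b ∧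
      ν.real (discreteOrthant r b \ discreteOrthant r a) ≤ q / M := by
  have hprob : ∀ i, IsProbabilityMeasure (ν.map fun y => y i) := fun i =>
    Measure.isProbabilityMeasure_map (measurable_pi_apply i).aemeasurable
  choose r hr hsand using fun i => exists_discretization (ν.map fun y => y i) M hM
  refine ⟨r, hr, fun x => ?_⟩
  choose a b ha hb hax hxb hν using fun i => hsand i (x i)
  refine ⟨a, b, ha, hb, fun y hy i => hax i (hy i), fun y hy i => hxb i (hy i), ?_⟩
  have hmeas : ∀ i, MeasurableSet ({y | r i y < b i} \ {y | r i y < a i}) := fun i =>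
    (measurableSet_lt (hr i) measurable_const).diff (measurableSet_lt (hr i) measurable_const)
  -- A point between the two orthants falls between a_i and b_i in some coordinate, so a union bound
  -- over q slabs of mass 1/M suffices.
  have hsub : discreteOrthant r b \ discreteOrthant r a ⊆
      ⋃ i ∈ (Finset.univ : Finset (Fin q)),
        (fun y : Fin q → ℝ => y i) ⁻¹' ({y | r i y < b i} \ {y | r i y < a i}) := by
    rintro y ⟨hyb, hya⟩
    obtain ⟨i, hi⟩ := not_forall.1 hya
    exact Set.mem_biUnion (Finset.mem_coe.2 (Finset.mem_univ i)) ⟨hyb i, hi⟩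
  calc _ ≤ ∑ i, ν.real ((fun y : Fin q → ℝ => y i) ⁻¹'
          ({y | r i y < b i} \ {y | r i y < a i})) :=
        (measureReal_mono hsub (measure_ne_top _ _)).trans (measureReal_biUnion_finset_le _ _)
    _ ≤ ∑ _i : Fin q, (1 / M : ℝ) := by
        refine Finset.sum_le_sum fun i _ => ?_
        have := hν i
        rwa [measureReal_def, Measure.map_apply (measurable_pi_apply i) (hmeas i),
          ← measureReal_def] at this
    _ = q / M := by simp; ring

/-- A bound for the maximum of all partial sums over initial segments and all orthants. -/
noncomputable def maximalBound {Ω : Type*} (X : ℕ → Ω → Fin p → ℝ) (m : ℕ)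
    (G : (Fin p → ℝ) → Fin q → ℝ) (r : Fin q → ℝ → ℕ) (K N A : ℕ) (η : ℝ) (ω : Ω) : ℝ :=
  2 * (((K : ℝ) + 1) ^ (q + 1) * dyadicSquareSum X m G r K N A ω) +
    2 * (η ^ 2 * (∑ j ∈ Finset.range N, hermiteEnvelope p m (X j ω)) ^ 2)

/-- With T the partial sum and V the envelope term, the sandwich gives T(a) - V ≤ T(x) ≤ T(b) + V.
The upper bound is squared when T(x) ≥ 0 and the lower one when T(x) ≤ 0; both discrete sums obey
the dyadic bound. -/
lemma sq_sum_setRemainder_lowerOrthant_le {Ω : Type*} {X : ℕ → Ω → Fin p → ℝ} {m : ℕ}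
    {G : (Fin p → ℝ) → Fin q → ℝ} (hG : Measurable G) {r : Fin q → ℝ → ℕ}
    (hr : ∀ i, Measurable (r i)) {K n N A : ℕ} (hn : n ≤ N) (hnK : n < 2 ^ (K + 1))
    (hAK : A < 2 ^ (K + 1)) {η : ℝ} (hη : 0 ≤ η) {x : Fin q → EReal} {a b : Fin q → ℕ}
    (ha : ∀ i, a i ≤ A) (hb : ∀ i, b i ≤ A) (hax : discreteOrthant r a ⊆ lowerOrthant x)
    (hxb : lowerOrthant x ⊆ discreteOrthant r b)
    (hd : ((stdNormalPi p).map G).real (discreteOrthant r b \ discreteOrthant r a) ≤ η ^ 2)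
    (ω : Ω) :
    (∑ j ∈ Finset.range n, setRemainder m G (lowerOrthant x) (X j ω)) ^ 2 ≤
      maximalBound X m G r K N A η ω := by
  have hν : IsProbabilityMeasure ((stdNormalPi p).map G) :=
    Measure.isProbabilityMeasure_map hG.aemeasurable
  have hx := measurableSet_lowerOrthant x
  have hma := measurableSet_discreteOrthant hr a
  have hmb := measurableSet_discreteOrthant hr b
  set V := η * ∑ j ∈ Finset.range N, hermiteEnvelope p m (X j ω) with hV
  set T : Set (Fin q → ℝ) → ℝ := fun A => ∑ j ∈ Finset.range n, setRemainder m G A (X j ω)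
  have hVn : η * ∑ j ∈ Finset.range n, hermiteEnvelope p m (X j ω) ≤ V := by
    refine mul_le_mul_of_nonneg_left ?_ hη
    exact Finset.sum_le_sum_of_subset_of_nonneg (Finset.range_mono hn)
      fun j _ _ => hermiteEnvelope_nonneg _
  have hmono : ∀ {A B : Set (Fin q → ℝ)}, MeasurableSet A → MeasurableSet B → A ⊆ B →
      B \ A ⊆ discreteOrthant r b \ discreteOrthant r a → T A ≤ T B + V := by
    intro A B hA hB hAB hsub
    refine le_trans ?_ (add_le_add_right hVn _)
    rw [Finset.mul_sum, ← Finset.sum_add_distrib]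
    exact Finset.sum_le_sum fun j _ => setRemainder_le_add hG hA hB hAB hη
      ((measureReal_mono hsub).trans hd) _
  have h1 := hmono hma hx hax (Set.sdiff_subset_sdiff_left hxb)
  have h2 := hmono hx hmb hxb (Set.sdiff_subset_sdiff_right hax)
  have hdisc : ∀ {a : Fin q → ℕ}, (∀ i, a i ≤ A) → T (discreteOrthant r a) ^ 2 ≤
      ((K : ℝ) + 1) ^ (q + 1) * dyadicSquareSum X m G r K N A ω := by
    intro a ha
    simp only [T]
    simp_rw [setRemainder_discreteOrthant hG hr fun i => (ha i).trans_lt hAK]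
    exact sq_sum_le_dyadic hn hnK ha fun κ c j => setRemainder m G (dyadicCell r κ c) (X j ω)
  have h3 := hdisc ha
  have h4 := hdisc hb
  rw [maximalBound, ← mul_pow, ← hV]
  change T (lowerOrthant x) ^ 2 ≤ _
  rcases le_total 0 (T (lowerOrthant x)) with hT | hT
  · nlinarith [sq_nonneg (T (discreteOrthant r b) - V)]
  · nlinarith [sq_nonneg (T (discreteOrthant r a) + V)]

end Maximal

namespace IsStdGaussianSeq

variable {Ω : Type*} [MeasurableSpace Ω] {p q : ℕ} {μ : Measure Ω} {X : ℕ → Ω → Fin p → ℝ}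
  {m : ℕ} {G : (Fin p → ℝ) → Fin q → ℝ}

lemma integrable_maximalBound (h : IsStdGaussianSeq μ X) (hG : Measurable G)
    {r : Fin q → ℝ → ℕ} (hr : ∀ i, Measurable (r i)) (K N A : ℕ) (η : ℝ) :
    Integrable (maximalBound X m G r K N A η) μ :=
  (((h.integrable_dyadicSquareSum hG hr K N A).const_mul _).const_mul _).add
    (((memLp_finsetSum _ fun j _ => h.memLp_comp j memLp_hermiteEnvelope).integrable_sq.const_mul
      _).const_mul _)

lemma integral_maximalBound_le (h : IsStdGaussianSeq μ X) (hG : Measurable G)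
    {r : Fin q → ℝ → ℕ} (hr : ∀ i, Measurable (r i)) {B s : ℝ} (hB : 0 ≤ B)
    (hblock : ∀ A : Set (Fin q → ℝ), MeasurableSet A → ∀ (N : ℕ) (I : Finset ℕ),
      I ⊆ Finset.range N → ∫ ω, (∑ j ∈ I, setRemainder m G A (X j ω)) ^ 2 ∂μ ≤
        B * (((stdNormalPi p).map G).real A * (I.card * (N : ℝ) ^ (1 - s)))) (K N A : ℕ)
    (η : ℝ) :
    ∫ ω, maximalBound X m G r K N A η ω ∂μ ≤
      2 * (((K : ℝ) + 1) ^ (q + 1) * (((K : ℝ) + 1) ^ (q + 1) * (B * (N * (N : ℝ) ^ (1 - s))))) +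
      2 * (η ^ 2 * ((N : ℝ) ^ 2 * ∫ s, hermiteEnvelope p m s ^ 2 ∂(stdNormalPi p))) := by
  unfold maximalBound
  rw [integral_add (((h.integrable_dyadicSquareSum hG hr K N A).const_mul _).const_mul _)
    (((memLp_finsetSum _ fun j _ => h.memLp_comp j memLp_hermiteEnvelope).integrable_sq.const_mul
      _).const_mul _), integral_const_mul, integral_const_mul, integral_const_mul,
    integral_const_mul]
  gcongr
  · exact h.integral_dyadicSquareSum_le hG hr hB hblock K N A
  · exact h.integral_sum_hermiteEnvelope_sq_le m N

/-- For every `N`, the squared maximal partial sum is dominated by a random variable whose mean is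
of order `N ^ (2 - s)` up to logarithmic factors. -/
lemma exists_sq_sum_reductionTerm_le (h : IsStdGaussianSeq μ X) (hG : Measurable G)
    {B s : ℝ} (hB : 0 ≤ B) (hs1 : s < 1)
    (hblock : ∀ A : Set (Fin q → ℝ), MeasurableSet A → ∀ (N : ℕ) (I : Finset ℕ),
      I ⊆ Finset.range N → ∫ ω, (∑ j ∈ I, setRemainder m G A (X j ω)) ^ 2 ∂μ ≤
        B * (((stdNormalPi p).map G).real A * (I.card * (N : ℝ) ^ (1 - s)))) :
    ∃ C : ℝ, 0 ≤ C ∧ ∀ N : ℕ, 1 ≤ N → ∃ Z : Ω → ℝ, Integrable Z μ ∧ (∀ ω, 0 ≤ Z ω) ∧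
      (∀ ω, ∀ n ≤ N, ∀ x : Fin q → EReal,
        (∑ j ∈ Finset.range n, reductionTerm μ X G m j x ω) ^ 2 ≤ Z ω) ∧
      ∫ ω, Z ω ∂μ ≤ C * ((Nat.log 2 (2 * N ^ 2 + 1) : ℝ) + 1) ^ (2 * (q + 1)) *
        (N : ℝ) ^ (2 - s) := by
  have hν : IsProbabilityMeasure ((stdNormalPi p).map G) :=
    Measure.isProbabilityMeasure_map hG.aemeasurable
  set E := ∫ s, hermiteEnvelope p m s ^ 2 ∂(stdNormalPi p) with hE
  have hE0 : 0 ≤ E := integral_nonneg fun _ => sq_nonneg _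
  refine ⟨2 * B + 2 * (q * E), by positivity, fun N hN => ?_⟩
  have hN0 : (0 : ℝ) < N := by exact_mod_cast hN
  -- Mesh N^{-2}: then η² = q/N² cancels the crude second moment of order N² of the summed envelope,
  -- while the number of levels is polynomial in N and costs only logarithms.
  obtain ⟨r, hr, hsand⟩ := exists_discretization_pi ((stdNormalPi p).map G) (N ^ 2) (by positivity)
  set K := Nat.log 2 (2 * N ^ 2 + 1)
  have hAK : 2 * N ^ 2 + 1 < 2 ^ (K + 1) := Nat.lt_pow_succ_log_self one_lt_two _
  set η : ℝ := Real.sqrt q / N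
  have hη : 0 ≤ η := by positivity
  have hη2 : η ^ 2 = q / ((N ^ 2 : ℕ) : ℝ) := by
    rw [div_pow, Real.sq_sqrt (Nat.cast_nonneg q)]; push_cast; rfl
  refine ⟨maximalBound X m G r K N (2 * N ^ 2 + 1) η, h.integrable_maximalBound hG hr _ _ _ _,
    fun ω => ?_, fun ω n hn x => ?_, ?_⟩
  · have : 0 ≤ dyadicSquareSum X m G r K N (2 * N ^ 2 + 1) ω :=
      Finset.sum_nonneg fun _ _ => Finset.sum_nonneg fun _ _ => sq_nonneg _
    unfold maximalBound
    positivity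
  · obtain ⟨a, b, ha, hb, hax, hxb, hd⟩ := hsand x
    simp_rw [h.reductionTerm_eq hG]
    refine sq_sum_setRemainder_lowerOrthant_le hG hr hn ?_ hAK hη ha hb hax hxb ?_ ω
    · nlinarith
    · rwa [hη2]
  · refine (h.integral_maximalBound_le hG hr hB hblock _ _ _ _).trans ?_
    have hpow : (N : ℝ) * (N : ℝ) ^ (1 - s) = (N : ℝ) ^ (2 - s) := by
      rw [show 2 - s = 1 + (1 - s) by ring, Real.rpow_add hN0, Real.rpow_one]
    have hqE : η ^ 2 * ((N : ℝ) ^ 2 * E) = q * E := by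
      rw [hη2]; push_cast; field_simp
    have h1 : 1 ≤ ((K : ℝ) + 1) ^ (2 * (q + 1)) :=
      one_le_pow₀ (by have : (0 : ℝ) ≤ K := Nat.cast_nonneg K; linarith)
    have h2 : 1 ≤ (N : ℝ) ^ (2 - s) :=
      Real.one_le_rpow (by exact_mod_cast hN) (by linarith)
    rw [hpow, hqE, pow_mul']
    rw [pow_mul'] at h1
    have h3 : q * E ≤ q * E * ((((K : ℝ) + 1) ^ (q + 1)) ^ 2 * (N : ℝ) ^ (2 - s)) :=
      le_mul_of_one_le_right (by positivity) (one_le_mul_of_one_le_of_one_le h1 h2)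
    linarith

end IsStdGaussianSeq

/-! ### Absorbing logarithms and the choice of exponents -/

lemma exists_log_pow_le_rpow {τ : ℝ} (hτ : 0 < τ) (d : ℕ) :
    ∃ C : ℝ, 0 < C ∧ ∀ N : ℕ, 1 ≤ N →
      ((Nat.log 2 (2 * N ^ 2 + 1) : ℝ) + 1) ^ d ≤ C * (N : ℝ) ^ τ := by
  -- Dividing by d + 1 gives σ d ≤ τ and also covers d = 0.
  set σ : ℝ := τ / (d + 1) with hσ
  have hσ0 : 0 < σ := by positivity
  have hlog2 : 0 < Real.log 2 := Real.log_pos one_lt_two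
  have hlog3 : 0 < Real.log 3 := Real.log_pos (by norm_num)
  set c : ℝ := (Real.log 3 + 2 / σ) / Real.log 2 + 1 with hc
  have hc0 : 0 < c := by positivity
  refine ⟨c ^ d, by positivity, fun N hN => ?_⟩
  have hN1 : (1 : ℝ) ≤ N := by exact_mod_cast hN
  have hNσ : 1 ≤ (N : ℝ) ^ σ := Real.one_le_rpow hN1 hσ0.le
  have h1 : ((Nat.log 2 (2 * N ^ 2 + 1) : ℝ) + 1) ≤ c * (N : ℝ) ^ σ := by
    have hk : (2 : ℝ) ^ Nat.log 2 (2 * N ^ 2 + 1) ≤ 3 * (N : ℝ) ^ 2 := by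
      have : 2 ^ Nat.log 2 (2 * N ^ 2 + 1) ≤ 3 * N ^ 2 :=
        (Nat.pow_log_le_self 2 (by omega)).trans (by nlinarith)
      exact_mod_cast this
    have hk2 := Real.log_le_log (by positivity) hk
    rw [Real.log_pow, Real.log_mul (by norm_num) (by positivity), Real.log_pow] at hk2
    have hlog := Real.log_le_rpow_div (Nat.cast_nonneg N) hσ0
    have : (Nat.log 2 (2 * N ^ 2 + 1) : ℝ) ≤
        (Real.log 3 + 2 / σ) / Real.log 2 * (N : ℝ) ^ σ := by
      rw [div_mul_eq_mul_div, le_div_iff₀ hlog2]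
      push_cast at hk2
      refine hk2.trans ?_
      rw [add_mul, div_mul_eq_mul_div, mul_div_assoc]
      gcongr
      exact le_mul_of_one_le_right hlog3.le hNσ
    rw [hc, add_mul, one_mul]
    linarith
  calc _ ≤ (c * (N : ℝ) ^ σ) ^ d := by gcongr
    _ = c ^ d * (N : ℝ) ^ (σ * d) := by rw [mul_pow, ← Real.rpow_mul_natCast (by positivity)]
    _ ≤ c ^ d * (N : ℝ) ^ τ := by
        refine mul_le_mul_of_nonneg_left (Real.rpow_le_rpow_of_exponent_le hN1 ?_) (by positivity)
        rw [hσ, div_mul_eq_mul_div, div_le_iff₀ (by positivity)]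
        nlinarith

theorem theorem4 {Ω : Type*} [MeasurableSpace Ω] (μ : Measure Ω) [IsProbabilityMeasure μ]
    (p q : ℕ) [NeZero p]
    -- a stationary `p`-dimensional Gaussian process
    (X : ℕ → Ω → Fin p → ℝ) (hXmeas : ∀ j, Measurable (X j))
    (hXgauss : IsGaussianProcess X μ) (hXstat : StationarySeq X μ)
    (hmean : ∀ i, ∫ ω, X 0 ω i ∂μ = 0)
    (hcov : ∀ i i', ∫ ω, X 0 ω i * X 0 ω i' ∂μ = if i = i' then 1 else 0)
    -- long-range dependence
    (D : ℝ) (hD : 0 < D) (hD1 : D < 1) (L : ℝ → ℝ) (hL : SlowlyVarying L)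
    (c : Fin p → Fin p → ℝ) (hc : c 0 0 ≠ 0)
    (hlrd : ∀ i i', ∀ k : ℕ, 1 ≤ k →
      ∫ ω, X 0 ω i * X k ω i' ∂μ = c i i' * L (k : ℝ) * (k : ℝ) ^ (-D))
    -- subordination, Hermite rank
    (G : (Fin p → ℝ) → (Fin q → ℝ)) (hG : Measurable G)
    (m : ℕ) (hm : classHermiteRank μ (X 0) G = (m : ℕ∞)) (hDm : D < 1 / (m : ℝ)) :
    ∃ C : ℝ, 0 < C ∧ ∃ κ : ℝ, 0 < κ ∧
      ∀ N : ℕ, 1 ≤ N → ∀ ε : ℝ, 0 < ε → ε ≤ 1 →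
        μ.real {ω | (ε : EReal) <
            ⨆ n ∈ Finset.Icc 1 N, ⨆ x : Fin q → EReal,
              (((dNorm μ X m N)⁻¹ *
                |∑ j ∈ Finset.range n, reductionTerm μ X G m j x ω| : ℝ) : EReal)}
          ≤ C * (N : ℝ) ^ (-κ) * (1 + ε ^ (-3 : ℤ)) := by
  have h : IsStdGaussianSeq μ X := ⟨hXmeas, hXgauss, hXstat, hmean, hcov⟩
  have hm1 : 1 ≤ m := by
    rw [Nat.one_le_iff_ne_zero]
    rintro rfl
    -- For m = 0 the quotient 1/m is 0 by convention, so D < 1/m contradicts D > 0.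
    simp at hDm
    linarith
  have hm0 : (0 : ℝ) < m := by exact_mod_cast hm1
  have hDm1 : D * m < 1 := (lt_div_iff₀ hm0).1 hDm
  -- The exponents satisfy Dm < t < s < min(1, D(m+1)): s governs the decay for the remainder and t
  -- the lower bound for d_N². The gap s - t is the gain.
  obtain ⟨s, hs, hs'⟩ := exists_between (lt_min hDm1 (show D * m < D * (m + 1) by linarith))
  obtain ⟨t, ht, hts⟩ := exists_between hs
  have hs1 : s < 1 := hs'.trans_le (min_le_left _ _)
  have hs0 : 0 < s := lt_trans (by positivity) hs
  obtain ⟨B, hB, hblock⟩ := h.exists_integral_sum_setRemainder_sq_le hL hlrd hG hm1 hm hs0 hs1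
    (hs'.trans_le (min_le_right _ _))
  obtain ⟨C₁, hC₁, hZ⟩ := h.exists_sq_sum_reductionTerm_le hG hB hs1 hblock
  obtain ⟨b, hb, N₀, hdN⟩ := h.exists_rpow_le_dNorm_sq hD hD1 hL hc (hlrd 0 0) hm1 ht
    (hts.trans hs1)
  have hκ : 0 < (s - t) / 2 := by linarith
  set κ := (s - t) / 2 with hκdef
  obtain ⟨C₂, hC₂, hlog⟩ := exists_log_pow_le_rpow hκ (2 * (q + 1))
  refine ⟨C₁ * C₂ / b + ((N₀ : ℝ) + 1) ^ κ, by positivity, κ, hκ, fun N hN ε hε hε1 => ?_⟩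
  have hN0 : (0 : ℝ) < N := by exact_mod_cast hN
  have hε3 : 1 ≤ ε ^ (-3 : ℤ) := one_le_zpow_of_nonpos₀ hε hε1 (by norm_num)
  -- For small N the lower bound for d_N is not available; the second summand of the constant makes
  -- the right-hand side at least 1.
  by_cases hNN : N < N₀
  · refine measureReal_le_one.trans ?_
    have h1 : 1 ≤ ((N₀ : ℝ) + 1) ^ κ * (N : ℝ) ^ (-κ) := by
      rw [Real.rpow_neg hN0.le, ← div_eq_mul_inv, le_div_iff₀ (by positivity), one_mul]
      refine Real.rpow_le_rpow hN0.le ?_ hκ.le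
      have : (N : ℝ) < N₀ := by exact_mod_cast hNN
      linarith
    have h2 : 1 ≤ (C₁ * C₂ / b + ((N₀ : ℝ) + 1) ^ κ) * (N : ℝ) ^ (-κ) := by
      refine h1.trans ?_
      gcongr
      exact le_add_of_nonneg_left (by positivity)
    exact one_le_mul_of_one_le_of_one_le h2 (by linarith)
  rw [not_lt] at hNN
  have hd2 := hdN N hNN
  have hpos : 0 < b * (N : ℝ) ^ (2 - t) := by positivity
  have hd : 0 < dNorm μ X m N := by
    refine (Real.sqrt_nonneg _).lt_of_ne fun h0 => ?_
    rw [dNorm, ← h0] at hd2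
    norm_num at hd2
    linarith
  obtain ⟨Z, hZi, hZ0, hZS, hZE⟩ := hZ N hN
  -- A supremum strictly above ε is witnessed by one pair (n, x), and `Z` dominates all pairs at
  -- once. Only monotonicity of the measure is used, so the supremum need not be measurable.
  have hsub : {ω | (ε : EReal) < ⨆ n ∈ Finset.Icc 1 N, ⨆ x : Fin q → EReal,
      (((dNorm μ X m N)⁻¹ *
        |∑ j ∈ Finset.range n, reductionTerm μ X G m j x ω| : ℝ) : EReal)} ⊆
      {ω | ε ^ 2 * (b * (N : ℝ) ^ (2 - t)) ≤ Z ω} := by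
    intro ω hω
    rw [Set.mem_ofPred_eq] at hω
    obtain ⟨n, hω⟩ := lt_iSup_iff.1 hω
    obtain ⟨hn, hω⟩ := lt_iSup_iff.1 hω
    obtain ⟨x, hω⟩ := lt_iSup_iff.1 hω
    rw [EReal.coe_lt_coe_iff, inv_mul_eq_div, lt_div_iff₀ hd] at hω
    calc ε ^ 2 * (b * (N : ℝ) ^ (2 - t)) ≤ ε ^ 2 * dNorm μ X m N ^ 2 := by gcongr
      _ = (ε * dNorm μ X m N) ^ 2 := by ring
      _ ≤ |∑ j ∈ Finset.range n, reductionTerm μ X G m j x ω| ^ 2 := by gcongr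
      _ = (∑ j ∈ Finset.range n, reductionTerm μ X G m j x ω) ^ 2 := sq_abs _
      _ ≤ Z ω := hZS ω n (Finset.mem_Icc.1 hn).2 x
  have hmarkov := mul_meas_ge_le_integral_of_nonneg (Eventually.of_forall hZ0) hZi
    (ε ^ 2 * (b * (N : ℝ) ^ (2 - t)))
  -- With κ = (s - t)/2, half of the gain N^{-(s-t)} pays for the logarithms bounded by N^κ, and the
  -- other half remains as the rate.
  have hpow : (N : ℝ) ^ κ * (N : ℝ) ^ (2 - s) = (N : ℝ) ^ (-κ) * (N : ℝ) ^ (2 - t) := by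
    rw [← Real.rpow_add hN0, ← Real.rpow_add hN0]
    congr 1
    rw [hκdef]; ring
  have hEZ : ∫ ω, Z ω ∂μ ≤ C₁ * C₂ * ((N : ℝ) ^ (-κ) * (N : ℝ) ^ (2 - t)) := by
    refine hZE.trans ?_
    rw [← hpow]
    calc _ ≤ C₁ * (C₂ * (N : ℝ) ^ κ) * (N : ℝ) ^ (2 - s) := by gcongr; exact hlog N hN
      _ = _ := by ring
  have hε2 : ε ^ (-2 : ℤ) ≤ ε ^ (-3 : ℤ) :=
    zpow_le_zpow_right_of_le_one₀ hε hε1 (by norm_num)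
  calc _ ≤ μ.real {ω | ε ^ 2 * (b * (N : ℝ) ^ (2 - t)) ≤ Z ω} := measureReal_mono hsub
    _ ≤ C₁ * C₂ * ((N : ℝ) ^ (-κ) * (N : ℝ) ^ (2 - t)) / (ε ^ 2 * (b * (N : ℝ) ^ (2 - t))) := by
        rw [le_div_iff₀ (by positivity), mul_comm]
        exact hmarkov.trans hEZ
    _ = C₁ * C₂ / b * (N : ℝ) ^ (-κ) * ε ^ (-2 : ℤ) := by
        rw [zpow_neg]
        norm_cast
        field_simp
    _ ≤ (C₁ * C₂ / b + ((N₀ : ℝ) + 1) ^ κ) * (N : ℝ) ^ (-κ) * (1 + ε ^ (-3 : ℤ)) := by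
        gcongr
        · exact le_add_of_nonneg_right (by positivity)
        · linarith
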